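/- Notation. Let $d\ge 0$ and $T^\bullet\mathbb{R}^d=\{(x,\xi)\in\mathbb{R}^d\times\mathbb{R}^d:\xi\neq0\}$. For $\chi\in\mathcal{D}(\mathbb{R}^d)$ and $t\in\mathcal{D}'(\mathbb{R}^d)$ let $\widehat{t\chi}(\xi)=\langle t,\chi e^{-ix\cdot\xi}\rangle$, and let $\theta(\xi)=1+|\xi|$. For a closed conic set $\Gamma\subset T^\bullet\mathbb{R}^d$ let $\mathcal{D}'_\Gamma$ be the set of distributions on $\mathbb{R}^d$ with wave front set in $\Gamma$, with the topology defined by the seminorms $t\mapsto|\langle t,\varphi\rangle|$, $\varphi\in\mathcal{D}(\mathbb{R}^d)$, and $\|t\|_{N,V,\chi}=\sup_{\xi\in V}(1+|\xi|)^N|\widehat{t\chi}(\xi)|$, for $N\in\mathbb{N}$, $\chi\in\mathcal{D}(\mathbb{R}^d)$ and closed cones $V\subset\mathbb{R}^d\setminus\{0\}$ such that $(\operatorname{supp}\chi\times V)\cap\Gamma=\emptyset$. A subset of $\mathcal{D}'_\Gamma$ is bounded if each of these seminorms is bounded on it. A distribution $t$ is called the product $t_1t_2$ of $t_1$ and $t_2$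 if every point has a neighbourhood $U$ such that for all $\chi\in\mathcal{D}(U)$ and all $\xi$ the integral $\int\widehat{t_1\chi}(\xi-\eta)\,\widehat{t_2\chi}(\eta)\,d\eta$ converges absolutely and equals $(2\pi)^d\,\widehat{t\chi^2}(\xi)$. Theorem. Let $\Gamma_1,\Gamma_2\subset T^\bullet\mathbb{R}^d$ be closed conic sets with $\Gamma_1\cap-\Gamma_2=\emptyset$, where $-\Gamma_2=\{(x,-\xi):(x,\xi)\in\Gamma_2\}$. Put $\Gamma=\Gamma_1\cup\Gamma_2\cup(\Gamma_1+\Gamma_2)$, where $\Gamma_1+\Gamma_2=\{(x,\xi_1+\xi_2):(x,\xi_1)\in\Gamma_1,(x,\xi_2)\in\Gamma_2\}$. Then: 1. (Well defined.) For all $t_1\in\mathcal{D}'_{\Gamma_1}$ and $t_2\in\mathcal{D}'_{\Gamma_2}$ the product $t_1t_2$ exists, is unique, and belongs to $\mathcal{D}'_\Gamma$. 2. (Bounded.) If $B_1\subset\mathcal{D}'_{\Gamma_1}$ and $B_2\subset\mathcal{D}'_{\Gamma_2}$ are bounded, then $\{t_1t_2:t_1\in B_1,t_2\in B_2\}$ is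 bounded in $\mathcal{D}'_\Gamma$. 3. (First bilinear estimate.) There are a locally finite smooth partition of unity $(\varphi_j^2)_{j\in\mathbb{N}}$ of $\mathbb{R}^d$ with real-valued $\varphi_j\in\mathcal{D}(\mathbb{R}^d)$, and closed cones $V_{j1},V_{j2}\subset\mathbb{R}^d\setminus\{0\}$ with $(\operatorname{supp}\varphi_j\times V_{jk})\cap\Gamma_k=\emptyset$ for $k=1,2$, such that for all $m_1,m_2\in\mathbb{N}$, all $\chi\in\mathcal{D}(\mathbb{R}^d)$ and all $N_1\ge m_2+d+1$, $N_2\ge m_1+d+1$ there is a constant $C$ such that $$\|\theta^{-(m_1+m_2+d)}\widehat{t_1t_2\chi^2}\|_{L^\infty}\le C\sum_j\left(\|\theta^{-m_1}\widehat{t_1\chi\varphi_j}\|_{L^\infty}+\|t_1\chi\|_{N_1,V_{j1},\varphi_j}\right)\left(\|\theta^{-m_2}\widehat{t_2\chi\varphi_j}\|_{L^\infty}+\|t_2\chi\|_{N_2,V_{j2},\varphi_j}\right)$$ for all $(t_1,t_2)\in\mathcal{D}'_{\Gamma_1}\times\mathcal{D}'_{\Gamma_2}$ such that $\|\theta^{-m_k}\widehat{t_k\chi\varphi_j}\|_{L^\infty}<\infty$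 for all $j$ and $k=1,2$. 4. (Second bilinear estimate.) For every closed cone $V\subset\mathbb{R}^d\setminus\{0\}$ and every $\chi\in\mathcal{D}(\mathbb{R}^d)$ with $(\operatorname{supp}\chi^2\times V)\cap\Gamma=\emptyset$ there are $(\varphi_j)$, $V_{j1}$, $V_{j2}$ with the properties listed in 3 such that for all $m_1,m_2\in\mathbb{N}$ and all $N\ge\max(m_1,m_2)+d+1$ there is a constant $C$ such that $$\|t_1t_2\|_{N,V,\chi^2}\le C\sum_j\Big(\|t_2\chi\|_{2N,V_{j2},\varphi_j}\|\theta^{-m_1}\widehat{t_1\varphi_j\chi}\|_{L^\infty}+\|t_1\chi\|_{2N,V_{j1},\varphi_j}\|\theta^{-m_2}\widehat{t_2\varphi_j\chi}\|_{L^\infty}+\|t_1\chi\|_{2N,V_{j1},\varphi_j}\|t_2\chi\|_{N,V_{j2},\varphi_j}\Big)$$ for all $(t_1,t_2)\in\mathcal{D}'_{\Gamma_1}\times\mathcal{D}'_{\Gamma_2}$ such that $\|\theta^{-m_k}\widehat{t_k\chi}\|_{L^\infty}<\infty$ for $k=1,2$. 5. (Sequential continuity.) The map $\mathcal{D}'_{\Gamma_1}\times\mathcal{D}'_{\Gamma_2}\to\mathcal{D}'_\Gamma$,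 $(t_1,t_2)\mapsto t_1t_2$, is jointly, and hence separately, sequentially continuous. -/

import Mathlib

open Set Filter Topology MeasureTheory TopologicalSpace
open scoped NNReal ENNReal ContDiff Distributions

namespace Microlocal

/-- Euclidean space `ℝᵈ`; covectors are identified with vectors through the inner product, so that
`E d × E d` is the cotangent space `T*ℝᵈ`. -/
abbrev E (d : ℕ) : Type := EuclideanSpace ℝ (Fin d)

/-- Complex valued test functions on `ℝᵈ`. -/
abbrev TestFun (d : ℕ) : Type := 𝓓((⊤ : Opens (E d)), ℂ)

/-- Complex valued distributions on `ℝᵈ` (Mathlib's notion: continuous real-linear maps from real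
test functions to `ℂ`). -/
abbrev Distr (d : ℕ) : Type := 𝓓'((⊤ : Opens (E d)), ℂ)

/-- The pairing `⟨t, φ⟩` with a complex test function: the complex-linear extension of `t`. -/
noncomputable def pairing {d : ℕ} (t : Distr d) (φ : TestFun d) : ℂ :=
  t (TestFunction.postcompCLM Complex.reCLM φ) +
    Complex.I * t (TestFunction.postcompCLM Complex.imCLM φ)

/-- The test function `g χ`, for `g` smooth and `χ` a test function. -/
noncomputable def mulSmooth {d : ℕ} (g : E d → ℂ) (hg : ContDiff ℝ ∞ g) (χ : TestFun d) :
    TestFun d where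
  toFun := fun x => g x * χ x
  contDiff' := hg.mul χ.contDiff
  hasCompactSupport' := χ.hasCompactSupport.mul_left
  tsupport_subset' := fun _ _ => trivial

/-- The product of two test functions. -/
noncomputable def mulTest {d : ℕ} (χ φ : TestFun d) : TestFun d := mulSmooth χ χ.contDiff φ

/-- The character `x ↦ exp (-i x·ξ)`. -/
noncomputable def character {d : ℕ} (ξ x : E d) : ℂ :=
  Complex.exp (-(Complex.I * ((inner ℝ x ξ : ℝ) : ℂ)))

theorem contDiff_character {d : ℕ} (ξ : E d) : ContDiff ℝ ∞ (character ξ) := by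
  unfold character
  have h : ContDiff ℝ ∞ (fun x : E d => ((inner ℝ x ξ : ℝ) : ℂ)) :=
    Complex.ofRealCLM.contDiff.comp (contDiff_id.inner ℝ contDiff_const)
  exact (contDiff_const.mul h).neg.cexp

/-- The Fourier transform of the compactly supported distribution `t χ`, namely
`ξ ↦ ⟨t, χ exp (-i x·ξ)⟩`. -/
noncomputable def fourierCut {d : ℕ} (t : Distr d) (χ : TestFun d) (ξ : E d) : ℂ :=
  pairing t (mulSmooth (character ξ) (contDiff_character ξ) χ)

/-- `‖t‖_{N,V,χ} = sup_{ξ ∈ V} (1 + |ξ|)^N |(tχ)^(ξ)|`, with value `∞` if the supremum is not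
finite. -/
noncomputable def coneNorm {d : ℕ} (N : ℕ) (V : Set (E d)) (χ : TestFun d) (t : Distr d) : ℝ≥0∞ :=
  ⨆ ξ ∈ V, ENNReal.ofReal ((1 + ‖ξ‖) ^ N * ‖fourierCut t χ ξ‖)

/-- `‖θ^{-m} (tχ)^‖_{L^∞}` with `θ(ξ) = 1 + |ξ|`; the function is continuous, so that the essential
supremum is the supremum. -/
noncomputable def orderNorm {d : ℕ} (m : ℕ) (χ : TestFun d) (t : Distr d) : ℝ≥0∞ :=
  ⨆ ξ : E d, ENNReal.ofReal (((1 + ‖ξ‖) ^ m)⁻¹ * ‖fourierCut t χ ξ‖)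

/-- The wave front set: a covector `(x, ξ)`, `ξ ≠ 0`, does not belong to it iff, for some cutoff `χ`
with `χ x ≠ 0`, the Fourier transform of `t χ` decays rapidly in an open conic neighbourhood `V`
of `ξ`. -/
def wavefrontSet {d : ℕ} (t : Distr d) : Set (E d × E d) :=
  {p | p.2 ≠ 0 ∧ ¬ ∃ (χ : TestFun d) (V : Set (E d)), χ p.1 ≠ 0 ∧ IsOpen V ∧ p.2 ∈ V ∧
    (∀ ξ ∈ V, ∀ c : ℝ, 0 < c → c • ξ ∈ V) ∧ ∀ N : ℕ, coneNorm N V χ t < ⊤}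

/-- Closed cones of `ℝᵈ \ {0}` (closed relatively to `ℝᵈ \ {0}`). -/
structure IsClosedCone {d : ℕ} (V : Set (E d)) : Prop where
  ne_zero : ∀ ξ ∈ V, ξ ≠ 0
  smul_mem : ∀ ξ ∈ V, ∀ c : ℝ, 0 < c → c • ξ ∈ V
  closed : closure V ∩ {ξ | ξ ≠ 0} ⊆ V

/-- Closed conic subsets of the cotangent space with the zero section removed (closed relatively to
it). -/
structure IsClosedConic {d : ℕ} (Γ : Set (E d × E d)) : Prop where
  ne_zero : ∀ p ∈ Γ, p.2 ≠ 0
  smul_mem : ∀ p ∈ Γ, ∀ c : ℝ, 0 < c → (p.1, c • p.2) ∈ Γ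
  closed : closure Γ ∩ {p | p.2 ≠ 0} ⊆ Γ

/-- The fibrewise sum `Γ₁ + Γ₂`. -/
def fiberSum {d : ℕ} (Γ₁ Γ₂ : Set (E d × E d)) : Set (E d × E d) :=
  {p | ∃ ξ₁ ξ₂ : E d, (p.1, ξ₁) ∈ Γ₁ ∧ (p.1, ξ₂) ∈ Γ₂ ∧ p.2 = ξ₁ + ξ₂}

/-- The fibrewise opposite `-Γ`. -/
def fiberNeg {d : ℕ} (Γ : Set (E d × E d)) : Set (E d × E d) := {p | (p.1, -p.2) ∈ Γ}

/-- The cone `Γ₁ ∪ Γ₂ ∪ (Γ₁ + Γ₂)`. -/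
def prodCone {d : ℕ} (Γ₁ Γ₂ : Set (E d × E d)) : Set (E d × E d) := Γ₁ ∪ Γ₂ ∪ fiberSum Γ₁ Γ₂

/-- `V` and `χ` index a seminorm `‖·‖_{N,V,χ}` of `D'_Γ`: `V` is a closed cone and
`(supp χ × V) ∩ Γ = ∅`. -/
def IsAdmissible {d : ℕ} (Γ : Set (E d × E d)) (V : Set (E d)) (χ : TestFun d) : Prop :=
  IsClosedCone V ∧ (tsupport χ ×ˢ V) ∩ Γ = ∅

/-- The space `D'_Γ` of distributions with wave front set in `Γ`. -/
@[ext]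
structure DPrime {d : ℕ} (Γ : Set (E d × E d)) where
  toDistr : Distr d
  wavefrontSet_subset : wavefrontSet toDistr ⊆ Γ

/-- The topology of `D'_Γ` given by the seminorms `‖·‖_{N,V,χ}` and `t ↦ |⟨t, φ⟩|`: the coarsest
topology for which all functions `t ↦ ‖t - s‖_{N,V,χ}`, `s ∈ D'_Γ`, and `t ↦ ⟨t, φ⟩` are
continuous. -/
noncomputable instance {d : ℕ} (Γ : Set (E d × E d)) : TopologicalSpace (DPrime Γ) :=
  (⨅ (N : ℕ) (V : Set (E d)) (χ : TestFun d) (_ : IsAdmissible Γ V χ) (s : DPrime Γ),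
    induced (fun t : DPrime Γ => coneNorm N V χ (t.toDistr - s.toDistr)) inferInstance) ⊓
  ⨅ φ : TestFun d, induced (fun t : DPrime Γ => pairing t.toDistr φ) inferInstance

/-- Bounded subsets of `D'_Γ`: bounded in `D'` (against every test function) and for every seminorm
`‖·‖_{N,V,χ}` of `D'_Γ`. -/
def IsBddIn {d : ℕ} {Γ : Set (E d × E d)} (B : Set (DPrime Γ)) : Prop :=
  (∀ φ : TestFun d, ∃ C : ℝ, ∀ t ∈ B, ‖pairing t.toDistr φ‖ ≤ C) ∧
  ∀ (N : ℕ) (V : Set (E d)) (χ : TestFun d), IsAdmissible Γ V χ →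
    ∃ C : ℝ≥0, ∀ t ∈ B, coneNorm N V χ t.toDistr ≤ C

/-- `t` is the product of `t₁` and `t₂`: every point has a neighbourhood `U` such that for every
cutoff `χ` supported in `U` the Fourier transform of `χ² t` is `(2π)^{-d}` times the (absolutely
convergent) convolution of the Fourier transforms of `χ t₁` and `χ t₂`. -/
def IsProduct {d : ℕ} (t₁ t₂ t : Distr d) : Prop :=
  ∀ x : E d, ∃ U ∈ 𝓝 x, ∀ χ : TestFun d, tsupport χ ⊆ U → ∀ ξ : E d,
    Integrable (fun η : E d => fourierCut t₁ χ (ξ - η) * fourierCut t₂ χ η) ∧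
    fourierCut t (mulTest χ χ) ξ =
      ((((2 * Real.pi) ^ d)⁻¹ : ℝ) : ℂ) *
        ∫ η : E d, fourierCut t₁ χ (ξ - η) * fourierCut t₂ χ η

/-- A locally finite smooth partition of unity `(φⱼ²)` with real valued `φⱼ ∈ D(ℝᵈ)`, and closed
cones `V₁ⱼ`, `V₂ⱼ` such that `(Vₖⱼ, φⱼ)` indexes seminorms of `D'_{Γₖ}`. -/
structure IsConicPartition {d : ℕ} (Γ₁ Γ₂ : Set (E d × E d)) (φ : ℕ → TestFun d)
    (V₁ V₂ : ℕ → Set (E d)) : Prop where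
  real : ∀ j x, (φ j x).im = 0
  locallyFinite : LocallyFinite fun j => tsupport (φ j)
  sum_sq : ∀ x, ∑ᶠ j, φ j x ^ 2 = 1
  admissible₁ : ∀ j, IsAdmissible Γ₁ (V₁ j) (φ j)
  admissible₂ : ∀ j, IsAdmissible Γ₂ (V₂ j) (φ j)

end Microlocal

namespace Microlocal

variable {d : ℕ}

/-! ### Test functions, characters and the pairing -/

/-! Locally the product is the convolution of the Fourier transforms of `t₁χ` and `t₂χ`, so
everything reduces to estimates of `∫ |a(ξ - η)| |b(η)| dη` where `a`, `b` grow polynomially and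
decay rapidly in closed cones `V₁`, `V₂`.

Near a point `x`, take for `Vₖ` the covectors at relative distance at least `δ` from the fibre of
`Γₖ` over `x`. Since `Γ₁ ∩ -Γ₂ = ∅`, compactness of the sphere gives `ε(|a| + |b|) ≤ |a + b|` for `a
∉ V₁`, `b ∉ V₂`, and the same bound for `|a + b - v|` when `v` lies in a closed cone avoiding `Γ`
over `x` (`exists_localCones`). Split the integral according to whether `ξ - η ∈ V₁` and `η ∈ V₂`.
In `V₁` or in `V₂` decay beats growth. Outside both, `η` lies in a ball of radius `|ξ|/ε`, which
costs `d` extra powers (`exists_lintegral_conv_le_wt`), and this region is empty when `ξ` lies in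
the test cone (`exists_lintegral_conv_le_inv_wt`). These two estimates give the growth and the wave
front set of the product, and both bilinear estimates.

The local definitions are compatible because a cutoff `g` can be moved from one factor of the
convolution to the other (`cutConv_mulTest_move`): both positions amount to convolving with `ĝ`. A
partition of unity by squares then glues them (`LocalPartition.isLocalProduct`); polarization of
`χ²` gives uniqueness.

Three facts about distributions are needed. The transform of `t g χ` is `(2π)^{-d}` times the
convolution of `ĝ` with that of `tχ` (`fourierCut_mulTest`), proved by extending `t` to a Banach
space of jets. The seminorms of `D'_Γ` are finite (`coneNorm_lt_top_of_isAdmissible`), by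
compactness in directions and then in positions. Weakly bounded sets have locally uniform order and
weakly null sequences are null in some weighted sup norm (`exists_uniform_norm_fourierCut_le`,
`exists_tendsto_norm_fourierCut_le`), by Banach–Steinhaus on `ℓ¹` and dominated convergence. The
last fact turns the estimates into boundedness and sequential continuity. -/

@[simp] theorem mulSmooth_apply (g : E d → ℂ) (hg : ContDiff ℝ ∞ g) (χ : TestFun d) (x : E d) :
    mulSmooth g hg χ x = g x * χ x := rfl

@[simp] theorem mulTest_apply (χ φ : TestFun d) (x : E d) : mulTest χ φ x = χ x * φ x := rfl

theorem mulTest_comm (χ φ : TestFun d) : mulTest χ φ = mulTest φ χ := by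
  ext x; simp [mul_comm]

theorem mulTest_assoc (χ φ ψ : TestFun d) :
    mulTest (mulTest χ φ) ψ = mulTest χ (mulTest φ ψ) := by
  ext x; simp [mul_assoc]

theorem tsupport_mulTest_left (χ φ : TestFun d) : tsupport (mulTest χ φ) ⊆ tsupport χ :=
  closure_mono fun x hx => by
    simp only [Function.mem_support, mulTest_apply] at hx ⊢
    exact left_ne_zero_of_mul hx

theorem tsupport_mulTest_right (χ φ : TestFun d) : tsupport (mulTest χ φ) ⊆ tsupport φ := by
  rw [mulTest_comm]; exact tsupport_mulTest_left φ χ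

theorem tsupport_mulTest_self (χ : TestFun d) : tsupport (mulTest χ χ) = tsupport χ := by
  unfold tsupport
  congr 1
  ext x
  simp

theorem tsupport_mulSmooth (g : E d → ℂ) (hg : ContDiff ℝ ∞ g) (χ : TestFun d) :
    tsupport (mulSmooth g hg χ) ⊆ tsupport χ :=
  closure_mono fun x hx => by
    simp only [Function.mem_support, mulSmooth_apply] at hx ⊢
    exact right_ne_zero_of_mul hx

theorem character_add (ξ η x : E d) : character (ξ + η) x = character ξ x * character η x := by
  simp only [character, ← Complex.exp_add, inner_add_right]
  congr 1
  push_cast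
  ring

@[simp] theorem character_zero (x : E d) : character 0 x = 1 := by simp [character]

@[simp] theorem norm_character (ξ x : E d) : ‖character ξ x‖ = 1 := by
  rw [character, ← mul_neg, ← Complex.ofReal_neg, mul_comm]
  exact Complex.norm_exp_ofReal_mul_I _

theorem continuous_character : Continuous fun p : E d × E d => character p.1 p.2 := by
  unfold character
  fun_prop

/-- The pairing as a linear form on complex test functions. -/
noncomputable def pairingL (t : Distr d) : TestFun d →ₗ[ℂ] ℂ where
  toFun := pairing t
  map_add' φ ψ := by simp only [pairing, map_add]; ring
  map_smul' c φ := by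
    have h1 : TestFunction.postcompCLM Complex.reCLM (c • φ)
        = c.re • TestFunction.postcompCLM Complex.reCLM φ
          - c.im • TestFunction.postcompCLM Complex.imCLM φ := by
      ext x
      change (c * φ x).re = c.re * (φ x).re - c.im * (φ x).im
      simp
    have h2 : TestFunction.postcompCLM Complex.imCLM (c • φ)
        = c.re • TestFunction.postcompCLM Complex.imCLM φ
          + c.im • TestFunction.postcompCLM Complex.reCLM φ := by
      ext x
      change (c * φ x).im = c.re * (φ x).im + c.im * (φ x).re
      simp
    simp only [pairing, h1, h2, map_add, map_sub, map_smul, Complex.real_smul, RingHom.id_apply,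
      smul_eq_mul]
    conv_rhs => rw [← Complex.re_add_im c]
    linear_combination (-(c.im : ℂ) * t (TestFunction.postcompCLM Complex.imCLM φ)) * Complex.I_sq

theorem pairingL_apply (t : Distr d) (φ : TestFun d) : pairingL t φ = pairing t φ := rfl

theorem pairing_add (t : Distr d) (φ ψ : TestFun d) :
    pairing t (φ + ψ) = pairing t φ + pairing t ψ := (pairingL t).map_add φ ψ

theorem pairing_smul (t : Distr d) (c : ℂ) (φ : TestFun d) :
    pairing t (c • φ) = c * pairing t φ := (pairingL t).map_smul c φ

theorem pairing_sum {ι : Type*} (t : Distr d) (s : Finset ι) (φ : ι → TestFun d) :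
    pairing t (∑ i ∈ s, φ i) = ∑ i ∈ s, pairing t (φ i) := map_sum (pairingL t) φ s

theorem pairing_sub_left (t s : Distr d) (φ : TestFun d) :
    pairing (t - s) φ = pairing t φ - pairing s φ := by
  simp only [pairing, sub_apply]; ring

theorem sum_apply_testFun {ι : Type*} (s : Finset ι) (φ : ι → TestFun d) (x : E d) :
    (∑ i ∈ s, φ i) x = ∑ i ∈ s, φ i x := by
  classical
  induction s using Finset.induction_on with
  | empty => simp
  | insert a s ha ih => rw [Finset.sum_insert ha, Finset.sum_insert ha, ← ih]; rfl

/-- Real test functions as complex ones. -/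
noncomputable def ofRealTest (f : 𝓓((⊤ : Opens (E d)), ℝ)) : TestFun d :=
  TestFunction.postcompCLM Complex.ofRealCLM f

theorem pairing_ofRealTest (t : Distr d) (f : 𝓓((⊤ : Opens (E d)), ℝ)) :
    pairing t (ofRealTest f) = t f := by
  have h1 : TestFunction.postcompCLM Complex.reCLM (ofRealTest f) = f := by
    ext x; change ((f x : ℂ)).re = f x; simp
  have h2 : TestFunction.postcompCLM Complex.imCLM (ofRealTest f) = 0 := by
    ext x; change ((f x : ℂ)).im = 0; simp
  simp [pairing, h1, h2]

theorem distr_ext {t s : Distr d} (h : ∀ φ : TestFun d, pairing t φ = pairing s φ) : t = s := by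
  ext f
  rw [← pairing_ofRealTest, ← pairing_ofRealTest, h]

/-! ### Algebraic properties of the localized Fourier transform -/

theorem fourierCut_zero_right (t : Distr d) (χ : TestFun d) : fourierCut t χ 0 = pairing t χ := by
  unfold fourierCut
  congr 1
  ext x; simp

theorem fourierCut_mulSmooth_character (t : Distr d) (χ : TestFun d) (ζ ξ : E d) :
    fourierCut t (mulSmooth (character ζ) (contDiff_character ζ) χ) ξ = fourierCut t χ (ξ + ζ) := by
  unfold fourierCut
  congr 1
  ext x; simp [character_add, mul_assoc]

theorem fourierCut_add (t : Distr d) (χ ψ : TestFun d) (ξ : E d) :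
    fourierCut t (χ + ψ) ξ = fourierCut t χ ξ + fourierCut t ψ ξ := by
  unfold fourierCut
  rw [← pairing_add]
  congr 1
  ext x; simp [mul_add]

theorem fourierCut_smul (t : Distr d) (c : ℂ) (χ : TestFun d) (ξ : E d) :
    fourierCut t (c • χ) ξ = c * fourierCut t χ ξ := by
  unfold fourierCut
  rw [← pairing_smul]
  congr 1
  ext x; simp; ring

@[simp] theorem fourierCut_zero (t : Distr d) (ξ : E d) : fourierCut t (0 : TestFun d) ξ = 0 := by
  simpa using fourierCut_smul t 0 0 ξ

theorem fourierCut_sum {ι : Type*} (t : Distr d) (s : Finset ι) (χ : ι → TestFun d) (ξ : E d) :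
    fourierCut t (∑ i ∈ s, χ i) ξ = ∑ i ∈ s, fourierCut t (χ i) ξ := by
  classical
  induction s using Finset.induction_on with
  | empty => simp
  | insert a s ha ih => rw [Finset.sum_insert ha, Finset.sum_insert ha, fourierCut_add, ih]

theorem fourierCut_sub_left (t s : Distr d) (χ : TestFun d) (ξ : E d) :
    fourierCut (t - s) χ ξ = fourierCut t χ ξ - fourierCut s χ ξ := pairing_sub_left _ _ _

end Microlocal

namespace Microlocal

variable {d : ℕ}

/-! ### Distributions have finite order on compact sets -/

/-- On functions supported in `K` the map `f ↦ ‖t f‖` is a continuous seminorm, hence dominated by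
finitely many of the seminorms defining the topology; `p` is the largest order among them. -/
theorem exists_distr_bound (t : Distr d) (K : Compacts (E d)) :
    ∃ (p : ℕ) (C : ℝ), 0 ≤ C ∧ ∀ f : 𝓓((⊤ : Opens (E d)), ℝ), tsupport f ⊆ K → ∀ A : ℝ,
      (∀ k ≤ p, ∀ x, ‖iteratedFDeriv ℝ k f x‖ ≤ A) → ‖t f‖ ≤ C * A := by
  have hK : (K : Set (E d)) ⊆ (⊤ : Opens (E d)) := fun _ _ => trivial
  let T : 𝓓_{K}(E d, ℝ) →ₗ[ℝ] ℂ :=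
    { toFun := fun f => t (TestFunction.ofSupportedIn hK f)
      map_add' := fun f g => t.map_add (TestFunction.ofSupportedInCLM ℝ hK f)
        (TestFunction.ofSupportedInCLM ℝ hK g)
      map_smul' := fun c f => t.map_smul c (TestFunction.ofSupportedInCLM ℝ hK f) }
  have hT : Continuous T := t.continuous.comp (TestFunction.continuous_ofSupportedIn hK)
  let q : Seminorm ℝ 𝓓_{K}(E d, ℝ) := (normSeminorm ℝ ℂ).comp T
  have hq : Continuous q := hT.norm
  obtain ⟨s, C, -, hC⟩ := Seminorm.bound_of_continuous
    (ContDiffMapSupportedIn.withSeminorms ℝ (E d) ℝ ⊤ K) q hq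
  refine ⟨s.sup id, C, C.2, fun f hf A hA => ?_⟩
  let f' : 𝓓_{K}(E d, ℝ) := .of_support_subset f.contDiff (subset_closure.trans hf)
  have hA0 : 0 ≤ A := (norm_nonneg _).trans (hA 0 (Nat.zero_le _) 0)
  have h1 : ‖t f‖ ≤ C * (s.sup (ContDiffMapSupportedIn.seminorm ℝ (E d) ℝ ⊤ K)) f' := hC f'
  refine h1.trans (mul_le_mul_of_nonneg_left ?_ C.2)
  refine Seminorm.finset_sup_apply_le hA0 fun i hi => ?_
  rw [ContDiffMapSupportedIn.seminorm_le_iff ℝ hA0]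
  intro _ x _
  exact hA i (Finset.le_sup (f := id) hi) x

theorem exists_pairing_bound (t : Distr d) (K : Compacts (E d)) :
    ∃ (p : ℕ) (C : ℝ), 0 ≤ C ∧ ∀ f : TestFun d, tsupport f ⊆ K → ∀ A : ℝ,
      (∀ k ≤ p, ∀ x, ‖iteratedFDeriv ℝ k f x‖ ≤ A) → ‖pairing t f‖ ≤ C * A := by
  obtain ⟨p, C, hC, h⟩ := exists_distr_bound t K
  refine ⟨p, C + C, by positivity, fun f hf A hA => ?_⟩
  have key : ∀ L : ℂ →L[ℝ] ℝ, ‖L‖ ≤ 1 → ‖t (TestFunction.postcompCLM L f)‖ ≤ C * A := by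
    intro L hL
    refine h _ ?_ A fun k hk x => ?_
    · exact (tsupport_comp_subset (map_zero L) f).trans hf
    · refine (L.norm_iteratedFDeriv_comp_left (f.contDiff.contDiffAt (x := x))
        (by exact_mod_cast le_top)).trans ?_
      calc _ ≤ 1 * ‖iteratedFDeriv ℝ k f x‖ := by gcongr
        _ ≤ A := by rw [one_mul]; exact hA k hk x
  unfold pairing
  refine (norm_add_le _ _).trans ?_
  rw [norm_mul, Complex.norm_I, one_mul, add_mul]
  exact add_le_add (key _ Complex.reCLM_norm.le) (key _ Complex.imCLM_norm.le)

/-- On functions of the form `g χ`, a distribution is controlled by finitely many derivatives of `g`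
on the support of `χ`. -/
theorem exists_pairing_mulSmooth_bound (t : Distr d) (χ : TestFun d) :
    ∃ (p : ℕ) (C : ℝ), 0 ≤ C ∧ ∀ (g : E d → ℂ) (hg : ContDiff ℝ ∞ g) (A : ℝ), 0 ≤ A →
      (∀ k ≤ p, ∀ x ∈ tsupport χ, ‖iteratedFDeriv ℝ k g x‖ ≤ A) →
      ‖pairing t (mulSmooth g hg χ)‖ ≤ C * A := by
  obtain ⟨p, C, hC, h⟩ := exists_pairing_bound t ⟨tsupport χ, χ.hasCompactSupport⟩
  have hb : ∀ k : ℕ, ∃ M : ℝ, ∀ x, ‖iteratedFDeriv ℝ k χ x‖ ≤ M := fun k =>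
    Continuous.bounded_above_of_compact_support
      (χ.contDiff.continuous_iteratedFDeriv (by exact_mod_cast le_top))
      (χ.hasCompactSupport.iteratedFDeriv k)
  choose M hM using hb
  have hM0 : ∀ k, 0 ≤ M k := fun k => (norm_nonneg _).trans (hM k 0)
  -- The Leibniz constants of all orders up to `p` are added up, so that one constant serves every
  -- `k ≤ p`.
  let D : ℝ := ∑ k ∈ Finset.range (p + 1), ∑ i ∈ Finset.range (k + 1), (k.choose i : ℝ) * M (k - i)
  have hD0 : 0 ≤ D := Finset.sum_nonneg fun k _ => Finset.sum_nonneg fun i _ =>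
    mul_nonneg (Nat.cast_nonneg _) (hM0 _)
  refine ⟨p, C * D, by positivity, fun g hg A hA0 hA => ?_⟩
  rw [mul_assoc]
  refine h _ (tsupport_mulSmooth g hg χ) _ fun k hk x => ?_
  by_cases hx : x ∈ tsupport χ
  · have h1 : ‖iteratedFDeriv ℝ k (fun y => g y * χ y) x‖ ≤ ∑ i ∈ Finset.range (k + 1),
        (k.choose i : ℝ) * ‖iteratedFDeriv ℝ i g x‖ * ‖iteratedFDeriv ℝ (k - i) χ x‖ :=
      norm_iteratedFDeriv_mul_le hg χ.contDiff x (by exact_mod_cast le_top)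
    refine h1.trans ?_
    have h2 : ∑ i ∈ Finset.range (k + 1), (k.choose i : ℝ) * M (k - i) ≤ D :=
      Finset.single_le_sum (f := fun k => ∑ i ∈ Finset.range (k + 1), (k.choose i : ℝ) * M (k - i))
        (fun k _ => Finset.sum_nonneg fun i _ => mul_nonneg (Nat.cast_nonneg _) (hM0 _))
        (Finset.mem_range.2 (Nat.lt_succ_of_le hk))
    refine le_trans ?_ (mul_le_mul_of_nonneg_right h2 hA0)
    rw [Finset.sum_mul]
    refine Finset.sum_le_sum fun i hi => ?_
    rw [mul_right_comm]
    have := hA i ((Nat.lt_succ_iff.1 (Finset.mem_range.1 hi)).trans hk) x hx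
    have := hM (k - i) x
    gcongr
    exact mul_nonneg (Nat.cast_nonneg _) (hM0 _)
  · have h0 : iteratedFDeriv ℝ k (mulSmooth g hg χ) x = 0 := by
      by_contra hne
      exact hx (tsupport_mulSmooth g hg χ (support_iteratedFDeriv_subset k hne))
    rw [h0, norm_zero]
    positivity

end Microlocal

namespace Microlocal

variable {d : ℕ}

/-! ### Superpositions of characters -/

/-- The bilinear form turning Mathlib's additive character into `character`. -/
noncomputable def phaseL : E d →L[ℝ] E d →L[ℝ] ℝ := (2 * Real.pi)⁻¹ • innerSL ℝ

theorem norm_phaseL_le : 2 * Real.pi * ‖(phaseL : E d →L[ℝ] E d →L[ℝ] ℝ)‖ ≤ 1 := by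
  have hpi := Real.two_pi_pos
  rw [← le_div_iff₀' hpi, one_div]
  refine ContinuousLinearMap.opNorm_le_bound _ (by positivity) fun ζ => ?_
  refine ContinuousLinearMap.opNorm_le_bound _ (by positivity) fun x => ?_
  change ‖(2 * Real.pi)⁻¹ * inner ℝ ζ x‖ ≤ _
  rw [norm_mul, norm_inv, Real.norm_of_nonneg hpi.le, mul_assoc]
  exact mul_le_mul_of_nonneg_left (norm_inner_le_norm ζ x) (by positivity)

theorem fourierChar_phaseL (ζ x : E d) :
    ((Real.fourierChar (-(phaseL ζ x)) : Circle) : ℂ) = character ζ x := by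
  have hpi := Real.two_pi_pos.ne'
  have h : phaseL ζ x = (2 * Real.pi)⁻¹ * inner ℝ x ζ := by
    rw [← real_inner_comm]; rfl
  rw [Real.fourierChar_apply, character, h, mul_neg, mul_inv_cancel_left₀ hpi]
  push_cast
  ring_nf

/-- The superposition `x ↦ ∫ h(ζ) exp (-i x·ζ) dμ(ζ)` of characters. -/
noncomputable def superpose (μ : Measure (E d)) (h : E d → ℂ) (x : E d) : ℂ :=
  ∫ ζ, character ζ x * h ζ ∂μ

theorem superpose_eq (μ : Measure (E d)) (h : E d → ℂ) :
    superpose μ h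
      = VectorFourier.fourierIntegral Real.fourierChar μ phaseL.toLinearMap₁₂ h := by
  ext x
  simp only [superpose, VectorFourier.fourierIntegral]
  refine integral_congr_ae (Eventually.of_forall fun ζ => ?_)
  change _ = ((Real.fourierChar (-(phaseL ζ x)) : Circle) : ℂ) * h ζ
  rw [fourierChar_phaseL]

theorem contDiff_superpose {μ : Measure (E d)} {h : E d → ℂ}
    (hh : ∀ n : ℕ, Integrable (fun ζ => ‖ζ‖ ^ n * ‖h ζ‖) μ) : ContDiff ℝ ∞ (superpose μ h) := by
  rw [superpose_eq]
  exact VectorFourier.contDiff_fourierIntegral (N := ⊤) phaseL fun n _ => hh n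

/-- A character is the superposition for a Dirac mass, so its derivatives are a special case of
differentiation under the integral sign. -/
theorem superpose_dirac (ζ : E d) : superpose (Measure.dirac ζ) (fun _ => 1) = character ζ := by
  ext x
  simp [superpose]

/-- The `k`-th derivative at the origin of a character. -/
noncomputable def charCoeff (ζ : E d) (k : ℕ) : E d [×k]→L[ℝ] ℂ :=
  VectorFourier.fourierPowSMulRight phaseL (fun _ => (1 : ℂ)) ζ k

theorem fourierPowSMulRight_eq_smul (h : E d → ℂ) (ζ : E d) (k : ℕ) :
    VectorFourier.fourierPowSMulRight phaseL h ζ k = h ζ • charCoeff ζ k := by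
  ext m
  simp [charCoeff]
  ring

theorem iteratedFDeriv_superpose {μ : Measure (E d)} {h : E d → ℂ}
    (hh : ∀ n : ℕ, Integrable (fun ζ => ‖ζ‖ ^ n * ‖h ζ‖) μ) (h' : AEStronglyMeasurable h μ)
    (k : ℕ) (x : E d) :
    iteratedFDeriv ℝ k (superpose μ h) x = ∫ ζ, character ζ x •
      h ζ • charCoeff ζ k ∂μ := by
  rw [superpose_eq, VectorFourier.iteratedFDeriv_fourierIntegral (N := ⊤) phaseL
    (fun n _ => hh n) h' (by exact_mod_cast le_top), VectorFourier.fourierIntegral]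
  refine integral_congr_ae (Eventually.of_forall fun ζ => ?_)
  change ((Real.fourierChar (-(phaseL ζ x)) : Circle) : ℂ) •
    (VectorFourier.fourierPowSMulRight phaseL h ζ k : E d [×k]→L[ℝ] ℂ) = _
  rw [fourierChar_phaseL, fourierPowSMulRight_eq_smul]

theorem iteratedFDeriv_character (ζ : E d) (k : ℕ) (x : E d) :
    iteratedFDeriv ℝ k (character ζ) x = character ζ x • charCoeff ζ k := by
  rw [← superpose_dirac, iteratedFDeriv_superpose (fun n => integrable_dirac (by simp))
    aestronglyMeasurable_const]
  simp [superpose_dirac]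

theorem norm_iteratedFDeriv_character_le (ζ : E d) (k : ℕ) (x : E d) :
    ‖iteratedFDeriv ℝ k (character ζ) x‖ ≤ ‖ζ‖ ^ k := by
  rw [iteratedFDeriv_character, norm_smul, norm_character, one_mul]
  refine (VectorFourier.norm_fourierPowSMulRight_le phaseL _ ζ k).trans ?_
  rw [norm_one, mul_one]
  exact mul_le_of_le_one_left (by positivity) (pow_le_one₀ (by positivity) norm_phaseL_le)

theorem continuous_iteratedFDeriv_character (k : ℕ) :
    Continuous fun p : E d × E d => iteratedFDeriv ℝ k (character p.1) p.2 := by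
  simp only [iteratedFDeriv_character]
  refine continuous_character.smul ?_
  exact (Continuous.fourierPowSMulRight phaseL continuous_const k).comp continuous_fst

/-! ### Extension of a distribution to a Banach space of jets -/

/-- Jets of order `≤ p` of smooth functions on a compact set. -/
def JetSpace (K : Set (E d)) (p : ℕ) : Type :=
  (k : Fin (p + 1)) → C(K, E d [×k]→L[ℝ] ℂ)

section
variable (K : Set (E d)) [CompactSpace K] (p : ℕ)

noncomputable instance : NormedAddCommGroup (JetSpace K p) :=
  inferInstanceAs (NormedAddCommGroup ((k : Fin (p + 1)) → C(K, E d [×k]→L[ℝ] ℂ)))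

noncomputable instance : NormedSpace ℂ (JetSpace K p) :=
  inferInstanceAs (NormedSpace ℂ ((k : Fin (p + 1)) → C(K, E d [×k]→L[ℝ] ℂ)))

instance : CompleteSpace (JetSpace K p) :=
  inferInstanceAs (CompleteSpace ((k : Fin (p + 1)) → C(K, E d [×k]→L[ℝ] ℂ)))

end

/-- The space of smooth functions. -/
def smoothSubmodule (d : ℕ) : Submodule ℂ (E d → ℂ) where
  carrier := Set.ofPred (ContDiff ℝ ∞)
  add_mem' := fun {f g} (hf : ContDiff ℝ ∞ f) (hg : ContDiff ℝ ∞ g) => hf.add hg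
  zero_mem' := (contDiff_const : ContDiff ℝ ∞ fun _ : E d => (0 : ℂ))
  smul_mem' := fun _ g (hg : ContDiff ℝ ∞ g) => contDiff_const.smul hg

theorem smoothSubmodule.contDiff (g : smoothSubmodule d) : ContDiff ℝ ∞ (g : E d → ℂ) := g.2

/-- The jet of a smooth function on a compact set. -/
noncomputable def jet (K : Set (E d)) [CompactSpace K] (p : ℕ) : smoothSubmodule d →ₗ[ℂ] JetSpace K p where
  toFun g := fun k => ⟨fun x => iteratedFDeriv ℝ k (g : E d → ℂ) x,
    ((smoothSubmodule.contDiff g).continuous_iteratedFDeriv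
      (by exact_mod_cast le_top)).comp continuous_subtype_val⟩
  map_add' f g := by
    refine funext fun k => ContinuousMap.ext fun x => ?_
    exact iteratedFDeriv_add_apply
      ((smoothSubmodule.contDiff f).contDiffAt.of_le (by exact_mod_cast le_top))
      ((smoothSubmodule.contDiff g).contDiffAt.of_le (by exact_mod_cast le_top))
  map_smul' c g := by
    refine funext fun k => ContinuousMap.ext fun x => ?_
    exact iteratedFDeriv_const_smul_apply
      ((smoothSubmodule.contDiff g).contDiffAt.of_le (by exact_mod_cast le_top))

theorem norm_iteratedFDeriv_le_jet (K : Set (E d)) [CompactSpace K] (p : ℕ) (g : smoothSubmodule d)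
    (k : Fin (p + 1)) (x : K) : ‖iteratedFDeriv ℝ k (g : E d → ℂ) x‖ ≤ ‖jet K p g‖ :=
  (ContinuousMap.norm_coe_le_norm (jet K p g k : C(K, E d [×k]→L[ℝ] ℂ)) x).trans
    (norm_le_pi_norm (ι := Fin (p + 1)) (G := fun k => C(K, E d [×k]→L[ℝ] ℂ)) (jet K p g) k)

/-- Evaluation of a component of a jet at a point. -/
noncomputable def jetEval (K : Set (E d)) [CompactSpace K] (p : ℕ) (k : Fin (p + 1)) (x : K) :
    JetSpace K p →L[ℂ] (E d [×k]→L[ℝ] ℂ) :=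
  LinearMap.mkContinuous
    { toFun := fun j => (j k : C(K, E d [×k]→L[ℝ] ℂ)) x
      map_add' := fun _ _ => rfl
      map_smul' := fun _ _ => rfl } 1 fun j => by
    rw [one_mul]
    exact (ContinuousMap.norm_coe_le_norm (j k : C(K, E d [×k]→L[ℝ] ℂ)) x).trans
      (norm_le_pi_norm (ι := Fin (p + 1)) (G := fun k => C(K, E d [×k]→L[ℝ] ℂ)) j k)

theorem jetEval_jet (K : Set (E d)) [CompactSpace K] (p : ℕ) (k : Fin (p + 1)) (x : K)
    (g : smoothSubmodule d) : jetEval K p k x (jet K p g) = iteratedFDeriv ℝ k (g : E d → ℂ) x :=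
  rfl

theorem jetSpace_ext (K : Set (E d)) [CompactSpace K] (p : ℕ) {i j : JetSpace K p}
    (h : ∀ k x, jetEval K p k x i = jetEval K p k x j) : i = j :=
  funext fun k => ContinuousMap.ext fun x => h k x

/-- A linear form bounded through a linear map into a normed space factors through a continuous
linear form on that space. -/
theorem exists_clm_factor {G X : Type*} [AddCommGroup G] [Module ℂ G] [NormedAddCommGroup X]
    [NormedSpace ℂ X] (J : G →ₗ[ℂ] X) (T : G →ₗ[ℂ] ℂ) (C : ℝ) (hT : ∀ g, ‖T g‖ ≤ C * ‖J g‖) :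
    ∃ S : X →L[ℂ] ℂ, ∀ g, S (J g) = T g := by
  -- The bound makes `T` vanish on the kernel of `J`. So `T` descends to a bounded form on the range
  -- of `J`, and Hahn–Banach extends it.
  have hker : LinearMap.ker J ≤ LinearMap.ker T := fun g hg => by
    have := hT g
    rw [LinearMap.mem_ker.1 hg, norm_zero, mul_zero] at this
    exact LinearMap.mem_ker.2 (norm_le_zero_iff.1 this)
  let T' : LinearMap.range J →ₗ[ℂ] ℂ :=
    ((LinearMap.ker J).liftQ T hker) ∘ₗ J.quotKerEquivRange.symm.toLinearMap
  have hT' : ∀ g, T' ⟨J g, g, rfl⟩ = T g := fun g => by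
    have : J.quotKerEquivRange.symm ⟨J g, g, rfl⟩ = (LinearMap.ker J).mkQ g := by
      rw [LinearEquiv.symm_apply_eq]
      rfl
    simp only [T', LinearMap.comp_apply, LinearEquiv.coe_coe, this]
    exact Submodule.liftQ_apply _ _ _
  let T'' : StrongDual ℂ (LinearMap.range J) := T'.mkContinuous C (by
    rintro ⟨_, g, rfl⟩
    rw [hT']
    exact hT g)
  obtain ⟨S, hS, -⟩ := exists_extension_norm_eq (LinearMap.range J) T''
  exact ⟨S, fun g => (hS ⟨J g, g, rfl⟩).trans (hT' g)⟩

instance (χ : TestFun d) : CompactSpace (tsupport χ) :=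
  isCompact_iff_compactSpace.1 χ.hasCompactSupport

/-- Bochner integrals of test functions require a Banach space in place of the space of test
functions. The value of `t` on `gχ` is bounded by the `p`-jet of `g` on the support of `χ`, so it
extends to all families of continuous functions there. The extension `S` is not canonical, but only
its values on jets are used. -/
theorem exists_jet_functional (t : Distr d) (χ : TestFun d) :
    ∃ (p : ℕ) (S : JetSpace (tsupport χ) p →L[ℂ] ℂ), ∀ g : smoothSubmodule d, S (jet (tsupport χ) p g) = pairing t (mulSmooth g (smoothSubmodule.contDiff g) χ) := by
  obtain ⟨p, C, hC, h⟩ := exists_pairing_mulSmooth_bound t χ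
  let T : smoothSubmodule d →ₗ[ℂ] ℂ :=
    { toFun := fun g => pairing t (mulSmooth g (smoothSubmodule.contDiff g) χ)
      map_add' := fun f g => by
        rw [← pairing_add]
        congr 1
        ext x
        exact add_mul _ _ _
      map_smul' := fun c g => by
        rw [RingHom.id_apply, smul_eq_mul, ← pairing_smul]
        congr 1
        ext x
        exact mul_assoc _ _ _ }
  refine ⟨p, exists_clm_factor (jet (tsupport χ) p) T C fun g => ?_⟩
  refine h g (smoothSubmodule.contDiff g) _ (norm_nonneg _) fun k hk x hx => ?_
  exact norm_iteratedFDeriv_le_jet _ p g ⟨k, Nat.lt_succ_of_le hk⟩ ⟨x, hx⟩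

/-- The character as an element of the space of smooth functions. -/
noncomputable def smoothCharacter (ζ : E d) : smoothSubmodule d := ⟨character ζ, contDiff_character ζ⟩

theorem continuous_curry_restrict (K : Set (E d)) {Y : Type*} [TopologicalSpace Y] {Φ : E d × E d → Y}
    (hΦ : Continuous Φ) (F : E d → C(K, Y)) (hF : ∀ ζ x, F ζ x = Φ (ζ, x)) : Continuous F := by
  refine ContinuousMap.continuous_of_continuous_uncurry _ ?_
  have : Function.uncurry (fun ζ x => F ζ x) = fun q : E d × K => Φ (q.1, q.2) :=
    funext fun q => hF q.1 q.2
  rw [this]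
  exact hΦ.comp (continuous_fst.prodMk (continuous_subtype_val.comp continuous_snd))

section
variable (K : Set (E d)) [CompactSpace K] (p : ℕ)

theorem continuous_jet_character : Continuous fun ζ : E d => jet K p (smoothCharacter ζ) :=
  continuous_pi (A := fun k : Fin (p + 1) => C(K, E d [×k]→L[ℝ] ℂ)) fun k =>
    continuous_curry_restrict K (continuous_iteratedFDeriv_character (k : ℕ)) _ fun _ _ => rfl

theorem norm_jet_character_le (ζ : E d) : ‖jet K p (smoothCharacter ζ)‖ ≤ (1 + ‖ζ‖) ^ p := by
  refine (pi_norm_le_iff_of_nonneg (by positivity)).2 fun k => ?_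
  refine (ContinuousMap.norm_le _ (by positivity)).2 fun x => ?_
  refine (norm_iteratedFDeriv_character_le ζ k x).trans ?_
  have h0 := norm_nonneg ζ
  calc ‖ζ‖ ^ (k : ℕ) ≤ (1 + ‖ζ‖) ^ (k : ℕ) := by gcongr; linarith
    _ ≤ (1 + ‖ζ‖) ^ p := pow_le_pow_right₀ (by linarith) (Nat.lt_succ_iff.1 k.2)

end

theorem continuous_fourierCut (t : Distr d) (χ : TestFun d) : Continuous (fourierCut t χ) := by
  obtain ⟨p, S, hS⟩ := exists_jet_functional t χ
  have : fourierCut t χ = fun ζ => S (jet (tsupport χ) p (smoothCharacter ζ)) := by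
    ext ζ
    exact (hS (smoothCharacter ζ)).symm
  rw [this]
  exact S.continuous.comp (continuous_jet_character _ _)

theorem exists_norm_fourierCut_le (t : Distr d) (χ : TestFun d) :
    ∃ (p : ℕ) (C : ℝ), 0 ≤ C ∧ ∀ ξ, ‖fourierCut t χ ξ‖ ≤ C * (1 + ‖ξ‖) ^ p := by
  obtain ⟨p, S, hS⟩ := exists_jet_functional t χ
  refine ⟨p, ‖S‖, norm_nonneg _, fun ξ => ?_⟩
  have : fourierCut t χ ξ = S (jet (tsupport χ) p (smoothCharacter ξ)) :=
    (hS (smoothCharacter ξ)).symm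
  rw [this]
  exact (S.le_opNorm _).trans (mul_le_mul_of_nonneg_left (norm_jet_character_le _ _ _)
    (norm_nonneg _))

theorem integrable_one_add_pow_mul {μ : Measure (E d)} {h : E d → ℂ}
    (hh : ∀ n : ℕ, Integrable (fun ζ => ‖ζ‖ ^ n * ‖h ζ‖) μ) (n : ℕ) :
    Integrable (fun ζ => (1 + ‖ζ‖) ^ n * ‖h ζ‖) μ := by
  have : (fun ζ : E d => (1 + ‖ζ‖) ^ n * ‖h ζ‖) = fun ζ => ∑ k ∈ Finset.range (n + 1),
      (n.choose k : ℝ) * (‖ζ‖ ^ k * ‖h ζ‖) := by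
    ext ζ
    rw [add_comm, add_pow, Finset.sum_mul]
    exact Finset.sum_congr rfl fun k _ => by rw [one_pow]; ring
  rw [this]
  exact integrable_finsetSum _ fun k _ => (hh k).const_mul _

/-- A distribution commutes with superpositions of characters. -/
theorem pairing_superpose (t : Distr d) (χ : TestFun d) {μ : Measure (E d)} {h : E d → ℂ}
    (hh : ∀ n : ℕ, Integrable (fun ζ => ‖ζ‖ ^ n * ‖h ζ‖) μ) (h' : AEStronglyMeasurable h μ) :
    pairing t (mulSmooth (superpose μ h) (contDiff_superpose hh) χ)
      = ∫ ζ, h ζ * fourierCut t χ ζ ∂μ := by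
  obtain ⟨p, S, hS⟩ := exists_jet_functional t χ
  -- Jets of characters grow like `(1 + |ζ|)^p`, and `h` has all moments.
  have hint : Integrable (fun ζ => h ζ • jet (tsupport χ) p (smoothCharacter ζ)) μ := by
    refine (integrable_one_add_pow_mul hh p).mono'
      (h'.smul (continuous_jet_character _ _).aestronglyMeasurable)
      (Eventually.of_forall fun ζ => ?_)
    rw [norm_smul, mul_comm]
    exact mul_le_mul_of_nonneg_right (norm_jet_character_le _ _ _) (norm_nonneg _)
  -- The integral of the jets is the jet of the integral: evaluated at one order and one point this
  -- is differentiation under the integral sign.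
  have hjet : ∫ ζ, h ζ • jet (tsupport χ) p (smoothCharacter ζ) ∂μ
      = jet (tsupport χ) p ⟨superpose μ h, contDiff_superpose hh⟩ := by
    refine jetSpace_ext _ _ fun k x => ?_
    rw [← (jetEval (tsupport χ) p k x).integral_comp_comm hint, jetEval_jet]
    change _ = iteratedFDeriv ℝ k (superpose μ h) x
    rw [iteratedFDeriv_superpose hh h']
    refine integral_congr_ae (Eventually.of_forall fun ζ => ?_)
    change jetEval (tsupport χ) p k x (h ζ • jet (tsupport χ) p (smoothCharacter ζ)) = _
    rw [map_smul, jetEval_jet]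
    change h ζ • iteratedFDeriv ℝ k (character ζ) x = _
    rw [iteratedFDeriv_character]
    exact smul_comm _ _ _
  have h2 := hS ⟨superpose μ h, contDiff_superpose hh⟩
  rw [← hjet, ← S.integral_comp_comm hint] at h2
  rw [← h2]
  refine integral_congr_ae (Eventually.of_forall fun ζ => ?_)
  change S (h ζ • jet (tsupport χ) p (smoothCharacter ζ)) = _
  rw [map_smul, hS]
  rfl

end Microlocal

namespace Microlocal

variable {d : ℕ}

/-! ### The Fourier transform of test functions -/

/-- The Fourier transform `ζ ↦ ∫ g(x) exp (-i x·ζ) dx` of a test function. -/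
noncomputable def fhat (g : TestFun d) (ζ : E d) : ℂ := ∫ x, character ζ x * g x

theorem fhat_eq_fourier (g : TestFun d) (ζ : E d) :
    fhat g ζ = FourierTransform.fourier (g : E d → ℂ) ((2 * Real.pi)⁻¹ • ζ) := by
  rw [Real.fourier_eq, fhat]
  refine integral_congr_ae (Eventually.of_forall fun x => ?_)
  change character ζ x * g x
    = ((Real.fourierChar (-(inner ℝ x ((2 * Real.pi)⁻¹ • ζ))) : Circle) : ℂ) * g x
  rw [← fourierChar_phaseL]
  congr 4
  rw [inner_smul_right, real_inner_comm]
  rfl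

theorem integrable_pow_mul_iteratedFDeriv (g : TestFun d) (k n : ℕ) :
    Integrable fun v : E d => ‖v‖ ^ k * ‖iteratedFDeriv ℝ n g v‖ := by
  have h : Continuous (iteratedFDeriv ℝ n g) :=
    g.contDiff.continuous_iteratedFDeriv (by exact_mod_cast le_top)
  refine Continuous.integrable_of_hasCompactSupport (by fun_prop) ?_
  exact ((g.hasCompactSupport.iteratedFDeriv (𝕜 := ℝ) n).norm).mul_left

theorem continuous_fhat (g : TestFun d) : Continuous (fhat g) := by
  have : fhat g = fun ζ => FourierTransform.fourier (g : E d → ℂ) ((2 * Real.pi)⁻¹ • ζ) :=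
    funext (fhat_eq_fourier g)
  rw [this]
  have h : Continuous (FourierTransform.fourier (g : E d → ℂ)) :=
    (Real.contDiff_fourier (N := 0) fun n _ => by
      simpa using integrable_pow_mul_iteratedFDeriv g n 0).continuous
  exact h.comp (by fun_prop)

theorem one_add_pow_le {r : ℝ} (hr : 0 ≤ r) (N : ℕ) : (1 + r) ^ N ≤ 2 ^ N * (1 + r ^ N) := by
  rcases le_total r 1 with h | h
  · calc (1 + r) ^ N ≤ 2 ^ N := by gcongr; linarith
      _ ≤ 2 ^ N * (1 + r ^ N) := le_mul_of_one_le_right (by positivity) (by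
        have := pow_nonneg hr N; linarith)
  · calc (1 + r) ^ N ≤ (2 * r) ^ N := by gcongr; linarith
      _ = 2 ^ N * r ^ N := mul_pow _ _ _
      _ ≤ 2 ^ N * (1 + r ^ N) := by gcongr; linarith

/-- Rapid decay of the Fourier transform, uniformly on test functions with support in a fixed
compact set and bounded derivatives. -/
theorem exists_fhat_bound (K : Compacts (E d)) (N : ℕ) : ∃ C : ℝ, 0 ≤ C ∧
    ∀ g : TestFun d, tsupport g ⊆ K → ∀ A : ℝ, (∀ k ≤ N, ∀ x, ‖iteratedFDeriv ℝ k g x‖ ≤ A) →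
      ∀ ζ, (1 + ‖ζ‖) ^ N * ‖fhat g ζ‖ ≤ C * A := by
  have hpi := Real.two_pi_pos
  let M : ℝ := volume.real (K : Set (E d))
  have hM : 0 ≤ M := measureReal_nonneg
  let D : ℝ := 2 ^ N * ((N + 1 : ℕ) * M)
  have hD : 0 ≤ D := by positivity
  refine ⟨2 ^ N * (M + (2 * Real.pi) ^ N * D), by positivity, fun g hg A hA ζ => ?_⟩
  have hA0 : 0 ≤ A := (norm_nonneg _).trans (hA 0 (Nat.zero_le _) 0)
  have hI : ∀ k ≤ N, ∫ v, ‖iteratedFDeriv ℝ k g v‖ ≤ M * A := fun k hk => by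
    rw [← setIntegral_eq_integral_of_forall_compl_eq_zero (s := (K : Set (E d)))]
    · refine (le_abs_self _).trans ?_
      rw [← Real.norm_eq_abs, mul_comm]
      refine norm_setIntegral_le_of_norm_le_const K.isCompact.measure_lt_top fun x _ => ?_
      rw [norm_norm]
      exact hA k hk x
    · intro x hx
      rw [norm_eq_zero]
      by_contra hne
      exact hx (hg (support_iteratedFDeriv_subset k hne))
  set w : E d := (2 * Real.pi)⁻¹ • ζ with hw
  have hζ : ‖ζ‖ = 2 * Real.pi * ‖w‖ := by
    rw [hw, norm_smul, norm_inv, Real.norm_of_nonneg hpi.le, mul_inv_cancel_left₀ hpi.ne']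
  have hdec : ∀ n ≤ N, ‖w‖ ^ n * ‖fhat g ζ‖ ≤ 2 ^ n * ((n + 1 : ℕ) * (M * A)) := fun n hn => by
    -- The case `k = 0`, no derivative on the transform: the right-hand side involves only `L¹`
    -- norms of derivatives of `g` of order at most `n`, which `hI` bounds by `M * A`.
    have h := Real.pow_mul_norm_iteratedFDeriv_fourier_le (K := ⊤) (N := ⊤)
      (f := (g : E d → ℂ)) g.contDiff
      (fun k n _ _ => integrable_pow_mul_iteratedFDeriv g k n) (k := 0) (n := n)
      (by exact_mod_cast le_top) (by exact_mod_cast le_top) w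
    rw [norm_iteratedFDeriv_zero, ← fhat_eq_fourier] at h
    refine h.trans ?_
    rw [pow_zero, one_mul]
    norm_num only [Nat.cast_zero, mul_zero, zero_add]
    refine mul_le_mul_of_nonneg_left ?_ (by positivity)
    calc _ ≤ ∑ p ∈ Finset.range 1 ×ˢ Finset.range (n + 1), M * A := by
          refine Finset.sum_le_sum fun p hp => ?_
          obtain ⟨h1, h2⟩ := Finset.mem_product.1 hp
          have h1 : p.1 = 0 := by simpa using h1
          have h2 : p.2 ≤ N := (Nat.lt_succ_iff.1 (Finset.mem_range.1 h2)).trans hn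
          simpa [h1] using hI p.2 h2
      _ = _ := by simp
  have h0 : ‖fhat g ζ‖ ≤ M * A := by simpa using hdec 0 (Nat.zero_le _)
  have hN := hdec N le_rfl
  calc (1 + ‖ζ‖) ^ N * ‖fhat g ζ‖ ≤ 2 ^ N * (1 + ‖ζ‖ ^ N) * ‖fhat g ζ‖ := by
        gcongr; exact one_add_pow_le (norm_nonneg ζ) N
    _ = 2 ^ N * (‖fhat g ζ‖ + (2 * Real.pi) ^ N * (‖w‖ ^ N * ‖fhat g ζ‖)) := by
        rw [hζ, mul_pow]; ring
    _ ≤ 2 ^ N * (M * A + (2 * Real.pi) ^ N * (2 ^ N * ((N + 1 : ℕ) * (M * A)))) := by gcongr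
    _ = 2 ^ N * (M + (2 * Real.pi) ^ N * D) * A := by simp only [D]; ring

theorem exists_norm_fhat_le (g : TestFun d) (N : ℕ) :
    ∃ C : ℝ, 0 ≤ C ∧ ∀ ζ, (1 + ‖ζ‖) ^ N * ‖fhat g ζ‖ ≤ C := by
  obtain ⟨C, hC, h⟩ := exists_fhat_bound ⟨tsupport g, g.hasCompactSupport⟩ N
  have hb : ∀ k : ℕ, ∃ M : ℝ, ∀ x, ‖iteratedFDeriv ℝ k g x‖ ≤ M := fun k =>
    Continuous.bounded_above_of_compact_support
      (g.contDiff.continuous_iteratedFDeriv (by exact_mod_cast le_top))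
      (g.hasCompactSupport.iteratedFDeriv k)
  choose M hM using hb
  have hM0 : ∀ k, 0 ≤ M k := fun k => (norm_nonneg _).trans (hM k 0)
  refine ⟨C * ∑ k ∈ Finset.range (N + 1), M k,
    mul_nonneg hC (Finset.sum_nonneg fun k _ => hM0 k), h g subset_rfl _ fun k hk x => ?_⟩
  exact (hM k x).trans (Finset.single_le_sum (f := M) (fun k _ => hM0 k)
    (Finset.mem_range.2 (Nat.lt_succ_of_le hk)))

theorem integrable_one_add_norm_inv_pow :
    Integrable fun ζ : E d => ((1 + ‖ζ‖) ^ (d + 1))⁻¹ := by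
  have h := integrable_one_add_norm (E := E d) (μ := volume) (r := (d + 1 : ℕ)) (by
    simp)
  refine h.congr (Eventually.of_forall fun ζ => ?_)
  change (1 + ‖ζ‖) ^ (-((d + 1 : ℕ) : ℝ)) = _
  rw [Real.rpow_neg (by positivity), Real.rpow_natCast]

theorem integrable_one_add_pow_mul_fhat (g : TestFun d) (N : ℕ) :
    Integrable fun ζ : E d => (1 + ‖ζ‖) ^ N * ‖fhat g ζ‖ := by
  obtain ⟨C, -, h⟩ := exists_norm_fhat_le g (N + (d + 1))
  have hc := continuous_fhat g
  refine (integrable_one_add_norm_inv_pow.const_mul C).mono' (by fun_prop)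
    (Eventually.of_forall fun ζ => ?_)
  rw [Real.norm_of_nonneg (by positivity), ← div_eq_mul_inv, le_div_iff₀ (by positivity)]
  calc _ = (1 + ‖ζ‖) ^ (N + (d + 1)) * ‖fhat g ζ‖ := by ring
    _ ≤ C := h ζ

theorem integrable_fhat (g : TestFun d) : Integrable (fhat g) := by
  have h := integrable_one_add_pow_mul_fhat g 0
  simp only [pow_zero, one_mul] at h
  exact (integrable_norm_iff (continuous_fhat g).aestronglyMeasurable).1 h

/-- The constant `(2π)^{-d}`. -/
noncomputable def normConst (d : ℕ) : ℂ := ((((2 * Real.pi) ^ d)⁻¹ : ℝ) : ℂ)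

/-- The argument `-ζ` appears because `superpose` uses the same sign `exp (-i x·ζ)` as the Fourier
transform itself. -/
theorem fhat_inversion (g : TestFun d) :
    (g : E d → ℂ) = superpose volume fun ζ => normConst d * fhat g (-ζ) := by
  have hpi := Real.two_pi_pos
  have hg : Integrable (g : E d → ℂ) :=
    g.continuous.integrable_of_hasCompactSupport g.hasCompactSupport
  have hF : FourierTransform.fourier (g : E d → ℂ) = fun w => fhat g ((2 * Real.pi) • w) := by
    ext w
    rw [fhat_eq_fourier, smul_smul, inv_mul_cancel₀ hpi.ne', one_smul]
  have hFi : Integrable (FourierTransform.fourier (g : E d → ℂ)) := by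
    rw [hF]
    exact (integrable_fhat g).comp_smul hpi.ne'
  have hinv := g.continuous.fourierInv_fourier_eq hg hFi
  ext x
  have h1 := congrFun hinv x
  rw [Real.fourierInv_eq, hF] at h1
  have h2 : ∀ v : E d, Real.fourierChar (inner ℝ v x) • fhat g ((2 * Real.pi) • v)
      = (fun ζ => character (-ζ) x * fhat g ζ) ((2 * Real.pi) • v) := fun v => by
    change ((Real.fourierChar (inner ℝ v x) : Circle) : ℂ) * _ = _
    congr 1
    rw [← fourierChar_phaseL]
    congr 2
    change _ = -((2 * Real.pi)⁻¹ * inner ℝ (-((2 * Real.pi) • v)) x)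
    rw [inner_neg_left, real_inner_smul_left, mul_neg, neg_neg, inv_mul_cancel_left₀ hpi.ne']
  simp_rw [h2] at h1
  -- The substitution `ζ = 2πv` has Jacobian `(2π)^{-d}`, which is `normConst d`.
  rw [Measure.integral_comp_smul volume (fun ζ => character (-ζ) x * fhat g ζ),
    finrank_euclideanSpace_fin, abs_of_nonneg (by positivity)] at h1
  rw [← h1, superpose, ← integral_neg_eq_self]
  simp only [neg_neg, mul_left_comm _ (normConst d)]
  rw [integral_const_mul, Complex.real_smul]
  rfl

theorem mulSmooth_mulTest (g : E d → ℂ) (hg : ContDiff ℝ ∞ g) (χ ψ : TestFun d) :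
    mulSmooth g hg (mulTest χ ψ) = mulTest χ (mulSmooth g hg ψ) := by
  ext x
  simp [mul_left_comm]

/-- The Fourier transform of `t g χ` is the convolution of those of `g` and `t χ`. -/
theorem fourierCut_mulTest (t : Distr d) (g χ : TestFun d) (ξ : E d) :
    fourierCut t (mulTest g χ) ξ
      = normConst d * ∫ ζ, fhat g ζ * fourierCut t χ (ξ - ζ) := by
  set h : E d → ℂ := fun ζ => normConst d * fhat g (-ζ) with hh
  have hi : ∀ n : ℕ, Integrable (fun ζ : E d => ‖ζ‖ ^ n * ‖h ζ‖) := fun n => by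
    have hc := continuous_fhat g
    refine (((integrable_one_add_pow_mul_fhat g n).const_mul ‖normConst d‖).comp_neg).mono'
      (by fun_prop) (Eventually.of_forall fun ζ => ?_)
    rw [Real.norm_of_nonneg (by positivity), hh, norm_mul, norm_neg]
    have := norm_nonneg ζ
    calc _ = ‖normConst d‖ * (‖ζ‖ ^ n * ‖fhat g (-ζ)‖) := by ring
      _ ≤ _ := by gcongr; linarith
  have hc := continuous_fhat g
  -- By Fourier inversion `g` is a superposition of characters, and multiplying by a character
  -- translates the transform of `tχ`; the change of sign of `ζ` made below then gives the
  -- convolution.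
  have key := pairing_superpose t (mulSmooth (character ξ) (contDiff_character ξ) χ) hi
    (by fun_prop)
  have he : mulSmooth (superpose volume h) (contDiff_superpose hi)
      (mulSmooth (character ξ) (contDiff_character ξ) χ)
      = mulSmooth (character ξ) (contDiff_character ξ) (mulTest g χ) := by
    rw [mulSmooth_mulTest]
    ext x
    rw [mulSmooth_apply, mulTest_apply, ← fhat_inversion]
  rw [he] at key
  rw [fourierCut, key, ← integral_neg_eq_self, ← integral_const_mul]
  refine integral_congr_ae (Eventually.of_forall fun ζ => ?_)
  simp only [hh, neg_neg, fourierCut_mulSmooth_character, neg_add_eq_sub, mul_assoc]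

end Microlocal

namespace Microlocal

variable {d : ℕ}

/-! ### Cutoffs -/

theorem exists_cutoff {K U : Set (E d)} (hK : IsCompact K) (hU : IsOpen U) (hKU : K ⊆ U) :
    ∃ ρ : TestFun d, (∀ x ∈ K, ρ x = 1) ∧ tsupport ρ ⊆ U ∧ ∀ x, (ρ x).im = 0 := by
  obtain ⟨L, hL, hKL, hLU⟩ := exists_compact_between hK hU hKU
  obtain ⟨f, h0, h1, -⟩ := exists_contMDiffMap_zero_one_of_isClosed (n := ⊤) (modelWithCornersSelf ℝ (E d))
    isOpen_interior.isClosed_compl hK.isClosed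
    (disjoint_left.2 fun x hx hx' => hx (hKL hx'))
  have hts : tsupport (fun x => (f x : ℂ)) ⊆ L := by
    refine closure_minimal (fun x hx => ?_) hL.isClosed
    by_contra hxL
    refine hx ?_
    have : f x = 0 := h0 fun h => hxL (interior_subset h)
    simp [this]
  refine ⟨⟨fun x => (f x : ℂ), ?_, hL.of_isClosed_subset (isClosed_tsupport _) hts,
    fun _ _ => trivial⟩, fun x hx => ?_, hts.trans hLU, fun x => Complex.ofReal_im _⟩
  · exact Complex.ofRealCLM.contDiff.comp f.contMDiff.contDiff
  · change (f x : ℂ) = 1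
    rw [h1 hx]
    simp

theorem mulTest_eq_right {ρ χ : TestFun d} (h : ∀ x ∈ tsupport χ, ρ x = 1) : mulTest ρ χ = χ := by
  ext x
  rw [mulTest_apply]
  by_cases hx : x ∈ tsupport χ
  · rw [h x hx, one_mul]
  · rw [image_eq_zero_of_notMem_tsupport hx, mul_zero]

/-! ### Uniform boundedness -/

section Series

variable (ξ : ℕ → E d)

/-- The terms of a series of characters with rapidly decreasing weights. -/
noncomputable def seriesTerm (a : ℕ → ℂ) (k : ℕ) (x : E d) : ℂ :=
  (a k * (((1 + ‖ξ k‖) ^ k)⁻¹ : ℝ)) • character (ξ k) x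

theorem contDiff_seriesTerm (a : ℕ → ℂ) (k : ℕ) : ContDiff ℝ ∞ (seriesTerm ξ a k) :=
  (contDiff_character (ξ k)).const_smul _

/-- Bound for the weighted derivatives of order `n` of the characters. -/
noncomputable def seriesConst (n : ℕ) : ℝ := 1 + ∑ k ∈ Finset.range n, ‖ξ k‖ ^ n

theorem seriesConst_nonneg (n : ℕ) : 0 ≤ seriesConst ξ n :=
  add_nonneg zero_le_one (Finset.sum_nonneg fun _ _ => by positivity)

/-- For `k ≥ n` the weight `(1 + |ξₖ|)^{-k}` absorbs the factor `|ξₖ|^n` of the `n`-th derivative;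
the finitely many `k < n` are paid for by the sum in `seriesConst`. So the series is smooth for
every `a ∈ ℓ¹`, however the frequencies `ξₖ` grow. -/
theorem norm_iteratedFDeriv_seriesTerm_le (a : ℕ → ℂ) (n k : ℕ) (x : E d) :
    ‖iteratedFDeriv ℝ n (seriesTerm ξ a k) x‖ ≤ ‖a k‖ * seriesConst ξ n := by
  have h1 : iteratedFDeriv ℝ n (seriesTerm ξ a k) x
      = (a k * (((1 + ‖ξ k‖) ^ k)⁻¹ : ℝ)) • iteratedFDeriv ℝ n (character (ξ k)) x := by
    have e : seriesTerm ξ a k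
        = (a k * (((1 + ‖ξ k‖) ^ k)⁻¹ : ℝ)) • character (ξ k) := rfl
    rw [e]
    exact iteratedFDeriv_const_smul_apply ((contDiff_character (ξ k)).contDiffAt.of_le
      (by exact_mod_cast le_top))
  have h0 := norm_nonneg (ξ k)
  rw [h1, norm_smul, norm_mul, mul_assoc, Complex.norm_real,
    Real.norm_of_nonneg (by positivity)]
  refine mul_le_mul_of_nonneg_left ?_ (norm_nonneg _)
  calc _ ≤ ((1 + ‖ξ k‖) ^ k)⁻¹ * ‖ξ k‖ ^ n := by
        gcongr; exact norm_iteratedFDeriv_character_le _ _ _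
    _ ≤ seriesConst ξ n := by
      rcases lt_or_ge k n with h | h
      · calc _ ≤ 1 * ‖ξ k‖ ^ n := by
              gcongr; exact inv_le_one_of_one_le₀ (one_le_pow₀ (by linarith))
          _ ≤ ∑ k ∈ Finset.range n, ‖ξ k‖ ^ n := by
              rw [one_mul]
              exact Finset.single_le_sum (f := fun k => ‖ξ k‖ ^ n) (fun _ _ => by positivity)
                (Finset.mem_range.2 h)
          _ ≤ _ := by rw [seriesConst]; linarith
      · calc _ ≤ ((1 + ‖ξ k‖) ^ k)⁻¹ * (1 + ‖ξ k‖) ^ k := by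
              gcongr
              calc ‖ξ k‖ ^ n ≤ (1 + ‖ξ k‖) ^ n := by gcongr; linarith
                _ ≤ (1 + ‖ξ k‖) ^ k := pow_le_pow_right₀ (by linarith) h
          _ = 1 := inv_mul_cancel₀ (by positivity)
          _ ≤ _ := by
            have : 0 ≤ ∑ k ∈ Finset.range n, ‖ξ k‖ ^ n :=
              Finset.sum_nonneg fun _ _ => by positivity
            rw [seriesConst]; linarith

variable {ξ} {a : ℕ → ℂ}

theorem contDiff_series (ha : Summable fun k => ‖a k‖) :
    ContDiff ℝ ∞ fun x => ∑' k, seriesTerm ξ a k x :=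
  contDiff_tsum (N := ⊤) (v := fun n k => ‖a k‖ * seriesConst ξ n)
    (fun k => contDiff_seriesTerm ξ a k) (fun _ _ => ha.mul_right _)
    fun n k x _ => norm_iteratedFDeriv_seriesTerm_le ξ a n k x

theorem norm_iteratedFDeriv_series_le (ha : Summable fun k => ‖a k‖) (n : ℕ) (x : E d) :
    ‖iteratedFDeriv ℝ n (fun x => ∑' k, seriesTerm ξ a k x) x‖
      ≤ (∑' k, ‖a k‖) * seriesConst ξ n := by
  rw [iteratedFDeriv_tsum (N := ⊤) (v := fun n k => ‖a k‖ * seriesConst ξ n)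
    (fun k => contDiff_seriesTerm ξ a k) (fun _ _ => ha.mul_right _)
    (fun n k x _ => norm_iteratedFDeriv_seriesTerm_le ξ a n k x) (by exact_mod_cast le_top),
    ← tsum_mul_right]
  exact tsum_of_norm_bounded (ha.mul_right _).hasSum
    fun k => norm_iteratedFDeriv_seriesTerm_le ξ a n k x

theorem summable_seriesTerm (ha : Summable fun k => ‖a k‖) (x : E d) :
    Summable fun k => seriesTerm ξ a k x := by
  refine Summable.of_norm_bounded (ha.mul_right (seriesConst ξ 0)) fun k => ?_
  simpa using norm_iteratedFDeriv_seriesTerm_le ξ a 0 k x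

end Series

/-- The space of absolutely summable sequences. -/
abbrev SummableSeq : Type := lp (fun _ : ℕ => ℂ) 1

theorem SummableSeq.summable (a : SummableSeq) : Summable fun k => ‖a k‖ := by
  have := (lp.memℓp a).summable (by simp)
  simpa using this

theorem SummableSeq.norm_eq (a : SummableSeq) : ‖a‖ = ∑' k, ‖a k‖ := by
  rw [lp.norm_eq_tsum_rpow (by simp)]
  simp

/-- The linear form `a ↦ ⟨t, χ ∑ aₖ (1 + |ξₖ|)⁻ᵏ exp (-i x·ξₖ)⟩`. -/
noncomputable def seriesForm (t : Distr d) (χ : TestFun d) (ξ : ℕ → E d) :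
    SummableSeq →ₗ[ℂ] ℂ where
  toFun a := pairing t (mulSmooth _ (contDiff_series (ξ := ξ) a.summable) χ)
  map_add' a b := by
    rw [← pairing_add]
    congr 1
    ext x
    change (∑' k, seriesTerm ξ (a + b : SummableSeq) k x) * χ x
      = (∑' k, seriesTerm ξ a k x) * χ x + (∑' k, seriesTerm ξ b k x) * χ x
    rw [← add_mul, ← (summable_seriesTerm a.summable x).tsum_add
      (summable_seriesTerm b.summable x)]
    congr 2
    ext k
    simp [seriesTerm]
    ring
  map_smul' c a := by
    rw [RingHom.id_apply, smul_eq_mul, ← pairing_smul]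
    congr 1
    ext x
    change (∑' k, seriesTerm ξ (c • a : SummableSeq) k x) * χ x
      = c * ((∑' k, seriesTerm ξ a k x) * χ x)
    rw [← mul_assoc, ← tsum_mul_left]
    congr 2
    ext k
    simp [seriesTerm, mul_assoc]

theorem exists_seriesForm_bound (t : Distr d) (χ : TestFun d) (ξ : ℕ → E d) :
    ∃ C : ℝ, ∀ a, ‖seriesForm t χ ξ a‖ ≤ C * ‖a‖ := by
  obtain ⟨p, C, hC, h⟩ := exists_pairing_mulSmooth_bound t χ
  refine ⟨C * ∑ n ∈ Finset.range (p + 1), seriesConst ξ n, fun a => ?_⟩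
  rw [mul_assoc]
  have h0 : 0 ≤ ∑ n ∈ Finset.range (p + 1), seriesConst ξ n :=
    Finset.sum_nonneg fun n _ => seriesConst_nonneg ξ n
  refine h _ _ _ (by positivity) fun k hk x _ => ?_
  refine (norm_iteratedFDeriv_series_le a.summable k x).trans ?_
  rw [← a.norm_eq, mul_comm]
  refine mul_le_mul_of_nonneg_right ?_ (norm_nonneg _)
  exact Finset.single_le_sum (f := seriesConst ξ) (fun n _ => seriesConst_nonneg ξ n)
    (Finset.mem_range.2 (Nat.lt_succ_of_le hk))

theorem seriesForm_single (t : Distr d) (χ : TestFun d) (ξ : ℕ → E d) (k : ℕ) :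
    seriesForm t χ ξ (lp.single 1 k 1)
      = (((1 + ‖ξ k‖) ^ k)⁻¹ : ℝ) * fourierCut t χ (ξ k) := by
  rw [fourierCut, ← pairing_smul]
  change pairing t _ = _
  congr 1
  ext x
  change (∑' j, seriesTerm ξ (lp.single 1 k (1 : ℂ) : SummableSeq) j x) * χ x
    = (((1 + ‖ξ k‖) ^ k)⁻¹ : ℝ) * (character (ξ k) x * χ x)
  rw [tsum_eq_single k, ← mul_assoc]
  · simp [seriesTerm]
  · intro j hj
    simp [seriesTerm, hj]

/-- A weakly bounded set of distributions has locally uniformly bounded order. -/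
theorem exists_uniform_norm_fourierCut_le (B : Set (Distr d))
    (hB : ∀ φ : TestFun d, ∃ C : ℝ, ∀ t ∈ B, ‖pairing t φ‖ ≤ C) (χ : TestFun d) :
    ∃ (m : ℕ) (C : ℝ), 0 ≤ C ∧ ∀ t ∈ B, ∀ ξ, ‖fourierCut t χ ξ‖ ≤ C * (1 + ‖ξ‖) ^ m := by
  by_contra! hcon
  -- The same `m` is used as exponent and as constant, so that a single sequence violates every
  -- candidate bound.
  have hcon' : ∀ m : ℕ, ∃ t ∈ B, ∃ ξ, (m : ℝ) * (1 + ‖ξ‖) ^ m < ‖fourierCut t χ ξ‖ :=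
    fun m => hcon m m (Nat.cast_nonneg _)
  choose t ht ξ hξ using hcon'
  have hcont : ∀ s : Distr d, ∃ S : SummableSeq →L[ℂ] ℂ, ∀ a, S a = seriesForm s χ ξ a := fun s => by
    obtain ⟨C, hC⟩ := exists_seriesForm_bound s χ ξ
    exact ⟨(seriesForm s χ ξ).mkContinuous C hC, fun a => rfl⟩
  choose S hS using hcont
  -- For fixed `a` the series times `χ` is one test function, so weak boundedness of `B` is
  -- pointwise boundedness of the forms on the Banach space `ℓ¹`.
  obtain ⟨C, hC⟩ := banach_steinhaus (g := fun s : B => S s) fun a => by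
    obtain ⟨C, hC⟩ := hB (mulSmooth _ (contDiff_series (ξ := ξ) a.summable) χ)
    exact ⟨C, fun s => by rw [hS]; exact hC s s.2⟩
  -- The `k`-th unit vector has norm one and isolates the transform of `t k` at `ξ k`, which was
  -- chosen larger than `k (1 + |ξ k|)^k`.
  obtain ⟨k, hk⟩ := exists_nat_gt C
  have h1 := (S (t k)).le_opNorm (lp.single 1 k 1)
  have hn : ‖(lp.single 1 k (1 : ℂ) : SummableSeq)‖ = 1 := by
    rw [SummableSeq.norm_eq, tsum_eq_single k]
    · simp
    · intro j hj; simp [hj]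
  rw [hn, mul_one, hS, seriesForm_single, norm_mul, Complex.norm_real,
    Real.norm_of_nonneg (by positivity), inv_mul_le_iff₀ (by positivity)] at h1
  have h2 := (hξ k).trans_le h1
  have h3 : ‖S (t k)‖ ≤ C := hC ⟨t k, ht k⟩
  rw [mul_comm] at h2
  exact absurd (lt_of_mul_lt_mul_left h2 (by positivity)) (not_lt.2 (h3.trans hk.le))

theorem one_add_norm_le_mul (ξ η : E d) : 1 + ‖ξ‖ ≤ (1 + ‖ξ - η‖) * (1 + ‖η‖) := by
  have h1 : ‖ξ‖ ≤ ‖ξ - η‖ + ‖η‖ := by simpa using norm_add_le (ξ - η) η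
  nlinarith [norm_nonneg (ξ - η), norm_nonneg η]

/-- Weak convergence to zero of a sequence of distributions implies locally uniform convergence of
the Fourier transforms, with polynomial weights. -/
theorem exists_tendsto_norm_fourierCut_le (u : ℕ → Distr d)
    (hu : ∀ φ : TestFun d, Tendsto (fun n => pairing (u n) φ) atTop (𝓝 0)) (χ : TestFun d) :
    ∃ (m : ℕ) (c : ℕ → ℝ), Tendsto c atTop (𝓝 0) ∧
      ∀ n ξ, ‖fourierCut (u n) χ ξ‖ ≤ c n * (1 + ‖ξ‖) ^ m := by
  obtain ⟨m, C, hC, hm⟩ := exists_uniform_norm_fourierCut_le (Set.range u) (fun φ => by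
    obtain ⟨C, hC⟩ := (Metric.isBounded_range_of_tendsto _ (hu φ)).exists_norm_le
    exact ⟨C, by rintro _ ⟨n, rfl⟩; exact hC _ ⟨n, rfl⟩⟩) χ
  -- Since `χ = ρχ`, the transform of `uₙχ` is its own convolution with `ρ̂`. This turns pointwise
  -- convergence with a uniform polynomial bound into convergence of a weighted `L¹` norm, and then
  -- of a weighted sup norm.
  obtain ⟨ρ, hρ, -⟩ := exists_cutoff χ.hasCompactSupport isOpen_univ (subset_univ _)
  have hρχ : mulTest ρ χ = χ := mulTest_eq_right hρ
  obtain ⟨M, hM0, hM⟩ := exists_norm_fhat_le ρ (m + (d + 1))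
  let f : ℕ → E d → ℝ := fun n ζ => ((1 + ‖ζ‖) ^ (m + (d + 1)))⁻¹ * ‖fourierCut (u n) χ ζ‖
  have hfc : ∀ n, Continuous (f n) := fun n => by
    have := continuous_fourierCut (u n) χ
    have h0 : ∀ ζ : E d, (1 + ‖ζ‖) ^ (m + (d + 1)) ≠ 0 := fun ζ => by positivity
    exact (Continuous.inv₀ (by fun_prop) h0).mul this.norm
  have hfb : ∀ n ζ, ‖f n ζ‖ ≤ C * ((1 + ‖ζ‖) ^ (d + 1))⁻¹ := fun n ζ => by
    rw [Real.norm_of_nonneg (by positivity), inv_mul_le_iff₀ (by positivity)]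
    refine (hm _ ⟨n, rfl⟩ ζ).trans (le_of_eq ?_)
    rw [pow_add]
    field_simp
  have hint := (integrable_one_add_norm_inv_pow (d := d)).const_mul C
  have hlim : Tendsto (fun n => ∫ ζ, f n ζ) atTop (𝓝 0) := by
    have h := tendsto_integral_of_dominated_convergence (F := f) (f := fun _ => (0 : ℝ)) _
      (fun n => (hfc n).aestronglyMeasurable) hint
      (fun n => Eventually.of_forall (hfb n)) (Eventually.of_forall fun ζ => ?_)
    · simpa using h
    · have h1 := (hu (mulSmooth (character ζ) (contDiff_character ζ) χ)).norm.const_mul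
        ((1 + ‖ζ‖) ^ (m + (d + 1)))⁻¹
      rw [norm_zero, mul_zero] at h1
      exact h1
  refine ⟨m + (d + 1), fun n => ‖normConst d‖ * (M * ∫ ζ, f n ζ), ?_, fun n ξ => ?_⟩
  · simpa using (hlim.const_mul M).const_mul ‖normConst d‖
  · rw [← hρχ, fourierCut_mulTest, norm_mul, mul_assoc]
    refine mul_le_mul_of_nonneg_left ?_ (norm_nonneg _)
    rw [← integral_sub_left_eq_self _ _ ξ, mul_right_comm, ← integral_const_mul]
    refine norm_integral_le_of_norm_le ((hint.mono' (hfc n).aestronglyMeasurable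
      (Eventually.of_forall (hfb n))).const_mul _) (Eventually.of_forall fun ζ => ?_)
    rw [sub_sub_cancel, norm_mul]
    change _ ≤ M * (1 + ‖ξ‖) ^ (m + (d + 1)) *
      (((1 + ‖ζ‖) ^ (m + (d + 1)))⁻¹ * ‖fourierCut (u n) χ ζ‖)
    rw [← mul_assoc]
    refine mul_le_mul_of_nonneg_right ?_ (norm_nonneg _)
    rw [← div_eq_mul_inv, le_div_iff₀ (by positivity)]
    have h1 := one_add_norm_le_mul ζ ξ
    rw [norm_sub_rev] at h1
    calc ‖fhat ρ (ξ - ζ)‖ * (1 + ‖ζ‖) ^ (m + (d + 1))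
        ≤ ‖fhat ρ (ξ - ζ)‖ * ((1 + ‖ξ - ζ‖) * (1 + ‖ξ‖)) ^ (m + (d + 1)) := by gcongr
      _ = (1 + ‖ξ - ζ‖) ^ (m + (d + 1)) * ‖fhat ρ (ξ - ζ)‖ * (1 + ‖ξ‖) ^ (m + (d + 1)) := by
          rw [mul_pow]; ring
      _ ≤ _ := by gcongr; exact hM _

end Microlocal

/-! ### Weights and convolution estimates -/

namespace Microlocal

variable {d : ℕ}

/-- The weight `1 + |ξ|`. -/
noncomputable def wt (ξ : E d) : ℝ≥0 := 1 + ‖ξ‖₊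

theorem coe_wt (ξ : E d) : (wt ξ : ℝ) = 1 + ‖ξ‖ := rfl

theorem one_le_wt (ξ : E d) : 1 ≤ wt ξ := le_self_add

theorem wt_pos (ξ : E d) : 0 < wt ξ := zero_lt_one.trans_le (one_le_wt ξ)

theorem wt_neg (ξ : E d) : wt (-ξ) = wt ξ := by simp [wt]

theorem wt_le_mul (ξ η : E d) : wt ξ ≤ wt (ξ - η) * wt η := by
  have := one_add_norm_le_mul ξ η
  exact_mod_cast this

theorem wt_sub_le_mul (ξ η : E d) : wt (ξ - η) ≤ wt ξ * wt η := by
  have := wt_le_mul (ξ - η) (-η)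
  rwa [wt_neg, sub_neg_eq_add, sub_add_cancel] at this

theorem wt_right_le_mul (ξ η : E d) : wt η ≤ wt ξ * wt (ξ - η) := by
  have := wt_sub_le_mul ξ (ξ - η)
  rwa [sub_sub_cancel] at this

/-- Quantitative transversality: the sum of a covector outside `V₁` and one outside `V₂` stays away
from `V ∪ {0}`. -/
def Separated (ε : ℝ≥0) (V₁ V₂ V : Set (E d)) : Prop :=
  ∀ a ∉ V₁, ∀ b ∉ V₂, ∀ v : E d, (v = 0 ∨ v ∈ V) → ε * (‖a‖ + ‖b‖) ≤ ‖a + b - v‖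

theorem measurable_wt : Measurable (wt : E d → ℝ≥0) := by
  unfold wt; fun_prop

/-- The integral of `(1 + |η|)^{-(d+1)}`. -/
noncomputable def wtMass (d : ℕ) : ℝ≥0∞ := ∫⁻ η : E d, (((wt η ^ (d + 1))⁻¹ : ℝ≥0) : ℝ≥0∞)

theorem wtMass_lt_top (d : ℕ) : wtMass d < ⊤ := by
  have h := (integrable_one_add_norm_inv_pow (d := d)).2
  rw [hasFiniteIntegral_iff_enorm] at h
  refine (lintegral_mono fun η => le_of_eq ?_).trans_lt h
  rw [← ofReal_norm, Real.norm_of_nonneg (by positivity), ← ENNReal.ofReal_coe_nnreal]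
  simp [coe_wt]

theorem lintegral_wt_sub (ξ : E d) :
    ∫⁻ η : E d, (((wt (ξ - η) ^ (d + 1))⁻¹ : ℝ≥0) : ℝ≥0∞) = wtMass d :=
  lintegral_sub_left_eq_self (fun η : E d => (((wt η ^ (d + 1))⁻¹ : ℝ≥0) : ℝ≥0∞)) ξ

/-- Of the `N` powers of decay in `H`, `m` cancel the factor `H` in the bound for `W` and `n`
remain; with `n = d + 1` the remainder is integrable. -/
theorem pow_mul_inv_le_of_le_mul {W H X K : ℝ≥0} {m n N : ℕ} (hH : 1 ≤ H) (h : W ≤ K * X * H)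
    (hN : m + n ≤ N) : W ^ m * (H ^ N)⁻¹ ≤ K ^ m * X ^ m * (H ^ n)⁻¹ := by
  have hH0 : 0 < H := zero_lt_one.trans_le hH
  rw [← div_eq_mul_inv, div_le_iff₀ (by positivity)]
  calc W ^ m ≤ (K * X * H) ^ m := by gcongr
    _ = K ^ m * X ^ m * (H ^ n)⁻¹ * H ^ (m + n) := by rw [pow_add, mul_pow, mul_pow]; field_simp
    _ ≤ _ := by gcongr

theorem mul_le_mul_coe_of_le {a b A B : ℝ≥0∞} {u v w : ℝ≥0} (ha : a ≤ A * u) (hb : b ≤ B * v)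
    (h : u * v ≤ w) : a * b ≤ A * B * w :=
  calc a * b ≤ A * u * (B * v) := mul_le_mul' ha hb
    _ = A * B * ((u * v : ℝ≥0) : ℝ≥0∞) := by push_cast; ring
    _ ≤ _ := by gcongr

theorem volume_closedBall_div_le (ξ : E d) (ε : ℝ≥0) :
    volume (Metric.closedBall (0 : E d) (‖ξ‖ / ε)) ≤
      ((ε⁻¹ ^ d : ℝ≥0) : ℝ≥0∞) * volume (Metric.ball (0 : E d) 1) * ((wt ξ ^ d : ℝ≥0) : ℝ≥0∞) := by
  rw [Measure.addHaar_closedBall _ _ (by positivity), finrank_euclideanSpace_fin,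
    mul_right_comm, ← ENNReal.coe_mul, ← ENNReal.ofReal_coe_nnreal]
  gcongr
  push_cast
  rw [← mul_pow, coe_wt]
  gcongr
  rw [div_eq_inv_mul]
  gcongr
  linarith

/-- Convolution of functions of polynomial growth with rapid decay in transversal cones: polynomial
growth. -/
theorem exists_lintegral_conv_le_wt (m₁ m₂ N₁ N₂ : ℕ) (hN₁ : m₂ + d + 1 ≤ N₁)
    (hN₂ : m₁ + d + 1 ≤ N₂) {ε : ℝ≥0} (hε : 0 < ε) :
    ∃ C : ℝ≥0, ∀ {V₁ V₂ V : Set (E d)}, Separated ε V₁ V₂ V → ∀ {a b : E d → ℝ≥0∞}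
      {A A' B B' : ℝ≥0∞}, (∀ ξ, a ξ ≤ A * ((wt ξ ^ m₁ : ℝ≥0) : ℝ≥0∞)) →
      (∀ ξ ∈ V₁, a ξ ≤ A' * (((wt ξ ^ N₁)⁻¹ : ℝ≥0) : ℝ≥0∞)) →
      (∀ ξ, b ξ ≤ B * ((wt ξ ^ m₂ : ℝ≥0) : ℝ≥0∞)) →
      (∀ ξ ∈ V₂, b ξ ≤ B' * (((wt ξ ^ N₂)⁻¹ : ℝ≥0) : ℝ≥0∞)) → ∀ ξ,
      ∫⁻ η, a (ξ - η) * b η ≤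
        C * ((wt ξ ^ (m₁ + m₂ + d) : ℝ≥0) : ℝ≥0∞) * ((A + A') * (B + B')) := by
  let K : ℝ≥0 := 1 + ε⁻¹
  let M : ℝ≥0∞ := wtMass d + wtMass d + ((K ^ m₁ * K ^ m₂ : ℝ≥0) : ℝ≥0∞) *
    (((ε⁻¹ ^ d : ℝ≥0) : ℝ≥0∞) * volume (Metric.ball (0 : E d) 1))
  have hM : M ≠ ⊤ := by
    have h1 := (wtMass_lt_top d).ne
    have h2 := (measure_ball_lt_top (μ := volume) (x := (0 : E d)) (r := 1)).ne
    simp only [M]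
    finiteness
  refine ⟨M.toNNReal, fun {V₁ V₂ V} hV {a b A A' B B'} ha ha' hb hb' ξ => ?_⟩
  rw [ENNReal.coe_toNNReal hM]
  have hX := one_le_wt ξ
  -- This ball contains every `η` for which neither factor decays; its volume is responsible for the
  -- `d` in the exponent `m₁ + m₂ + d`.
  let S := Metric.closedBall (0 : E d) (‖ξ‖ / ε)
  have key : ∀ η, a (ξ - η) * b η ≤ ((A + A') * (B + B')) *
      (((wt ξ ^ (m₁ + m₂ + d) : ℝ≥0) : ℝ≥0∞) * (((wt η ^ (d + 1))⁻¹ : ℝ≥0) : ℝ≥0∞) +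
      ((wt ξ ^ (m₁ + m₂ + d) : ℝ≥0) : ℝ≥0∞) * (((wt (ξ - η) ^ (d + 1))⁻¹ : ℝ≥0) : ℝ≥0∞) +
      S.indicator (fun _ => ((K ^ m₁ * K ^ m₂ * wt ξ ^ (m₁ + m₂) : ℝ≥0) : ℝ≥0∞)) η) := by
    intro η
    have hW := one_le_wt (ξ - η)
    have hH := one_le_wt η
    -- Decay of `b` beats the growth of `a`, because `wt (ξ - η) ≤ wt ξ * wt η`.
    by_cases h2 : η ∈ V₂
    · have h : wt (ξ - η) ^ m₁ * (wt η ^ N₂)⁻¹ ≤ wt ξ ^ (m₁ + m₂ + d) * (wt η ^ (d + 1))⁻¹ := by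
        refine (pow_mul_inv_le_of_le_mul (K := 1) (X := wt ξ) (n := d + 1) hH
          (by rw [one_mul]; exact wt_sub_le_mul ξ η) (by omega)).trans ?_
        rw [one_pow, one_mul]
        gcongr
        omega
      refine (mul_le_mul_coe_of_le (ha _) (hb' η h2) h).trans ?_
      rw [ENNReal.coe_mul]
      gcongr
      · exact le_self_add
      · exact le_add_self
      · exact le_self_add.trans le_self_add
    by_cases h1 : ξ - η ∈ V₁
    · have h : (wt (ξ - η) ^ N₁)⁻¹ * wt η ^ m₂
          ≤ wt ξ ^ (m₁ + m₂ + d) * (wt (ξ - η) ^ (d + 1))⁻¹ := by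
        rw [mul_comm (_)⁻¹]
        refine (pow_mul_inv_le_of_le_mul (K := 1) (X := wt ξ) (n := d + 1) hW
          (by rw [one_mul]; exact wt_right_le_mul ξ η) (by omega)).trans ?_
        rw [one_pow, one_mul]
        gcongr
        omega
      refine (mul_le_mul_coe_of_le (ha' _ h1) (hb η) h).trans ?_
      rw [ENNReal.coe_mul]
      gcongr
      · exact le_add_self
      · exact le_self_add
      · exact le_add_self.trans le_self_add
    -- Neither factor decays: separation with `v = 0` bounds both frequencies by `‖ξ‖ / ε`.
    · have h0 := hV _ h1 _ h2 0 (Or.inl rfl)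
      rw [sub_add_cancel, sub_zero] at h0
      have hε' : (0 : ℝ) < ε := hε
      have h3 : ‖ξ - η‖ + ‖η‖ ≤ ‖ξ‖ / ε := by
        rw [le_div_iff₀ hε', mul_comm]; exact h0
      have hηS : η ∈ S := by
        rw [mem_closedBall_zero_iff]
        linarith [norm_nonneg (ξ - η)]
      have hK : ∀ ζ : E d, ‖ζ‖ ≤ ‖ξ‖ / ε → wt ζ ≤ K * wt ξ := fun ζ hζ => by
        rw [← NNReal.coe_le_coe]
        push_cast [K, coe_wt]
        rw [div_eq_inv_mul] at hζ
        have : (0 : ℝ) ≤ (ε : ℝ)⁻¹ := by positivity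
        nlinarith [norm_nonneg ξ]
      have h : wt (ξ - η) ^ m₁ * wt η ^ m₂ ≤ K ^ m₁ * K ^ m₂ * wt ξ ^ (m₁ + m₂) := by
        calc _ ≤ (K * wt ξ) ^ m₁ * (K * wt ξ) ^ m₂ := by
              gcongr
              · exact hK _ (by linarith [norm_nonneg η])
              · exact hK _ (by linarith [norm_nonneg (ξ - η)])
          _ = _ := by rw [mul_pow, mul_pow, pow_add]; ring
      refine (mul_le_mul_coe_of_le (ha _) (hb η) h).trans ?_
      rw [indicator_of_mem hηS]
      gcongr
      · exact le_self_add
      · exact le_self_add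
      · exact le_add_self
  have hm1 : Measurable fun η : E d => (((wt η ^ (d + 1))⁻¹ : ℝ≥0) : ℝ≥0∞) := by
    have := measurable_wt (d := d); fun_prop
  have hm2 : Measurable fun η : E d => (((wt (ξ - η) ^ (d + 1))⁻¹ : ℝ≥0) : ℝ≥0∞) := by
    have := measurable_wt (d := d); fun_prop
  have hS : MeasurableSet S := Metric.isClosed_closedBall.measurableSet
  calc _ ≤ _ := lintegral_mono key
    _ = ((A + A') * (B + B')) * (((wt ξ ^ (m₁ + m₂ + d) : ℝ≥0) : ℝ≥0∞) * wtMass d +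
          ((wt ξ ^ (m₁ + m₂ + d) : ℝ≥0) : ℝ≥0∞) * wtMass d +
          ((K ^ m₁ * K ^ m₂ * wt ξ ^ (m₁ + m₂) : ℝ≥0) : ℝ≥0∞) * volume S) := by
        have hm3 : Measurable (S.indicator fun _ : E d =>
            ((K ^ m₁ * K ^ m₂ * wt ξ ^ (m₁ + m₂) : ℝ≥0) : ℝ≥0∞)) := measurable_const.indicator hS
        rw [lintegral_const_mul, lintegral_add_right _ hm3, lintegral_add_left,
          lintegral_const_mul _ hm1, lintegral_const_mul _ hm2, lintegral_wt_sub,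
          lintegral_indicator_const hS]
        · rfl
        · exact hm1.const_mul _
        · exact ((hm1.const_mul _).add (hm2.const_mul _)).add hm3
    _ ≤ ((A + A') * (B + B')) * (((wt ξ ^ (m₁ + m₂ + d) : ℝ≥0) : ℝ≥0∞) * wtMass d +
          ((wt ξ ^ (m₁ + m₂ + d) : ℝ≥0) : ℝ≥0∞) * wtMass d +
          ((K ^ m₁ * K ^ m₂ * wt ξ ^ (m₁ + m₂) : ℝ≥0) : ℝ≥0∞) *
            (((ε⁻¹ ^ d : ℝ≥0) : ℝ≥0∞) * volume (Metric.ball (0 : E d) 1) *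
              ((wt ξ ^ d : ℝ≥0) : ℝ≥0∞))) := by
        gcongr
        exact volume_closedBall_div_le ξ ε
    _ = _ := by
        rw [pow_add _ (m₁ + m₂) d]
        push_cast
        simp only [M]
        push_cast
        ring

/-- Convolution of functions of polynomial growth with rapid decay in transversal cones: rapid decay
in a cone that avoids the sums. -/
theorem exists_lintegral_conv_le_inv_wt (m₁ m₂ N : ℕ) (hm₁ : m₁ + d + 1 ≤ N)
    (hm₂ : m₂ + d + 1 ≤ N) {ε : ℝ≥0} (hε : 0 < ε) :
    ∃ C : ℝ≥0, ∀ {V₁ V₂ V : Set (E d)}, Separated ε V₁ V₂ V → 0 ∉ V₁ → 0 ∉ V₂ → 0 ∉ V →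
      ∀ {a b : E d → ℝ≥0∞} {A A' B B' B'' : ℝ≥0∞},
      (∀ ξ, a ξ ≤ A * ((wt ξ ^ m₁ : ℝ≥0) : ℝ≥0∞)) →
      (∀ ξ ∈ V₁, a ξ ≤ A' * (((wt ξ ^ (2 * N))⁻¹ : ℝ≥0) : ℝ≥0∞)) →
      (∀ ξ, b ξ ≤ B * ((wt ξ ^ m₂ : ℝ≥0) : ℝ≥0∞)) →
      (∀ ξ ∈ V₂, b ξ ≤ B' * (((wt ξ ^ (2 * N))⁻¹ : ℝ≥0) : ℝ≥0∞)) →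
      (∀ ξ ∈ V₂, b ξ ≤ B'' * (((wt ξ ^ N)⁻¹ : ℝ≥0) : ℝ≥0∞)) → ∀ ξ ∈ V,
      ((wt ξ ^ N : ℝ≥0) : ℝ≥0∞) * ∫⁻ η, a (ξ - η) * b η ≤
        C * (B' * A + A' * B + A' * B'') := by
  let K : ℝ≥0 := 2 + ε⁻¹
  have hK1 : 1 ≤ K := le_trans one_le_two le_self_add
  let M : ℝ≥0∞ := ((K ^ (2 * N) : ℝ≥0) : ℝ≥0∞) * (wtMass d + wtMass d)
  have hM : M ≠ ⊤ := by
    have h1 := (wtMass_lt_top d).ne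
    simp only [M]
    finiteness
  refine ⟨M.toNNReal, fun {V₁ V₂ V} hV h01 h02 h0 {a b A A' B B' B''} ha ha' hb hb' hb'' ξ hξ => ?_⟩
  rw [ENNReal.coe_toNNReal hM]
  have hε' : (0 : ℝ) < ε := hε
  -- When the frequency `x` of the non-decaying factor is controlled by the frequency `y` of the
  -- decaying one, so is their sum `ξ`.
  have hcomp : ∀ x y : E d, ε * ‖x‖ ≤ ‖y‖ → wt x ≤ K * wt y ∧ wt (x + y) ≤ K * wt y := by
    intro x y h
    have h3 : ‖x‖ ≤ (ε : ℝ)⁻¹ * ‖y‖ := by rwa [← div_eq_inv_mul, le_div_iff₀ hε', mul_comm]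
    have h4 : (0 : ℝ) ≤ (ε : ℝ)⁻¹ := by positivity
    constructor <;> rw [← NNReal.coe_le_coe] <;> push_cast [K, coe_wt]
    · nlinarith [norm_nonneg y]
    · nlinarith [norm_nonneg y, norm_add_le x y]
  -- This is why decay of order `2N` is required: `N` powers pay for the weight `X ^ N`, and the
  -- other `N` for the growth `H ^ m` and the integrable remainder.
  have hdec : ∀ (m : ℕ) (X W H : ℝ≥0), 1 ≤ W → m + d + 1 ≤ N → X ≤ K * W → H ≤ K * W →
      X ^ N * ((W ^ (2 * N))⁻¹ * H ^ m) ≤ K ^ (2 * N) * (W ^ (d + 1))⁻¹ := by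
    intro m X W H hW hm hX hH
    have hW0 : 0 < W := zero_lt_one.trans_le hW
    calc X ^ N * ((W ^ (2 * N))⁻¹ * H ^ m)
        ≤ (K * W) ^ N * ((W ^ (2 * N))⁻¹ * (K * W) ^ m) := by gcongr
      _ = K ^ (N + m) * (W ^ m * (W ^ N)⁻¹) := by
          rw [two_mul, pow_add, pow_add, mul_pow, mul_pow]; field_simp
      _ ≤ K ^ (2 * N) * (W ^ (d + 1))⁻¹ := by
          gcongr
          · omega
          · rw [← div_eq_mul_inv, div_le_iff₀ (by positivity), ← div_eq_inv_mul,
              le_div_iff₀ (by positivity), ← pow_add]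
            gcongr
            omega
  have key : ∀ η, ((wt ξ ^ N : ℝ≥0) : ℝ≥0∞) * (a (ξ - η) * b η) ≤ (B' * A + A' * B + A' * B'') *
      (((K ^ (2 * N) : ℝ≥0) : ℝ≥0∞) * ((((wt η ^ (d + 1))⁻¹ : ℝ≥0) : ℝ≥0∞) +
        (((wt (ξ - η) ^ (d + 1))⁻¹ : ℝ≥0) : ℝ≥0∞))) := by
    intro η
    have hW := one_le_wt (ξ - η)
    have hH := one_le_wt η
    have hW0 := wt_pos (ξ - η)
    have hH0 := wt_pos η
    have fin1 : ∀ {p q P Q : ℝ≥0∞} {u v : ℝ≥0} (w : ℝ≥0), p ≤ P * u → q ≤ Q * v →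
        wt ξ ^ N * (u * v) ≤ w → ((wt ξ ^ N : ℝ≥0) : ℝ≥0∞) * (p * q) ≤ P * Q * w :=
      fun {p q P Q u v} w hp hq h => by
        calc _ ≤ ((wt ξ ^ N : ℝ≥0) : ℝ≥0∞) * (P * u * (Q * v)) := by gcongr
          _ = P * Q * ((wt ξ ^ N * (u * v) : ℝ≥0) : ℝ≥0∞) := by push_cast; ring
          _ ≤ _ := by gcongr
    by_cases h1 : ξ - η ∈ V₁
    · by_cases h2 : η ∈ V₂
      -- Both factors decay and `wt ξ ≤ wt (ξ - η) * wt η`, so order `N` is enough for `b`, and the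
      -- surplus decay of `a` is integrable.
      · have h : wt ξ ^ N * ((wt (ξ - η) ^ (2 * N))⁻¹ * (wt η ^ N)⁻¹)
            ≤ K ^ (2 * N) * (wt (ξ - η) ^ (d + 1))⁻¹ := by
          calc _ ≤ (wt (ξ - η) * wt η) ^ N * ((wt (ξ - η) ^ (2 * N))⁻¹ * (wt η ^ N)⁻¹) := by
                gcongr; exact wt_le_mul ξ η
            _ = 1 * (wt (ξ - η) ^ N)⁻¹ := by
                rw [two_mul, pow_add, mul_pow]; field_simp
            _ ≤ _ := by
                gcongr
                · exact one_le_pow₀ hK1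
                · omega
        refine (fin1 _ (ha' _ h1) (hb'' η h2) h).trans ?_
        rw [ENNReal.coe_mul]
        gcongr
        · exact le_add_self
        · exact le_add_self
      -- Since `0 ∉ V₁`, separation applies to the pair `0`, `η` and gives `ε ‖η‖ ≤ ‖ξ - η‖`.
      · have h3 := hV 0 h01 η h2 ξ (Or.inr hξ)
        rw [norm_zero, zero_add, zero_add, norm_sub_rev] at h3
        obtain ⟨h4, h5⟩ := hcomp _ _ h3
        rw [add_sub_cancel] at h5
        refine (fin1 _ (ha' _ h1) (hb η) (hdec m₂ _ _ _ hW hm₂ h5 h4)).trans ?_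
        rw [ENNReal.coe_mul]
        gcongr
        · exact le_add_self.trans le_self_add
        · exact le_add_self
    · by_cases h2 : η ∈ V₂
      · have h3 := hV _ h1 0 h02 ξ (Or.inr hξ)
        rw [norm_zero, add_zero, add_zero, sub_sub_cancel_left, norm_neg] at h3
        obtain ⟨h4, h5⟩ := hcomp _ _ h3
        rw [sub_add_cancel] at h5
        rw [mul_comm (a _)]
        refine (fin1 _ (hb' η h2) (ha _) (hdec m₁ _ _ _ hH hm₁ h5 h4)).trans ?_
        rw [ENNReal.coe_mul]
        gcongr
        · exact le_self_add.trans le_self_add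
        · exact le_self_add
      -- Separation applied to `(ξ - η) + η = ξ ∈ V` forces both summands to vanish, whereas `0 ∉
      -- V`.
      · exfalso
        have h3 := hV _ h1 _ h2 ξ (Or.inr hξ)
        rw [sub_add_cancel, sub_self, norm_zero] at h3
        have h4 : ‖ξ - η‖ + ‖η‖ ≤ 0 := by
          by_contra hc
          push Not at hc
          exact absurd h3 (not_le.2 (mul_pos hε' hc))
        have h5 : ξ = 0 := by
          rw [← norm_le_zero_iff]
          have := norm_add_le (ξ - η) η
          rw [sub_add_cancel] at this
          linarith
        exact h0 (h5 ▸ hξ)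
  have hm1 : Measurable fun η : E d => (((wt η ^ (d + 1))⁻¹ : ℝ≥0) : ℝ≥0∞) := by
    have := measurable_wt (d := d); fun_prop
  have hm2 : Measurable fun η : E d => (((wt (ξ - η) ^ (d + 1))⁻¹ : ℝ≥0) : ℝ≥0∞) := by
    have := measurable_wt (d := d); fun_prop
  rw [← lintegral_const_mul' _ _ ENNReal.coe_ne_top]
  calc _ ≤ _ := lintegral_mono key
    _ = (B' * A + A' * B + A' * B'') * M := by
        rw [lintegral_const_mul, lintegral_const_mul, lintegral_add_left hm1, lintegral_wt_sub]
        · rfl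
        · exact hm1.add hm2
        · exact (hm1.add hm2).const_mul _
    _ = _ := mul_comm _ _

end Microlocal

/-! ### Geometry of closed cones -/

namespace Microlocal

variable {d : ℕ}

/-- Closed cones `V₁`, `V₂` that avoid `Γ₁`, `Γ₂` over the open set `U` and are separated from the
cone `V`. -/
structure LocalCones (Γ₁ Γ₂ : Set (E d × E d)) (U V₁ V₂ V : Set (E d)) (ε : ℝ≥0) : Prop where
  isOpen : IsOpen U
  closedCone₁ : IsClosedCone V₁
  closedCone₂ : IsClosedCone V₂
  avoid₁ : (U ×ˢ V₁) ∩ Γ₁ = ∅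
  avoid₂ : (U ×ˢ V₂) ∩ Γ₂ = ∅
  pos : 0 < ε
  separated : Separated ε V₁ V₂ V

/-- The cone of the covectors that stay away from `C`. -/
def awayCone (C : Set (E d)) (δ : ℝ) : Set (E d) := {ξ | ξ ≠ 0 ∧ ∀ c ∈ C, δ * ‖ξ‖ ≤ ‖ξ - c‖}

theorem isClosed_away (C : Set (E d)) (δ : ℝ) : IsClosed {ξ : E d | ∀ c ∈ C, δ * ‖ξ‖ ≤ ‖ξ - c‖} := by
  have : {ξ : E d | ∀ c ∈ C, δ * ‖ξ‖ ≤ ‖ξ - c‖} = ⋂ c ∈ C, {ξ : E d | δ * ‖ξ‖ ≤ ‖ξ - c‖} := by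
    ext; simp
  rw [this]
  exact isClosed_biInter fun c _ => isClosed_le (by fun_prop) (by fun_prop)

theorem isClosedCone_awayCone {C : Set (E d)} (hC : ∀ ξ ∈ C, ∀ c : ℝ, 0 < c → c • ξ ∈ C) (δ : ℝ) :
    IsClosedCone (awayCone C δ) where
  ne_zero _ h := h.1
  smul_mem ξ h r hr := by
    refine ⟨smul_ne_zero hr.ne' h.1, fun c hc => ?_⟩
    have h1 := h.2 _ (hC c hc r⁻¹ (inv_pos.2 hr))
    have h2 : r • ξ - c = r • (ξ - r⁻¹ • c) := by rw [smul_sub, smul_inv_smul₀ hr.ne']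
    rw [h2, norm_smul, norm_smul, Real.norm_of_nonneg hr.le]
    calc δ * (r * ‖ξ‖) = r * (δ * ‖ξ‖) := by ring
      _ ≤ _ := by gcongr
  closed := by
    rintro ξ ⟨h1, h2⟩
    refine ⟨h2, ?_⟩
    have : awayCone C δ ⊆ {ξ : E d | ∀ c ∈ C, δ * ‖ξ‖ ≤ ‖ξ - c‖} := fun _ h => h.2
    exact closure_minimal this (isClosed_away C δ) h1

theorem exists_mem_of_not_mem_awayCone {C : Set (E d)} {δ : ℝ} {ξ : E d}
    (h : ξ ∉ awayCone C δ) : ∃ c, (c = 0 ∨ c ∈ C) ∧ ‖ξ - c‖ ≤ δ * ‖ξ‖ := by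
  by_cases h0 : ξ = 0
  · exact ⟨0, Or.inl rfl, by simp [h0]⟩
  · have h1 : ¬ ∀ c ∈ C, δ * ‖ξ‖ ≤ ‖ξ - c‖ := fun h' => h ⟨h0, h'⟩
    push Not at h1
    obtain ⟨c, hc, h2⟩ := h1
    exact ⟨c, Or.inr hc, h2.le⟩

theorem IsClosedCone.isClosed_insert {V : Set (E d)} (hV : IsClosedCone V) :
    IsClosed (insert 0 V) := by
  refine isClosed_of_closure_subset fun ξ hξ => ?_
  by_cases h0 : ξ = 0
  · exact Or.inl h0
  · rw [insert_eq, closure_union, closure_singleton] at hξ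
    rcases hξ with h | h
    · exact Or.inl h
    · exact Or.inr (hV.closed ⟨h, h0⟩)

theorem IsClosedCone.smul_mem_insert {V : Set (E d)} (hV : IsClosedCone V) {ξ : E d}
    (h : ξ ∈ insert 0 V) {c : ℝ} (hc : 0 < c) : c • ξ ∈ insert 0 V := by
  rcases h with rfl | h
  · simp
  · exact Or.inr (hV.smul_mem _ h _ hc)

theorem isClosedCone_fiber {Γ : Set (E d × E d)} (hΓ : IsClosedConic Γ) (x : E d) :
    IsClosedCone {ξ | (x, ξ) ∈ Γ} where
  ne_zero ξ h := hΓ.ne_zero _ h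
  smul_mem ξ h c hc := hΓ.smul_mem _ h c hc
  closed := by
    rintro ξ ⟨h1, h2⟩
    refine hΓ.closed ⟨?_, h2⟩
    exact map_mem_closure (f := fun ξ : E d => (x, ξ)) (by fun_prop) h1 fun ξ h => h

/-- If no nontrivial sum of elements of two closed cones lies in a third one, then sums stay away
from the third one. -/
theorem exists_mul_norm_add_le_norm_sub {C₁ C₂ V : Set (E d)} (h₁ : IsClosedCone C₁)
    (h₂ : IsClosedCone C₂) (hV : IsClosedCone V)
    (h : ∀ a ∈ insert 0 C₁, ∀ b ∈ insert 0 C₂, a + b ∈ insert 0 V → a = 0 ∧ b = 0) :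
    ∃ ε : ℝ, 0 < ε ∧ ε ≤ 1 ∧ ∀ a ∈ insert 0 C₁, ∀ b ∈ insert 0 C₂, ∀ v ∈ insert 0 V,
      ε * (‖a‖ + ‖b‖) ≤ ‖a + b - v‖ := by
  -- By homogeneity it suffices to bound the distance from `a + b` to `V ∪ {0}` below on the compact
  -- set `|a| + |b| = 1`; it is positive there by hypothesis.
  let T : Set (E d × E d) := (insert 0 C₁ ×ˢ insert 0 C₂) ∩ {p | ‖p.1‖ + ‖p.2‖ = 1}
  have hTc : IsCompact T := by
    refine Metric.isCompact_of_isClosed_isBounded ((h₁.isClosed_insert.prod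
      h₂.isClosed_insert).inter (isClosed_eq (by fun_prop) (by fun_prop))) ?_
    refine (Metric.isBounded_closedBall (x := (0 : E d × E d)) (r := 1)).subset fun p hp => ?_
    have := hp.2
    rw [mem_ofPred_eq] at this
    rw [mem_closedBall_zero_iff, Prod.norm_def]
    exact max_le (by linarith [norm_nonneg p.2]) (by linarith [norm_nonneg p.1])
  let f : E d × E d → ℝ := fun p => Metric.infDist (p.1 + p.2) (insert 0 V)
  have hne : (insert (0 : E d) V).Nonempty := insert_nonempty _ _
  have hf : Continuous f := (Metric.continuous_infDist_pt _).comp (by fun_prop)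
  have hpos : ∀ p ∈ T, 0 < f p := fun p hp => by
    refine (hV.isClosed_insert.notMem_iff_infDist_pos hne).1 fun h' => ?_
    obtain ⟨h3, h4⟩ := h _ hp.1.1 _ hp.1.2 h'
    have := hp.2
    simp [h3, h4] at this
  obtain ⟨ε, hε, hεf⟩ : ∃ ε : ℝ, 0 < ε ∧ ∀ p ∈ T, ε ≤ f p := by
    rcases T.eq_empty_or_nonempty with h0 | h0
    · exact ⟨1, one_pos, by simp [h0]⟩
    · obtain ⟨p, hp, hm⟩ := hTc.exists_isMinOn h0 hf.continuousOn
      exact ⟨f p, hpos p hp, fun q hq => hm hq⟩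
  refine ⟨min ε 1, lt_min hε one_pos, min_le_right _ _, fun a ha b hb v hv => ?_⟩
  rcases (add_nonneg (norm_nonneg a) (norm_nonneg b)).eq_or_lt with h0 | h0
  · rw [← h0, mul_zero]; exact norm_nonneg _
  set r := ‖a‖ + ‖b‖
  have hr : 0 < r⁻¹ := inv_pos.2 h0
  have hT : (r⁻¹ • a, r⁻¹ • b) ∈ T := by
    refine ⟨⟨h₁.smul_mem_insert ha hr, h₂.smul_mem_insert hb hr⟩, ?_⟩
    simp only [mem_ofPred_eq, norm_smul, Real.norm_of_nonneg hr.le, ← mul_add]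
    exact inv_mul_cancel₀ h0.ne'
  have h5 := (hεf _ hT).trans (Metric.infDist_le_dist_of_mem (hV.smul_mem_insert hv hr))
  rw [dist_eq_norm, ← smul_add, ← smul_sub, norm_smul, Real.norm_of_nonneg hr.le,
    ← div_eq_inv_mul, le_div_iff₀ h0] at h5
  exact (mul_le_mul_of_nonneg_right (min_le_left _ _) h0.le).trans h5

/-- The unit covectors far from the fibre over `x` form a compact set, and its product with `{x}`
misses the closure of `Γ`. The tube lemma thickens `{x}` to an open set, and homogeneity passes from
unit covectors to the cone. -/
theorem exists_isOpen_prod_awayCone {Γ : Set (E d × E d)} (hΓ : IsClosedConic Γ) (x : E d) {δ : ℝ}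
    (hδ : 0 < δ) :
    ∃ U : Set (E d), IsOpen U ∧ x ∈ U ∧ (U ×ˢ awayCone {ξ | (x, ξ) ∈ Γ} δ) ∩ Γ = ∅ := by
  let S : Set (E d) := {ξ | ∀ c ∈ {ξ | (x, ξ) ∈ Γ}, δ * ‖ξ‖ ≤ ‖ξ - c‖} ∩ Metric.sphere 0 1
  have hS : IsCompact S := (isCompact_sphere _ _).inter_left (isClosed_away _ _)
  obtain ⟨u, v, hu, hv, hxu, hSv, huv⟩ := generalized_tube_lemma (isCompact_singleton (x := x)) hS
    (isClosed_closure (s := Γ)).isOpen_compl (by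
      rintro ⟨y, ξ⟩ ⟨hy, h1, h2⟩ hc
      obtain rfl : y = x := hy
      have h0 : ξ ≠ 0 := by
        rintro rfl
        simp at h2
      have h3 := h1 ξ (hΓ.closed ⟨hc, h0⟩)
      rw [sub_self, norm_zero] at h3
      exact absurd h3 (not_le.2 (mul_pos hδ (norm_pos_iff.2 h0))))
  refine ⟨u, hu, hxu rfl, ?_⟩
  rw [eq_empty_iff_forall_notMem]
  rintro ⟨y, ξ⟩ ⟨⟨hy, hξ⟩, hΓ'⟩
  have hξ0 : 0 < ‖ξ‖⁻¹ := inv_pos.2 (norm_pos_iff.2 hξ.1)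
  have hξ' := ((isClosedCone_awayCone (isClosedCone_fiber hΓ x).smul_mem δ).smul_mem ξ hξ _ hξ0)
  refine huv (mk_mem_prod hy (hSv ⟨hξ'.2, ?_⟩)) (subset_closure (hΓ.smul_mem _ hΓ' _ hξ0))
  simp [norm_smul, hξ.1]

/-- The fibres `C₁`, `C₂` over `x` are separated from `V`: a vanishing sum is excluded by `hΓ`, a
sum in `V` by `hxV`. Separation survives a small conic enlargement of the fibres, and the
complements of the enlargements still avoid `Γ₁` and `Γ₂` over a neighbourhood of `x`. -/
theorem exists_localCones {Γ₁ Γ₂ : Set (E d × E d)} (hΓ₁ : IsClosedConic Γ₁)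
    (hΓ₂ : IsClosedConic Γ₂) (hΓ : Γ₁ ∩ fiberNeg Γ₂ = ∅) (x : E d) {V : Set (E d)}
    (hV : IsClosedCone V) (hxV : ∀ v ∈ V, (x, v) ∉ prodCone Γ₁ Γ₂) :
    ∃ U V₁ V₂ ε, x ∈ U ∧ LocalCones Γ₁ Γ₂ U V₁ V₂ V ε := by
  let C₁ : Set (E d) := {ξ | (x, ξ) ∈ Γ₁}
  let C₂ : Set (E d) := {ξ | (x, ξ) ∈ Γ₂}
  have h₁ : IsClosedCone C₁ := isClosedCone_fiber hΓ₁ x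
  have h₂ : IsClosedCone C₂ := isClosedCone_fiber hΓ₂ x
  obtain ⟨ε, hε, hε1, hsep⟩ := exists_mul_norm_add_le_norm_sub h₁ h₂ hV (by
    rintro a (rfl | ha) b (rfl | hb) hab
    · exact ⟨rfl, rfl⟩
    · rw [zero_add] at hab
      rcases hab with rfl | hab
      · exact ⟨rfl, rfl⟩
      · exact absurd (Or.inl (Or.inr hb)) (hxV b hab)
    · rw [add_zero] at hab
      rcases hab with rfl | hab
      · exact ⟨rfl, rfl⟩
      · exact absurd (Or.inl (Or.inl ha)) (hxV a hab)
    · rcases hab with hab | hab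
      · exfalso
        have : (x, a) ∈ Γ₁ ∩ fiberNeg Γ₂ := by
          refine ⟨ha, ?_⟩
          rw [add_eq_zero_iff_eq_neg'] at hab
          change (x, -a) ∈ Γ₂
          rw [← hab]
          exact hb
        rw [hΓ] at this
        exact this
      · exact absurd (Or.inr ⟨a, b, ha, hb, rfl⟩) (hxV _ hab))
  -- Moving `a` and `b` by `ε/4` of their norms loses a factor `1 - ε/4` on the left and `ε/4` on
  -- the right; since `ε ≤ 1`, the constant `ε/2` survives.
  have hδ : 0 < ε / 4 := by positivity
  obtain ⟨U₁, hU₁, hx₁, ha₁⟩ := exists_isOpen_prod_awayCone hΓ₁ x hδ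
  obtain ⟨U₂, hU₂, hx₂, ha₂⟩ := exists_isOpen_prod_awayCone hΓ₂ x hδ
  refine ⟨U₁ ∩ U₂, awayCone C₁ (ε / 4), awayCone C₂ (ε / 4), ⟨ε / 2, by positivity⟩, ⟨hx₁, hx₂⟩,
    hU₁.inter hU₂, isClosedCone_awayCone h₁.smul_mem _, isClosedCone_awayCone h₂.smul_mem _,
    ?_, ?_, ?_, ?_⟩
  · exact subset_eq_empty (inter_subset_inter_left _ (prod_mono inter_subset_left subset_rfl)) ha₁
  · exact subset_eq_empty (inter_subset_inter_left _ (prod_mono inter_subset_right subset_rfl)) ha₂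
  · exact NNReal.coe_pos.1 (half_pos hε)
  · intro a ha b hb v hv
    obtain ⟨c₁, hc₁, hac⟩ := exists_mem_of_not_mem_awayCone ha
    obtain ⟨c₂, hc₂, hbc⟩ := exists_mem_of_not_mem_awayCone hb
    have h := hsep c₁ hc₁ c₂ hc₂ v hv
    change ε / 2 * (‖a‖ + ‖b‖) ≤ ‖a + b - v‖
    have e1 : ‖c₁ + c₂ - v‖ ≤ ‖a + b - v‖ + ‖a - c₁‖ + ‖b - c₂‖ := by
      have : c₁ + c₂ - v = (a + b - v) - (a - c₁) - (b - c₂) := by abel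
      rw [this]
      exact (norm_sub_le _ _).trans (add_le_add_left (norm_sub_le _ _) _)
    have e2 : ‖a‖ ≤ ‖a - c₁‖ + ‖c₁‖ := by simpa using norm_add_le (a - c₁) c₁
    have e3 : ‖b‖ ≤ ‖b - c₂‖ + ‖c₂‖ := by simpa using norm_add_le (b - c₂) c₂
    have e4 : (1 - ε / 4) * (‖a‖ + ‖b‖) ≤ ‖c₁‖ + ‖c₂‖ := by linarith
    have e5 := mul_le_mul_of_nonneg_left e4 hε.le
    have e6 : 0 ≤ (1 - ε) * (ε * (‖a‖ + ‖b‖)) := mul_nonneg (by linarith) (by positivity)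
    nlinarith

/-- The ray spanned by a covector. -/
def ray (ξ₀ : E d) : Set (E d) := {v | ∃ c : ℝ, 0 < c ∧ v = c • ξ₀}

theorem isClosedCone_ray {ξ₀ : E d} (h0 : ξ₀ ≠ 0) : IsClosedCone (ray ξ₀) where
  ne_zero := by
    rintro _ ⟨c, hc, rfl⟩
    exact smul_ne_zero hc.ne' h0
  smul_mem := by
    rintro _ ⟨c, hc, rfl⟩ r hr
    exact ⟨r * c, mul_pos hr hc, smul_smul _ _ _⟩
  closed := by
    rintro v ⟨hv, hv0⟩
    have hc : IsClosed {v : E d | ‖ξ₀‖ • v = ‖v‖ • ξ₀} := isClosed_eq (by fun_prop) (by fun_prop)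
    have hs : ray ξ₀ ⊆ {v : E d | ‖ξ₀‖ • v = ‖v‖ • ξ₀} := by
      rintro _ ⟨c, hc, rfl⟩
      simp only [mem_ofPred_eq, norm_smul, Real.norm_of_nonneg hc.le, smul_smul, mul_comm]
    have h1 : ‖ξ₀‖ • v = ‖v‖ • ξ₀ := closure_minimal hs hc hv
    have h2 : 0 < ‖ξ₀‖ := norm_pos_iff.2 h0
    refine ⟨‖ξ₀‖⁻¹ * ‖v‖, mul_pos (inv_pos.2 h2) (norm_pos_iff.2 hv0), ?_⟩
    rw [mul_smul, ← h1, inv_smul_smul₀ h2.ne']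

/-- An open conic neighbourhood of a ray. -/
def coneNhd (ξ₀ : E d) (δ : ℝ) : Set (E d) := {v | ∃ c : ℝ, 0 < c ∧ ‖v - c • ξ₀‖ < δ * ‖v‖}

theorem isOpen_coneNhd (ξ₀ : E d) (δ : ℝ) : IsOpen (coneNhd ξ₀ δ) := by
  have : coneNhd ξ₀ δ = ⋃ (c : ℝ) (_ : 0 < c), {v | ‖v - c • ξ₀‖ < δ * ‖v‖} := by
    ext; simp [coneNhd]
  rw [this]
  exact isOpen_biUnion fun c _ => isOpen_lt (by fun_prop) (by fun_prop)

theorem mem_coneNhd_self {ξ₀ : E d} (h0 : ξ₀ ≠ 0) {δ : ℝ} (hδ : 0 < δ) : ξ₀ ∈ coneNhd ξ₀ δ :=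
  ⟨1, one_pos, by simpa using mul_pos hδ (norm_pos_iff.2 h0)⟩

theorem zero_notMem_coneNhd (ξ₀ : E d) (δ : ℝ) : 0 ∉ coneNhd ξ₀ δ := by
  rintro ⟨c, -, h⟩
  rw [norm_zero, mul_zero] at h
  exact absurd h (not_lt.2 (norm_nonneg _))

theorem smul_mem_coneNhd {ξ₀ : E d} {δ : ℝ} {v : E d} (hv : v ∈ coneNhd ξ₀ δ) {r : ℝ}
    (hr : 0 < r) : r • v ∈ coneNhd ξ₀ δ := by
  obtain ⟨c, hc, h⟩ := hv
  refine ⟨r * c, mul_pos hr hc, ?_⟩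
  rw [mul_smul, ← smul_sub, norm_smul, norm_smul, Real.norm_of_nonneg hr.le]
  calc r * ‖v - c • ξ₀‖ < r * (δ * ‖v‖) := by gcongr
    _ = _ := by ring

theorem exists_coneNhd_subset {V : Set (E d)} (hV : IsOpen V)
    (hVc : ∀ ξ ∈ V, ∀ c : ℝ, 0 < c → c • ξ ∈ V) {ξ₀ : E d} (h0 : ξ₀ ≠ 0) (hξ₀ : ξ₀ ∈ V) :
    ∃ δ : ℝ, 0 < δ ∧ δ ≤ 1 ∧ coneNhd ξ₀ δ ⊆ V := by
  obtain ⟨r, hr, hrV⟩ := Metric.isOpen_iff.1 hV ξ₀ hξ₀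
  have hn : 0 < ‖ξ₀‖ := norm_pos_iff.2 h0
  -- The value `1/2` gives `‖v‖ ≤ 2c‖ξ₀‖`; the other one then places `c⁻¹ • v` in the ball of radius
  -- `r` about `ξ₀`.
  refine ⟨min (1 / 2) (r / (2 * ‖ξ₀‖)), by positivity, (min_le_left _ _).trans (by norm_num), ?_⟩
  rintro v ⟨c, hc, hv⟩
  have h1 : ‖v‖ ≤ ‖v - c • ξ₀‖ + c * ‖ξ₀‖ := by
    have := norm_add_le (v - c • ξ₀) (c • ξ₀)
    rwa [sub_add_cancel, norm_smul, Real.norm_of_nonneg hc.le] at this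
  have h2 : ‖v - c • ξ₀‖ ≤ 1 / 2 * ‖v‖ :=
    hv.le.trans (mul_le_mul_of_nonneg_right (min_le_left _ _) (norm_nonneg _))
  have h3 : ‖v - c • ξ₀‖ < c * r := by
    calc ‖v - c • ξ₀‖ < _ := hv
      _ ≤ r / (2 * ‖ξ₀‖) * (2 * (c * ‖ξ₀‖)) := by
          gcongr
          · exact min_le_right _ _
          · linarith
      _ = c * r := by field_simp
  have h4 : c⁻¹ • v ∈ V := by
    refine hrV ?_
    rw [mem_ball_iff_norm]
    have : c⁻¹ • v - ξ₀ = c⁻¹ • (v - c • ξ₀) := by rw [smul_sub, inv_smul_smul₀ hc.ne']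
    rw [this, norm_smul, Real.norm_of_nonneg (inv_pos.2 hc).le, ← div_eq_inv_mul, div_lt_iff₀ hc,
      mul_comm r]
    exact h3
  have := hVc _ h4 c hc
  rwa [smul_inv_smul₀ hc.ne'] at this

/-- Separation from a ray is an open condition. -/
theorem Separated.exists_coneNhd {ε : ℝ≥0} (hε : 0 < ε) {V₁ V₂ : Set (E d)} {ξ₀ : E d}
    (h : Separated ε V₁ V₂ (ray ξ₀)) :
    ∃ ε' : ℝ≥0, 0 < ε' ∧ Separated ε' V₁ V₂ (coneNhd ξ₀ (ε / 2)) := by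
  -- With `s = ‖a‖ + ‖b‖` and `D = ‖a + b - v‖`, separation from the ray gives `ε s ≤ D + (ε/2)‖v‖`,
  -- and `‖v‖ ≤ D + s`; solve for `D`.
  refine ⟨(ε / 2) / (1 + ε / 2), by positivity, fun a ha b hb v hv => ?_⟩
  have hε0 : (0 : ℝ) < ε := hε
  push_cast
  rw [div_mul_eq_mul_div, div_le_iff₀ (by positivity)]
  have hs : 0 ≤ ‖a‖ + ‖b‖ := by positivity
  rcases hv with rfl | ⟨c, hc, hv⟩
  · have := h a ha b hb 0 (Or.inl rfl)
    nlinarith [norm_nonneg (a + b - 0)]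
  · have h1 := h a ha b hb _ (Or.inr ⟨c, hc, rfl⟩)
    have h2 : ‖a + b - c • ξ₀‖ ≤ ‖a + b - v‖ + ‖v - c • ξ₀‖ := norm_sub_le_norm_sub_add_norm_sub ..
    have h3 : ‖v‖ ≤ ‖a + b - v‖ + (‖a‖ + ‖b‖) := by
      have := norm_sub_le (a + b) (a + b - v)
      rw [sub_sub_cancel] at this
      linarith [norm_add_le a b]
    have h4 := mul_le_mul_of_nonneg_left h3 (half_pos hε0).le
    linarith

/-- The cone `{0}ᶜ` describes a factor that decays in all directions, such as the transform of a
test function. Only `a = 0` is left outside it, so separation merely says that `b` stays away from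
the ray. -/
theorem separated_compl_zero_coneNhd {δ : ℝ≥0} (hδ : δ ≤ 1) (ξ₀ : E d) :
    Separated δ {0}ᶜ (coneNhd ξ₀ δ) (ray ξ₀) := by
  intro a ha b hb v hv
  obtain rfl : a = 0 := by simpa using ha
  have hδ' : (δ : ℝ) ≤ 1 := hδ
  rw [norm_zero, zero_add, zero_add]
  rcases hv with rfl | ⟨c, hc, rfl⟩
  · rw [sub_zero]
    exact mul_le_of_le_one_left (norm_nonneg _) hδ'
  · exact not_lt.1 fun h => hb ⟨c, hc, h⟩

end Microlocal

/-! ### Partitions of unity by squares and division of test functions -/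

namespace Microlocal

variable {d : ℕ}

open scoped Manifold in
/-- Smooth partitions of unity by squares, subordinate to an open cover indexed by points. -/
theorem exists_sq_partition (U : E d → Set (E d)) (hU : ∀ x, U x ∈ 𝓝 x) :
    ∃ (φ : ℕ → TestFun d) (c : ℕ → E d), (∀ j x, (φ j x).im = 0) ∧
      (LocallyFinite fun j => tsupport (φ j)) ∧ (∀ x, ∑ᶠ j, φ j x ^ 2 = 1) ∧
      ∀ j, tsupport (φ j) ⊆ U (c j) := by
  obtain ⟨ι, f, hf⟩ := SmoothBumpCovering.exists_isSubordinate 𝓘(ℝ, E d) (s := univ) isClosed_univ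
    (fun x _ => hU x)
  have hlf := f.locallyFinite
  have hsm : ∀ i, ContDiff ℝ ∞ (f i) := fun i => (f i).contMDiff.contDiff
  have hcount : Countable ι := by
    have := hlf.countable_univ fun i => ⟨f.c i, by simp⟩
    exact countable_univ_iff.1 this
  obtain ⟨e, he⟩ := Countable.exists_injective_nat ι
  -- The bump functions are divided by the square root of `S`, which is smooth because `S` is
  -- positive everywhere.
  let S : E d → ℝ := fun x => ∑ᶠ i, f i x ^ 2
  have hlf2 : LocallyFinite fun i => Function.support fun x => f i x ^ 2 :=
    hlf.subset fun i x hx h => hx (by simp only [h]; norm_num)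
  have hS : ContDiff ℝ ∞ S := by
    have : ContMDiff 𝓘(ℝ, E d) 𝓘(ℝ, ℝ) ∞ S :=
      contMDiff_finsum (fun i => ((hsm i).pow 2).contMDiff) hlf2
    exact this.contDiff
  have hfin : ∀ x, (Function.support fun i => f i x ^ 2).Finite := fun x =>
    (hlf2.point_finite x).subset fun i hi => hi
  have hSpos : ∀ x, 0 < S x := fun x => by
    refine finsum_pos (fun i => sq_nonneg _) ⟨f.ind x (mem_univ x), ?_⟩ (hfin x)
    rw [f.apply_ind]
    norm_num
  have hS0 : ∀ x, √(S x) ≠ 0 := fun x => (Real.sqrt_pos.2 (hSpos x)).ne'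
  let g : ι → TestFun d := fun i =>
    { toFun := fun x => ((f i x * (√(S x))⁻¹ : ℝ) : ℂ)
      contDiff' := Complex.ofRealCLM.contDiff.comp
        ((hsm i).mul ((hS.sqrt fun x => (hSpos x).ne').inv hS0))
      hasCompactSupport' := by
        refine (f i).hasCompactSupport.mono fun x hx h => hx ?_
        simp [h]
      tsupport_subset' := fun _ _ => trivial }
  have hg : ∀ i x, g i x = ((f i x * (√(S x))⁻¹ : ℝ) : ℂ) := fun _ _ => rfl
  have hgs : ∀ i, tsupport (g i) ⊆ tsupport (f i) := fun i => by
    refine closure_mono fun x hx h => hx ?_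
    rw [hg, h]
    simp
  -- The index set is countable, by local finiteness; it is injected into `ℕ` and the unused indices
  -- carry the zero function.
  let φ : ℕ → TestFun d := Function.extend e g 0
  have hφe : ∀ i, φ (e i) = g i := fun i => he.extend_apply _ _ _
  have hφ0 : ∀ n, n ∉ range e → φ n = 0 := fun n hn => Function.extend_apply' _ _ _ hn
  refine ⟨φ, Function.extend e f.c 0, fun j x => ?_, ?_, fun x => ?_, fun j => ?_⟩
  · by_cases hj : j ∈ range e
    · obtain ⟨i, rfl⟩ := hj
      rw [hφe, hg, Complex.ofReal_im]
    · rw [hφ0 j hj]; rfl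
  · intro x
    obtain ⟨t, ht, hfin⟩ := hlf.closure x
    refine ⟨t, ht, (hfin.image e).subset ?_⟩
    rintro n ⟨y, hy, hyt⟩
    by_cases hn : n ∈ range e
    · obtain ⟨i, rfl⟩ := hn
      simp only [hφe] at hy
      exact ⟨i, ⟨y, hgs i hy, hyt⟩, rfl⟩
    · simp only [hφ0 n hn] at hy
      have h0 : tsupport ((0 : TestFun d) : E d → ℂ) = ∅ := by
        rw [tsupport_eq_empty_iff]; rfl
      rw [h0] at hy
      exact hy.elim
  · have h1 : ∀ n, φ n x ^ 2 = ∑ᶠ (_ : n ∈ range e), φ n x ^ 2 := fun n => by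
      classical
      by_cases hn : n ∈ range e
      · rw [finsum_eq_if, if_pos hn]
      · rw [finsum_eq_if, if_neg hn, hφ0 n hn]
        exact zero_pow two_ne_zero
    rw [finsum_congr h1, finsum_mem_range he]
    simp only [hφe, hg]
    have h2 : ∀ i, (((f i x * (√(S x))⁻¹ : ℝ) : ℂ)) ^ 2
        = (((S x)⁻¹ : ℝ) : ℂ) * Complex.ofRealHom.toAddMonoidHom (f i x ^ 2) := fun i => by
      have : (√(S x))⁻¹ ^ 2 = (S x)⁻¹ := by rw [inv_pow, Real.sq_sqrt (hSpos x).le]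
      change _ = (((S x)⁻¹ : ℝ) : ℂ) * ((f i x ^ 2 : ℝ) : ℂ)
      rw [← this]
      push_cast
      ring
    rw [finsum_congr h2, ← mul_finsum, ← AddMonoidHom.map_finsum _ (hfin x)]
    change (((S x)⁻¹ : ℝ) : ℂ) * ((S x : ℝ) : ℂ) = 1
    rw [← Complex.ofReal_mul, inv_mul_cancel₀ (hSpos x).ne', Complex.ofReal_one]
  · by_cases hj : j ∈ range e
    · obtain ⟨i, rfl⟩ := hj
      rw [hφe, he.extend_apply]
      exact (hgs i).trans (hf i)
    · rw [hφ0 j hj]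
      have h0 : tsupport ((0 : TestFun d) : E d → ℂ) = ∅ := by
        rw [tsupport_eq_empty_iff]; rfl
      rw [h0]
      exact empty_subset _

/-- Only finitely many members of a locally finite family meet the support of a test function. -/
theorem finite_tsupport_inter {φ : ℕ → TestFun d} (hφ : LocallyFinite fun j => tsupport (φ j))
    (f : TestFun d) : {j | (tsupport (φ j) ∩ tsupport f).Nonempty}.Finite :=
  hφ.finite_nonempty_inter_compact f.hasCompactSupport

theorem mulTest_eq_zero {f g : TestFun d} (h : ¬ (tsupport g ∩ tsupport f).Nonempty) :
    mulTest f g = 0 := by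
  ext x
  rw [mulTest_apply]
  by_contra hx
  obtain ⟨h1, h2⟩ := mul_ne_zero_iff.1 hx
  exact h ⟨x, subset_tsupport _ h2, subset_tsupport _ h1⟩

/-- A partition of unity by squares decomposes test functions. -/
theorem sum_mulTest_sq {φ : ℕ → TestFun d} (hφ : ∀ x, ∑ᶠ j, φ j x ^ 2 = 1) {f : TestFun d}
    {J : Finset ℕ} (hJ : ∀ j, (tsupport (φ j) ∩ tsupport f).Nonempty → j ∈ J) :
    ∑ j ∈ J, mulTest (mulTest f (φ j)) (φ j) = f := by
  ext x
  rw [sum_apply_testFun]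
  simp only [mulTest_apply]
  by_cases hx : f x = 0
  · simp [hx]
  · have h := hφ x
    rw [finsum_eq_sum_of_support_subset (s := J)] at h
    · calc _ = f x * ∑ j ∈ J, φ j x ^ 2 := by
            rw [Finset.mul_sum]
            exact Finset.sum_congr rfl fun j _ => by ring
        _ = f x := by rw [h, mul_one]
    · intro j hj
      have hj' : φ j x ≠ 0 := fun h0 => hj (by simp [h0])
      exact hJ j ⟨x, subset_tsupport _ hj', subset_tsupport _ hx⟩

/-- The complex conjugate of a test function. -/
noncomputable def conjTest (f : TestFun d) : TestFun d where
  toFun := fun x => starRingEnd ℂ (f x)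
  contDiff' := Complex.conjCLE.contDiff.comp f.contDiff
  hasCompactSupport' := f.hasCompactSupport.comp_left (map_zero _)
  tsupport_subset' := fun _ _ => trivial

theorem conjTest_apply (f : TestFun d) (x : E d) : conjTest f x = starRingEnd ℂ (f x) := rfl

/-- Test functions are divisible by test functions that do not vanish on their supports. -/
theorem exists_mulTest_eq {χ ρ : TestFun d} (h : ∀ x ∈ tsupport χ, ρ x ≠ 0) :
    ∃ g : TestFun d, mulTest g ρ = χ := by
  refine ⟨{ toFun := fun x => χ x * (ρ x)⁻¹
            contDiff' := ?_
            hasCompactSupport' := χ.hasCompactSupport.mono fun x hx h0 => hx ?_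
            tsupport_subset' := fun _ _ => trivial }, ?_⟩
  · rw [contDiff_iff_contDiffAt]
    intro x
    by_cases hx : x ∈ tsupport χ
    · exact χ.contDiff.contDiffAt.mul (ρ.contDiff.contDiffAt.inv (h x hx))
    · refine (contDiffAt_const (c := (0 : ℂ))).congr_of_eventuallyEq ?_
      filter_upwards [(isClosed_tsupport χ).isOpen_compl.mem_nhds hx] with y hy
      rw [image_eq_zero_of_notMem_tsupport hy, zero_mul]
  · simp [h0]
  · ext x
    rw [mulTest_apply]
    change χ x * (ρ x)⁻¹ * ρ x = χ x
    by_cases hx : x ∈ tsupport χ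
    · rw [inv_mul_cancel_right₀ (h x hx)]
    · rw [image_eq_zero_of_notMem_tsupport hx, zero_mul, zero_mul]

end Microlocal

/-! ### Seminorms and their finiteness on `D'_Γ` -/

namespace Microlocal

variable {d : ℕ}

theorem ofReal_one_add_norm_pow_mul (N : ℕ) (ξ : E d) (z : ℂ) :
    ENNReal.ofReal ((1 + ‖ξ‖) ^ N * ‖z‖) = ((wt ξ ^ N : ℝ≥0) : ℝ≥0∞) * ‖z‖ₑ := by
  rw [ENNReal.ofReal_mul (by positivity), ofReal_norm, ← coe_wt, ← NNReal.coe_pow,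
    ENNReal.ofReal_coe_nnreal]

theorem wt_pow_ne_zero (ξ : E d) (N : ℕ) : wt ξ ^ N ≠ 0 := (pow_pos (wt_pos ξ) N).ne'

theorem coe_wt_pow_mul_le_iff {ξ : E d} {N : ℕ} {a C : ℝ≥0∞} :
    ((wt ξ ^ N : ℝ≥0) : ℝ≥0∞) * a ≤ C ↔ a ≤ C * (((wt ξ ^ N)⁻¹ : ℝ≥0) : ℝ≥0∞) := by
  rw [ENNReal.coe_inv (wt_pow_ne_zero ξ N), ← div_eq_mul_inv,
    ENNReal.le_div_iff_mul_le (Or.inl (by exact_mod_cast wt_pow_ne_zero ξ N))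
      (Or.inl ENNReal.coe_ne_top), mul_comm]

theorem coneNorm_le_iff {N : ℕ} {V : Set (E d)} {χ : TestFun d} {t : Distr d} {C : ℝ≥0∞} :
    coneNorm N V χ t ≤ C ↔ ∀ ξ ∈ V, ((wt ξ ^ N : ℝ≥0) : ℝ≥0∞) * ‖fourierCut t χ ξ‖ₑ ≤ C := by
  simp only [coneNorm, iSup_le_iff, ofReal_one_add_norm_pow_mul]

theorem enorm_fourierCut_le_coneNorm (N : ℕ) {V : Set (E d)} (χ : TestFun d) (t : Distr d)
    {ξ : E d} (hξ : ξ ∈ V) :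
    ‖fourierCut t χ ξ‖ₑ ≤ coneNorm N V χ t * (((wt ξ ^ N)⁻¹ : ℝ≥0) : ℝ≥0∞) :=
  coe_wt_pow_mul_le_iff.1 (coneNorm_le_iff.1 le_rfl ξ hξ)

theorem orderNorm_le_iff {m : ℕ} {χ : TestFun d} {t : Distr d} {C : ℝ≥0∞} :
    orderNorm m χ t ≤ C ↔ ∀ ξ, ‖fourierCut t χ ξ‖ₑ ≤ C * ((wt ξ ^ m : ℝ≥0) : ℝ≥0∞) := by
  rw [orderNorm, iSup_le_iff]
  refine forall_congr' fun ξ => ?_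
  rw [ENNReal.ofReal_mul (by positivity), ofReal_norm, ← coe_wt, ← NNReal.coe_pow, ← NNReal.coe_inv,
    ENNReal.ofReal_coe_nnreal, ENNReal.coe_inv (wt_pow_ne_zero ξ m), mul_comm, ← div_eq_mul_inv,
    ENNReal.div_le_iff_le_mul (Or.inl (by exact_mod_cast wt_pow_ne_zero ξ m))
      (Or.inl ENNReal.coe_ne_top)]

theorem enorm_fourierCut_le_orderNorm (m : ℕ) (χ : TestFun d) (t : Distr d) (ξ : E d) :
    ‖fourierCut t χ ξ‖ₑ ≤ orderNorm m χ t * ((wt ξ ^ m : ℝ≥0) : ℝ≥0∞) :=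
  orderNorm_le_iff.1 le_rfl ξ

theorem orderNorm_le_ofReal {m : ℕ} {χ : TestFun d} {t : Distr d} {C : ℝ}
    (h : ∀ ξ, ‖fourierCut t χ ξ‖ ≤ C * (1 + ‖ξ‖) ^ m) :
    orderNorm m χ t ≤ ENNReal.ofReal C := by
  refine iSup_le fun ξ => ENNReal.ofReal_le_ofReal ?_
  rw [inv_mul_le_iff₀ (by positivity), mul_comm]
  exact h ξ

theorem exists_orderNorm_lt_top (t : Distr d) (χ : TestFun d) : ∃ m, orderNorm m χ t < ⊤ := by
  obtain ⟨m, C, -, h⟩ := exists_norm_fourierCut_le t χ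
  exact ⟨m, (orderNorm_le_ofReal h).trans_lt ENNReal.ofReal_lt_top⟩

theorem coneNorm_mono {N M : ℕ} (hN : N ≤ M) {V W : Set (E d)} (hV : V ⊆ W) (χ : TestFun d)
    (t : Distr d) : coneNorm N V χ t ≤ coneNorm M W χ t := by
  refine iSup₂_le fun ξ hξ => le_trans ?_ (le_iSup₂ ξ (hV hξ))
  gcongr
  linarith [norm_nonneg ξ]

theorem orderNorm_anti {m n : ℕ} (h : m ≤ n) (χ : TestFun d) (t : Distr d) :
    orderNorm n χ t ≤ orderNorm m χ t := by
  refine iSup_mono fun ξ => ?_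
  gcongr
  linarith [norm_nonneg ξ]

theorem coneNorm_zero_right (N : ℕ) (V : Set (E d)) (t : Distr d) :
    coneNorm N V (0 : TestFun d) t = 0 := by simp [coneNorm]

theorem coneNorm_add_right_le (t : Distr d) (χ ψ : TestFun d) (N : ℕ) (V : Set (E d)) :
    coneNorm N V (χ + ψ) t ≤ coneNorm N V χ t + coneNorm N V ψ t := by
  refine coneNorm_le_iff.2 fun ξ hξ => ?_
  rw [fourierCut_add]
  refine (mul_le_mul_right (enorm_add_le _ _) _).trans ?_
  rw [mul_add]
  exact add_le_add (coneNorm_le_iff.1 le_rfl ξ hξ) (coneNorm_le_iff.1 le_rfl ξ hξ)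

theorem exists_enorm_fhat_le (g : TestFun d) (N : ℕ) :
    ∃ C : ℝ≥0, ∀ ζ, ‖fhat g ζ‖ₑ ≤ C * (((wt ζ ^ N)⁻¹ : ℝ≥0) : ℝ≥0∞) := by
  obtain ⟨C, hC, h⟩ := exists_norm_fhat_le g N
  refine ⟨C.toNNReal, fun ζ => coe_wt_pow_mul_le_iff.1 ?_⟩
  rw [← ofReal_one_add_norm_pow_mul]
  exact ENNReal.ofReal_le_ofReal (h ζ)

theorem enorm_fourierCut_mulTest_le (t : Distr d) (g χ : TestFun d) (ξ : E d) :
    ‖fourierCut t (mulTest g χ) ξ‖ₑ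
      ≤ ‖normConst d‖ₑ * ∫⁻ η, ‖fhat g (ξ - η)‖ₑ * ‖fourierCut t χ η‖ₑ := by
  rw [fourierCut_mulTest, enorm_mul, ← integral_sub_left_eq_self _ _ ξ]
  gcongr
  refine (enorm_integral_le_lintegral_enorm _).trans (le_of_eq ?_)
  simp only [sub_sub_cancel, enorm_mul]

/-- Multiplication by a test function preserves rapid decay up to shrinking the cone. -/
theorem coneNorm_mulTest_lt_top {ε : ℝ≥0} (hε : 0 < ε) {W V : Set (E d)}
    (h : Separated ε {0}ᶜ W V) (hW : 0 ∉ W) (hV : 0 ∉ V) {t : Distr d} {χ : TestFun d}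
    (hdec : ∀ N, coneNorm N W χ t < ⊤) (g : TestFun d) (N : ℕ) :
    coneNorm N V (mulTest g χ) t < ⊤ := by
  obtain ⟨m, hm⟩ := exists_orderNorm_lt_top t χ
  let M := N + m + d + 1
  -- Multiplication by `g` is convolution with `ĝ`, which is bounded (growth exponent `0`) and
  -- rapidly decreasing in all directions; so the first cone is `{0}ᶜ`.
  obtain ⟨C, hC⟩ := exists_lintegral_conv_le_inv_wt (d := d) 0 m M (by omega) (by omega) hε
  obtain ⟨A, hA⟩ := exists_enorm_fhat_le g 0
  obtain ⟨A', hA'⟩ := exists_enorm_fhat_le g (2 * M)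
  refine (coneNorm_mono (M := M) (by omega) subset_rfl _ _).trans_lt ?_
  have key := hC h (by simp) hW hV (a := fun ζ => ‖fhat g ζ‖ₑ) (b := fun ζ => ‖fourierCut t χ ζ‖ₑ)
    (A := A) (fun ξ => (hA ξ).trans (le_of_eq (by simp))) (fun ξ _ => hA' ξ) (enorm_fourierCut_le_orderNorm m χ t)
    (fun ξ hξ => enorm_fourierCut_le_coneNorm (2 * M) χ t hξ)
    (fun ξ hξ => enorm_fourierCut_le_coneNorm M χ t hξ)
  refine (coneNorm_le_iff.2 fun ξ hξ => ?_).trans_lt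
    (b := ‖normConst d‖ₑ * (C * (coneNorm (2 * M) W χ t * A + A' * orderNorm m χ t +
      A' * coneNorm M W χ t))) ?_
  · calc _ ≤ ((wt ξ ^ M : ℝ≥0) : ℝ≥0∞) * (‖normConst d‖ₑ *
          ∫⁻ η, ‖fhat g (ξ - η)‖ₑ * ‖fourierCut t χ η‖ₑ) := by
          gcongr; exact enorm_fourierCut_mulTest_le t g χ ξ
      _ = ‖normConst d‖ₑ * (((wt ξ ^ M : ℝ≥0) : ℝ≥0∞) *
          ∫⁻ η, ‖fhat g (ξ - η)‖ₑ * ‖fourierCut t χ η‖ₑ) := by ring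
      _ ≤ _ := mul_le_mul' le_rfl (key ξ hξ)
  · have h1 := (hdec (2 * M)).ne
    have h2 := (hdec M).ne
    have h3 := hm.ne
    rw [lt_top_iff_ne_top]
    finiteness

/-- The cone spanned by a set. -/
def coneSpan (S : Set (E d)) : Set (E d) := {v | ∃ c : ℝ, 0 < c ∧ ∃ s ∈ S, v = c • s}

theorem coneSpan_mono {S T : Set (E d)} (h : S ⊆ T) : coneSpan S ⊆ coneSpan T := by
  rintro v ⟨c, hc, s, hs, rfl⟩
  exact ⟨c, hc, s, h hs, rfl⟩

theorem coneSpan_union (S T : Set (E d)) : coneSpan (S ∪ T) ⊆ coneSpan S ∪ coneSpan T := by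
  rintro v ⟨c, hc, s, hs | hs, rfl⟩
  · exact Or.inl ⟨c, hc, s, hs, rfl⟩
  · exact Or.inr ⟨c, hc, s, hs, rfl⟩

theorem coneNorm_union_le (N : ℕ) (V W : Set (E d)) (χ : TestFun d) (t : Distr d) :
    coneNorm N (V ∪ W) χ t ≤ coneNorm N V χ t + coneNorm N W χ t := by
  refine coneNorm_le_iff.2 fun ξ hξ => ?_
  rcases hξ with hξ | hξ
  · exact (coneNorm_le_iff.1 le_rfl ξ hξ).trans le_self_add
  · exact (coneNorm_le_iff.1 le_rfl ξ hξ).trans le_add_self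

/-- Decay is asserted for all multiples of `ψ`, not only for `ψ`: in this form it survives products
and sums of cutoffs, as the compactness arguments require. The price is a smaller cone. -/
theorem exists_decay_coneNhd {t : Distr d} {x ξ₀ : E d} (h0 : ξ₀ ≠ 0)
    (h : (x, ξ₀) ∉ wavefrontSet t) :
    ∃ (ψ : TestFun d) (δ : ℝ), ψ x ≠ 0 ∧ 0 < δ ∧
      ∀ g N, coneNorm N (coneNhd ξ₀ δ) (mulTest g ψ) t < ⊤ := by
  have h' : ∃ (χ : TestFun d) (V : Set (E d)), χ x ≠ 0 ∧ IsOpen V ∧ ξ₀ ∈ V ∧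
      (∀ ξ ∈ V, ∀ c : ℝ, 0 < c → c • ξ ∈ V) ∧ ∀ N : ℕ, coneNorm N V χ t < ⊤ := by
    by_contra hc
    exact h ⟨h0, hc⟩
  obtain ⟨χ, V, hχ, hVo, hξV, hVc, hN⟩ := h'
  obtain ⟨δ, hδ, hδ1, hδV⟩ := exists_coneNhd_subset hVo hVc h0 hξV
  lift δ to ℝ≥0 using hδ.le
  have hδ' : 0 < δ := by exact_mod_cast hδ
  obtain ⟨ε, hε, hsep⟩ := (separated_compl_zero_coneNhd (by exact_mod_cast hδ1) ξ₀).exists_coneNhd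
    hδ'
  exact ⟨χ, δ / 2, hχ, by positivity, fun g N => coneNorm_mulTest_lt_top hε hsep
    (zero_notMem_coneNhd _ _) (zero_notMem_coneNhd _ _)
    (fun N => (coneNorm_mono le_rfl hδV χ t).trans_lt (hN N)) g N⟩

/-- Compactness of the unit covectors of `V`: finitely many conic neighbourhoods suffice, and the
product of their cutoffs is a multiple of each of them and does not vanish at `x`. -/
theorem exists_decay_fiber {t : Distr d} {x : E d} {V : Set (E d)} (hV : IsClosedCone V)
    (h : ∀ v ∈ V, (x, v) ∉ wavefrontSet t) :
    ∃ ψ : TestFun d, ψ x ≠ 0 ∧ ∀ g N, coneNorm N V (mulTest g ψ) t < ⊤ := by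
  have hK : IsCompact (insert 0 V ∩ Metric.sphere 0 1) :=
    (isCompact_sphere _ _).inter_left hV.isClosed_insert
  have hKV : ∀ ξ ∈ insert 0 V ∩ Metric.sphere (0 : E d) 1, ξ ∈ V := by
    rintro ξ ⟨rfl | hξ, h1⟩
    · simp at h1
    · exact hξ
  obtain ⟨ψ, hψ, hdec⟩ := hK.induction_on
    (p := fun S => ∃ ψ : TestFun d, ψ x ≠ 0 ∧ ∀ g N, coneNorm N (coneSpan S) (mulTest g ψ) t < ⊤)
    (by
      obtain ⟨ρ, hρ, -⟩ := exists_cutoff (isCompact_singleton (x := x)) isOpen_univ (subset_univ _)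
      refine ⟨ρ, by rw [hρ x rfl]; exact one_ne_zero, fun g N => ?_⟩
      have : coneSpan (∅ : Set (E d)) = ∅ := by
        rw [eq_empty_iff_forall_notMem]
        rintro v ⟨c, -, s, hs, -⟩
        exact hs
      simp [this, coneNorm])
    (by
      rintro S T hST ⟨ψ, hψ, hN⟩
      exact ⟨ψ, hψ, fun g N => (coneNorm_mono le_rfl (coneSpan_mono hST) _ _).trans_lt (hN g N)⟩)
    (by
      rintro S T ⟨ψ, hψ, hN⟩ ⟨ψ', hψ', hN'⟩
      refine ⟨mulTest ψ ψ', mul_ne_zero hψ hψ', fun g N => ?_⟩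
      refine ((coneNorm_mono le_rfl (coneSpan_union S T) _ _).trans
        (coneNorm_union_le _ _ _ _ _)).trans_lt (ENNReal.add_lt_top.2 ⟨?_, ?_⟩)
      · rw [mulTest_comm ψ, ← mulTest_assoc]
        exact hN _ _
      · rw [← mulTest_assoc]
        exact hN' _ _)
    (by
      intro ξ hξ
      have hξV := hKV ξ hξ
      obtain ⟨ψ, δ, hψ, hδ, hN⟩ := exists_decay_coneNhd (hV.ne_zero ξ hξV) (h ξ hξV)
      refine ⟨coneNhd ξ δ, mem_nhdsWithin_of_mem_nhds ((isOpen_coneNhd ξ δ).mem_nhds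
        (mem_coneNhd_self (hV.ne_zero ξ hξV) hδ)), ψ, hψ, fun g N =>
        (coneNorm_mono le_rfl ?_ _ _).trans_lt (hN g N)⟩
      rintro v ⟨c, hc, s, hs, rfl⟩
      exact smul_mem_coneNhd hs hc)
  refine ⟨ψ, hψ, fun g N => (coneNorm_mono le_rfl ?_ _ _).trans_lt (hdec g N)⟩
  intro v hv
  have hv0 : 0 < ‖v‖ := norm_pos_iff.2 (hV.ne_zero v hv)
  refine ⟨‖v‖, hv0, ‖v‖⁻¹ • v, ⟨Or.inr (hV.smul_mem v hv _ (inv_pos.2 hv0)), ?_⟩, ?_⟩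
  · simp [norm_smul, hv0.ne']
  · rw [smul_inv_smul₀ hv0.ne']

open scoped ComplexOrder in
/-- The seminorms of `D'_Γ` are finite. -/
theorem coneNorm_lt_top_of_isAdmissible {Γ : Set (E d × E d)} {V : Set (E d)} {χ : TestFun d}
    (h : IsAdmissible Γ V χ) (t : DPrime Γ) (N : ℕ) : coneNorm N V χ t.toDistr < ⊤ := by
  -- Compactness in the position variable. Local cutoffs are added rather than multiplied, and
  -- nonnegativity prevents cancellation; this is why `ψ` is replaced by `|ψ|²`.
  obtain ⟨ρ, -, hρ, hdec⟩ := χ.hasCompactSupport.induction_on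
    (p := fun S => ∃ ρ : TestFun d, (∀ x, 0 ≤ ρ x) ∧ (∀ x ∈ S, ρ x ≠ 0) ∧
      ∀ g N, coneNorm N V (mulTest g ρ) t.toDistr < ⊤)
    ⟨0, fun x => le_rfl, fun x hx => hx.elim, fun g N => by
      rw [mulTest_comm, show mulTest 0 g = 0 by ext x; exact zero_mul _, coneNorm_zero_right]
      exact ENNReal.zero_lt_top⟩
    (by
      rintro S T hST ⟨ρ, h1, h2, h3⟩
      exact ⟨ρ, h1, fun x hx => h2 x (hST hx), h3⟩)
    (by
      rintro S T ⟨ρ, h1, h2, h3⟩ ⟨ρ', h1', h2', h3'⟩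
      refine ⟨ρ + ρ', fun x => add_nonneg (h1 x) (h1' x), fun x hx h0 => ?_, fun g N => ?_⟩
      · obtain ⟨h4, h5⟩ := (add_eq_zero_iff_of_nonneg (h1 x) (h1' x)).1 h0
        rcases hx with hx | hx
        · exact h2 x hx h4
        · exact h2' x hx h5
      · have : mulTest g (ρ + ρ') = mulTest g ρ + mulTest g ρ' := by ext x; exact mul_add _ _ _
        rw [this]
        exact (coneNorm_add_right_le _ _ _ _ _).trans_lt
          (ENNReal.add_lt_top.2 ⟨h3 g N, h3' g N⟩))
    (by
      intro x hx
      obtain ⟨ψ, hψ, hdec⟩ := exists_decay_fiber (t := t.toDistr) (x := x) h.1 fun v hv hwf => by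
        have : (x, v) ∈ (tsupport χ ×ˢ V) ∩ Γ := ⟨⟨hx, hv⟩, t.wavefrontSet_subset hwf⟩
        rw [h.2] at this
        exact this
      refine ⟨{y | ψ y ≠ 0}, mem_nhdsWithin_of_mem_nhds
        ((isOpen_ne_fun ψ.continuous continuous_const).mem_nhds hψ), mulTest (conjTest ψ) ψ,
        fun y => ?_, fun y hy => ?_, fun g N => ?_⟩
      · rw [mulTest_apply, conjTest_apply, mul_comm, Complex.mul_conj]
        exact_mod_cast Complex.normSq_nonneg _
      · rw [mulTest_apply, conjTest_apply]
        exact mul_ne_zero ((map_ne_zero _).2 hy) hy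
      · rw [← mulTest_assoc]
        exact hdec _ _)
  -- As `ρ` has no zero on the support of `χ`, the cutoff `χ` is a multiple of `ρ`.
  obtain ⟨g, rfl⟩ := exists_mulTest_eq hρ
  exact hdec g N

end Microlocal

/-! ### Convolutions of localized Fourier transforms -/

namespace Microlocal

variable {d : ℕ}

/-- A linear functional on real test functions that is bounded by finitely many derivatives on each
compact set defines a distribution. -/
theorem exists_distr_of_bound (Φ : 𝓓((⊤ : Opens (E d)), ℝ) →ₗ[ℝ] ℂ)
    (h : ∀ K : Compacts (E d), ∃ (p : ℕ) (C : ℝ), 0 ≤ C ∧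
      ∀ f : 𝓓((⊤ : Opens (E d)), ℝ), tsupport f ⊆ K → ∀ A : ℝ,
        (∀ k ≤ p, ∀ x, ‖iteratedFDeriv ℝ k f x‖ ≤ A) → ‖Φ f‖ ≤ C * A) :
    ∃ P : Distr d, ∀ f, P f = Φ f := by
  let T : 𝓓((⊤ : Opens (E d)), ℝ) →L[ℝ] ℂ :=
    TestFunction.mkCLM ℝ Φ (map_add Φ) (map_smul Φ) fun K hK => by
      obtain ⟨p, C, hC, hb⟩ := h K
      refine (ContDiffMapSupportedIn.mkCLMtoNormedSpace ℝ (n := ⊤) (K := K)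
        (fun f => Φ (TestFunction.ofSupportedInCLM ℝ hK f))
        (fun f g => by rw [map_add, map_add]) (fun c f => by rw [map_smul, map_smul])
        ⟨Finset.range (p + 1), C, hC, fun f => ?_⟩).continuous
      refine hb _ (closure_minimal (fun x hx => ?_) K.isCompact.isClosed) _ fun k hk x => ?_
      · by_contra hxK
        exact hx (f.zero_on_compl hxK)
      · refine (ContDiffMapSupportedIn.norm_iteratedFDeriv_apply_le_seminorm_top ℝ).trans ?_
        exact Seminorm.le_finset_sup_apply (Finset.mem_range.2 (Nat.lt_succ_of_le hk))
  exact ⟨T, fun f => rfl⟩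

/-- The convolution of the Fourier transforms of `t₁ χ` and `t₂ ψ`. -/
noncomputable def cutConv (t₁ t₂ : Distr d) (χ ψ : TestFun d) (ξ : E d) : ℂ :=
  ∫ η, fourierCut t₁ χ (ξ - η) * fourierCut t₂ ψ η

/-- The convolution of the Fourier transforms of `t₁ χ` and `t₂ ψ` converges absolutely with
polynomial bounds. -/
def PolyConv (t₁ t₂ : Distr d) (χ ψ : TestFun d) : Prop :=
  ∃ (m : ℕ) (C : ℝ≥0), ∀ ξ, ∫⁻ η, ‖fourierCut t₁ χ (ξ - η)‖ₑ * ‖fourierCut t₂ ψ η‖ₑ ≤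
    C * ((wt ξ ^ m : ℝ≥0) : ℝ≥0∞)

variable {t₁ t₂ : Distr d} {χ ψ : TestFun d}

theorem enorm_cutConv_le (t₁ t₂ : Distr d) (χ ψ : TestFun d) (ξ : E d) :
    ‖cutConv t₁ t₂ χ ψ ξ‖ₑ ≤
      ∫⁻ η, ‖fourierCut t₁ χ (ξ - η)‖ₑ * ‖fourierCut t₂ ψ η‖ₑ := by
  refine (enorm_integral_le_lintegral_enorm _).trans (le_of_eq ?_)
  simp only [enorm_mul]

theorem cutConv_symm (t₁ t₂ : Distr d) (χ ψ : TestFun d) (ξ : E d) :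
    cutConv t₁ t₂ χ ψ ξ = cutConv t₂ t₁ ψ χ ξ := by
  unfold cutConv
  rw [← integral_sub_left_eq_self _ _ ξ]
  simp only [sub_sub_cancel, mul_comm]

theorem PolyConv.symm (h : PolyConv t₁ t₂ χ ψ) : PolyConv t₂ t₁ ψ χ := by
  obtain ⟨m, C, h⟩ := h
  refine ⟨m, C, fun ξ => le_trans (le_of_eq ?_) (h ξ)⟩
  rw [← lintegral_sub_left_eq_self _ ξ]
  simp only [sub_sub_cancel, mul_comm]

theorem PolyConv.integrable (h : PolyConv t₁ t₂ χ ψ) (ξ : E d) :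
    Integrable fun η => fourierCut t₁ χ (ξ - η) * fourierCut t₂ ψ η := by
  obtain ⟨m, C, h⟩ := h
  have h1 := continuous_fourierCut t₁ χ
  have h2 := continuous_fourierCut t₂ ψ
  refine ⟨(by fun_prop : Continuous fun η => fourierCut t₁ χ (ξ - η) *
    fourierCut t₂ ψ η).aestronglyMeasurable, ?_⟩
  rw [hasFiniteIntegral_iff_enorm]
  simp only [enorm_mul]
  exact (h ξ).trans_lt (by finiteness)

theorem PolyConv.norm_le (h : PolyConv t₁ t₂ χ ψ) :
    ∃ (m : ℕ) (C : ℝ), 0 ≤ C ∧ ∀ ξ, ‖cutConv t₁ t₂ χ ψ ξ‖ ≤ C * (1 + ‖ξ‖) ^ m := by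
  obtain ⟨m, C, h⟩ := h
  refine ⟨m, C, C.2, fun ξ => ?_⟩
  have h1 := (enorm_cutConv_le t₁ t₂ χ ψ ξ).trans (h ξ)
  rw [← ENNReal.coe_mul, enorm_le_coe] at h1
  exact_mod_cast h1

theorem wt_sub_pow_mul_inv_le (ξ ζ : E d) (m : ℕ) :
    (wt ζ ^ (m + (d + 1)))⁻¹ * wt (ξ - ζ) ^ m ≤ wt ξ ^ m * (wt ζ ^ (d + 1))⁻¹ := by
  rw [mul_comm]
  refine (pow_mul_inv_le_of_le_mul (K := 1) (X := wt ξ) (n := d + 1) (one_le_wt ζ)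
    (by rw [one_mul]; exact wt_sub_le_mul ξ ζ) le_rfl).trans ?_
  rw [one_pow, one_mul]

/-- Expand the transform of `t₁ g χ` as a convolution with `ĝ` and exchange integrals. Decay of `ĝ`
of order `m + d + 1` beats the polynomial bound of order `m` and makes the double integral
absolutely convergent. -/
theorem cutConv_mulTest_left (h : PolyConv t₁ t₂ χ ψ) (g : TestFun d) (ξ : E d) :
    cutConv t₁ t₂ (mulTest g χ) ψ ξ
      = normConst d * ∫ ζ, fhat g ζ * cutConv t₁ t₂ χ ψ (ξ - ζ) := by
  have hc1 := continuous_fourierCut t₁ χ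
  have hc2 := continuous_fourierCut t₂ ψ
  have hcg := continuous_fhat g
  obtain ⟨m, C, hC⟩ := h
  obtain ⟨M, hM⟩ := exists_enorm_fhat_le g (m + (d + 1))
  have hcont : Continuous (Function.uncurry fun η ζ =>
      fhat g ζ * fourierCut t₁ χ (ξ - η - ζ) * fourierCut t₂ ψ η) := by
    unfold Function.uncurry
    fun_prop
  have hint : Integrable (Function.uncurry fun η ζ =>
      fhat g ζ * fourierCut t₁ χ (ξ - η - ζ) * fourierCut t₂ ψ η)
      ((volume : Measure (E d)).prod volume) := by
    refine ⟨hcont.aestronglyMeasurable, ?_⟩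
    rw [hasFiniteIntegral_iff_enorm, lintegral_prod_symm _ hcont.enorm.aemeasurable]
    calc _ = ∫⁻ ζ, ‖fhat g ζ‖ₑ *
          ∫⁻ η, ‖fourierCut t₁ χ (ξ - ζ - η)‖ₑ * ‖fourierCut t₂ ψ η‖ₑ := by
          refine lintegral_congr fun ζ => ?_
          rw [← lintegral_const_mul' _ _ enorm_ne_top]
          refine lintegral_congr fun η => ?_
          simp only [Function.uncurry, enorm_mul, mul_assoc, sub_right_comm]
      _ ≤ ∫⁻ ζ, (M * C * ((wt ξ ^ m : ℝ≥0) : ℝ≥0∞)) * (((wt ζ ^ (d + 1))⁻¹ : ℝ≥0) : ℝ≥0∞) := by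
          refine lintegral_mono fun ζ => (mul_le_mul_coe_of_le (hM ζ) (hC _)
            (wt_sub_pow_mul_inv_le ξ ζ m)).trans (le_of_eq ?_)
          push_cast
          ring
      _ = (M * C * ((wt ξ ^ m : ℝ≥0) : ℝ≥0∞)) * wtMass d := by
          rw [lintegral_const_mul' _ _ (by finiteness)]
          rfl
      _ < ⊤ := by
          have := (wtMass_lt_top d).ne
          rw [lt_top_iff_ne_top]
          finiteness
  unfold cutConv
  simp only [fourierCut_mulTest]
  calc _ = normConst d * ∫ η, ∫ ζ, fhat g ζ * fourierCut t₁ χ (ξ - η - ζ) * fourierCut t₂ ψ η := by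
        rw [← integral_const_mul]
        refine integral_congr_ae (Eventually.of_forall fun η => ?_)
        change _ = normConst d * ∫ ζ, _
        rw [integral_mul_const]
        exact mul_assoc _ _ _
    _ = _ := by
        rw [integral_integral_swap hint]
        congr 1
        refine integral_congr_ae (Eventually.of_forall fun ζ => ?_)
        change (∫ η, _) = fhat g ζ * ∫ η, _
        rw [← integral_const_mul]
        refine integral_congr_ae (Eventually.of_forall fun η => ?_)
        change fhat g ζ * fourierCut t₁ χ (ξ - η - ζ) * _ = fhat g ζ * (fourierCut t₁ χ (ξ - ζ - η) * _)
        rw [sub_right_comm, mul_assoc]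

/-- The formula for a cutoff on the first factor is symmetric in the two factors. Moving cutoffs
makes the product independent of the way a test function is split. -/
theorem cutConv_mulTest_move (h : PolyConv t₁ t₂ χ ψ) (g : TestFun d) (ξ : E d) :
    cutConv t₁ t₂ (mulTest g χ) ψ ξ = cutConv t₁ t₂ χ (mulTest g ψ) ξ := by
  rw [cutConv_mulTest_left h, cutConv_symm t₁ t₂ χ, cutConv_mulTest_left h.symm]
  simp only [cutConv_symm t₁ t₂]

/-- The pairing of the product with test functions is controlled by finitely many derivatives. -/
theorem exists_norm_cutConv_mulTest_le (h : PolyConv t₁ t₂ χ ψ) (K : Compacts (E d)) :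
    ∃ (p : ℕ) (C : ℝ), 0 ≤ C ∧ ∀ f : TestFun d, tsupport f ⊆ K → ∀ A : ℝ,
      (∀ k ≤ p, ∀ x, ‖iteratedFDeriv ℝ k f x‖ ≤ A) →
        ‖cutConv t₁ t₂ (mulTest f χ) ψ 0‖ ≤ C * A := by
  obtain ⟨m, M, hM, hb⟩ := h.norm_le
  obtain ⟨C, hC, hf⟩ := exists_fhat_bound K (m + (d + 1))
  have hI : 0 ≤ ∫ ζ : E d, ((1 + ‖ζ‖) ^ (d + 1))⁻¹ := integral_nonneg fun ζ => by positivity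
  refine ⟨m + (d + 1), ‖normConst d‖ * (C * M * ∫ ζ : E d, ((1 + ‖ζ‖) ^ (d + 1))⁻¹), by positivity,
    fun f hfK A hA => ?_⟩
  have hA0 : 0 ≤ A := (norm_nonneg _).trans (hA 0 (Nat.zero_le _) 0)
  rw [cutConv_mulTest_left h, norm_mul, mul_assoc]
  refine mul_le_mul_of_nonneg_left ?_ (norm_nonneg _)
  have e : C * M * (∫ ζ : E d, ((1 + ‖ζ‖) ^ (d + 1))⁻¹) * A
      = ∫ ζ : E d, (C * M * A) * ((1 + ‖ζ‖) ^ (d + 1))⁻¹ := by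
    rw [integral_const_mul]; ring
  rw [e]
  refine norm_integral_le_of_norm_le (integrable_one_add_norm_inv_pow.const_mul _)
    (Eventually.of_forall fun ζ => ?_)
  rw [norm_mul, zero_sub, ← div_eq_mul_inv, le_div_iff₀ (by positivity)]
  have h1 := hf f hfK A hA ζ
  have h2 := hb (-ζ)
  rw [norm_neg] at h2
  calc ‖fhat f ζ‖ * ‖cutConv t₁ t₂ χ ψ (-ζ)‖ * (1 + ‖ζ‖) ^ (d + 1)
      ≤ ‖fhat f ζ‖ * (M * (1 + ‖ζ‖) ^ m) * (1 + ‖ζ‖) ^ (d + 1) := by gcongr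
    _ = M * ((1 + ‖ζ‖) ^ (m + (d + 1)) * ‖fhat f ζ‖) := by rw [pow_add]; ring
    _ ≤ M * (C * A) := by gcongr
    _ = _ := by ring

theorem cutConv_zero_left (t₁ t₂ : Distr d) (ψ : TestFun d) (ξ : E d) :
    cutConv t₁ t₂ 0 ψ ξ = 0 := by simp [cutConv]

theorem cutConv_add_left {χ' : TestFun d} (h : PolyConv t₁ t₂ χ ψ) (h' : PolyConv t₁ t₂ χ' ψ)
    (ξ : E d) : cutConv t₁ t₂ (χ + χ') ψ ξ = cutConv t₁ t₂ χ ψ ξ + cutConv t₁ t₂ χ' ψ ξ := by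
  unfold cutConv
  rw [← integral_add (h.integrable ξ) (h'.integrable ξ)]
  simp only [fourierCut_add, add_mul]

theorem cutConv_smul_left (t₁ t₂ : Distr d) (χ ψ : TestFun d) (c : ℂ) (ξ : E d) :
    cutConv t₁ t₂ (c • χ) ψ ξ = c * cutConv t₁ t₂ χ ψ ξ := by
  unfold cutConv
  rw [← integral_const_mul]
  simp only [fourierCut_smul, mul_assoc]

theorem cutConv_sum_left {J : Finset ℕ} {f : ℕ → TestFun d} (h : ∀ j ∈ J, PolyConv t₁ t₂ (f j) ψ)
    (ξ : E d) : cutConv t₁ t₂ (∑ j ∈ J, f j) ψ ξ = ∑ j ∈ J, cutConv t₁ t₂ (f j) ψ ξ := by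
  unfold cutConv
  rw [← integral_finsetSum _ fun j hj => (h j hj).integrable ξ]
  simp only [fourierCut_sum, Finset.sum_mul]

theorem cutConv_mulSmooth_character (t₁ t₂ : Distr d) (χ ψ : TestFun d) (ζ ξ : E d) :
    cutConv t₁ t₂ (mulSmooth (character ζ) (contDiff_character ζ) χ) ψ ξ
      = cutConv t₁ t₂ χ ψ (ξ + ζ) := by
  unfold cutConv
  simp only [fourierCut_mulSmooth_character, add_sub_right_comm]

theorem cutConv_sub {s₁ s₂ : Distr d} (h : PolyConv s₁ s₂ χ ψ) (h' : PolyConv t₁ t₂ χ ψ)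
    (h₁₂ : PolyConv (s₁ - t₁) (s₂ - t₂) χ ψ) (h₁ : PolyConv (s₁ - t₁) t₂ χ ψ)
    (h₂ : PolyConv t₁ (s₂ - t₂) χ ψ) (ξ : E d) :
    cutConv s₁ s₂ χ ψ ξ - cutConv t₁ t₂ χ ψ ξ
      = cutConv (s₁ - t₁) (s₂ - t₂) χ ψ ξ + cutConv (s₁ - t₁) t₂ χ ψ ξ
        + cutConv t₁ (s₂ - t₂) χ ψ ξ := by
  have i := (h₁₂.integrable ξ).add (h₁.integrable ξ)
  have e := integral_add i (h₂.integrable ξ)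
  have e' := integral_add (h₁₂.integrable ξ) (h₁.integrable ξ)
  unfold cutConv
  rw [← integral_sub (h.integrable ξ) (h'.integrable ξ)]
  refine Eq.trans ?_ (e.trans (congrArg (· + _) e'))
  refine integral_congr_ae (Eventually.of_forall fun η => ?_)
  simp only [fourierCut_sub_left, Pi.add_apply]
  ring

theorem LocalCones.isAdmissible₁ {Γ₁ Γ₂ : Set (E d × E d)} {U V₁ V₂ V : Set (E d)} {ε : ℝ≥0}
    (h : LocalCones Γ₁ Γ₂ U V₁ V₂ V ε) (hχ : tsupport χ ⊆ U) : IsAdmissible Γ₁ V₁ χ :=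
  ⟨h.closedCone₁,
    subset_eq_empty (inter_subset_inter_left _ (prod_mono hχ subset_rfl)) h.avoid₁⟩

theorem LocalCones.isAdmissible₂ {Γ₁ Γ₂ : Set (E d × E d)} {U V₁ V₂ V : Set (E d)} {ε : ℝ≥0}
    (h : LocalCones Γ₁ Γ₂ U V₁ V₂ V ε) (hχ : tsupport χ ⊆ U) : IsAdmissible Γ₂ V₂ χ :=
  ⟨h.closedCone₂,
    subset_eq_empty (inter_subset_inter_left _ (prod_mono hχ subset_rfl)) h.avoid₂⟩

theorem Separated.exists_enorm_cutConv_le (m₁ m₂ N₁ N₂ : ℕ) (hN₁ : m₂ + d + 1 ≤ N₁)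
    (hN₂ : m₁ + d + 1 ≤ N₂) {ε : ℝ≥0} (hε : 0 < ε) {V₁ V₂ V : Set (E d)}
    (h : Separated ε V₁ V₂ V) :
    ∃ C : ℝ≥0, ∀ (t₁ t₂ : Distr d) (χ ψ : TestFun d) (ξ : E d),
      ∫⁻ η, ‖fourierCut t₁ χ (ξ - η)‖ₑ * ‖fourierCut t₂ ψ η‖ₑ ≤
        C * ((wt ξ ^ (m₁ + m₂ + d) : ℝ≥0) : ℝ≥0∞) *
          ((orderNorm m₁ χ t₁ + coneNorm N₁ V₁ χ t₁) *
            (orderNorm m₂ ψ t₂ + coneNorm N₂ V₂ ψ t₂)) := by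
  obtain ⟨C, hC⟩ := exists_lintegral_conv_le_wt (d := d) m₁ m₂ N₁ N₂ hN₁ hN₂ hε
  exact ⟨C, fun t₁ t₂ χ ψ ξ => hC h (a := fun ξ => ‖fourierCut t₁ χ ξ‖ₑ)
    (b := fun ξ => ‖fourierCut t₂ ψ ξ‖ₑ) (enorm_fourierCut_le_orderNorm m₁ χ t₁)
    (fun ξ hξ => enorm_fourierCut_le_coneNorm N₁ χ t₁ hξ)
    (enorm_fourierCut_le_orderNorm m₂ ψ t₂)
    (fun ξ hξ => enorm_fourierCut_le_coneNorm N₂ ψ t₂ hξ) ξ⟩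

theorem Separated.exists_wt_pow_mul_enorm_cutConv_le (m₁ m₂ N : ℕ) (hm₁ : m₁ + d + 1 ≤ N)
    (hm₂ : m₂ + d + 1 ≤ N) {ε : ℝ≥0} (hε : 0 < ε) {V₁ V₂ V : Set (E d)}
    (h : Separated ε V₁ V₂ V) (h₁ : 0 ∉ V₁) (h₂ : 0 ∉ V₂) (h₀ : 0 ∉ V) :
    ∃ C : ℝ≥0, ∀ (t₁ t₂ : Distr d) (χ ψ : TestFun d), ∀ ξ ∈ V,
      ((wt ξ ^ N : ℝ≥0) : ℝ≥0∞) *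
          ∫⁻ η, ‖fourierCut t₁ χ (ξ - η)‖ₑ * ‖fourierCut t₂ ψ η‖ₑ ≤
        C * (coneNorm (2 * N) V₂ ψ t₂ * orderNorm m₁ χ t₁ +
          coneNorm (2 * N) V₁ χ t₁ * orderNorm m₂ ψ t₂ +
          coneNorm (2 * N) V₁ χ t₁ * coneNorm N V₂ ψ t₂) := by
  obtain ⟨C, hC⟩ := exists_lintegral_conv_le_inv_wt (d := d) m₁ m₂ N hm₁ hm₂ hε
  exact ⟨C, fun t₁ t₂ χ ψ ξ => hC h h₁ h₂ h₀ (a := fun ξ => ‖fourierCut t₁ χ ξ‖ₑ)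
    (b := fun ξ => ‖fourierCut t₂ ψ ξ‖ₑ) (enorm_fourierCut_le_orderNorm m₁ χ t₁)
    (fun ξ hξ => enorm_fourierCut_le_coneNorm (2 * N) χ t₁ hξ)
    (enorm_fourierCut_le_orderNorm m₂ ψ t₂)
    (fun ξ hξ => enorm_fourierCut_le_coneNorm (2 * N) ψ t₂ hξ)
    (fun ξ hξ => enorm_fourierCut_le_coneNorm N ψ t₂ hξ) ξ⟩

theorem Separated.polyConv {ε : ℝ≥0} (hε : 0 < ε) {V₁ V₂ V : Set (E d)}
    (h : Separated ε V₁ V₂ V) (h₁ : ∀ N, coneNorm N V₁ χ t₁ < ⊤) (h₂ : ∀ N, coneNorm N V₂ ψ t₂ < ⊤) :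
    PolyConv t₁ t₂ χ ψ := by
  obtain ⟨m₁, hm₁⟩ := exists_orderNorm_lt_top t₁ χ
  obtain ⟨m₂, hm₂⟩ := exists_orderNorm_lt_top t₂ ψ
  obtain ⟨C, hC⟩ := h.exists_enorm_cutConv_le m₁ m₂ _ _ le_rfl le_rfl hε
  let M := C * ((orderNorm m₁ χ t₁ + coneNorm (m₂ + d + 1) V₁ χ t₁) *
    (orderNorm m₂ ψ t₂ + coneNorm (m₁ + d + 1) V₂ ψ t₂))
  have hM : M ≠ ⊤ := by
    have h3 := (h₁ (m₂ + d + 1)).ne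
    have h4 := (h₂ (m₁ + d + 1)).ne
    have h5 := hm₁.ne
    have h6 := hm₂.ne
    simp only [M]
    finiteness
  refine ⟨m₁ + m₂ + d, M.toNNReal, fun ξ => (hC t₁ t₂ χ ψ ξ).trans (le_of_eq ?_)⟩
  rw [ENNReal.coe_toNNReal hM, mul_right_comm]

theorem coneNorm_sub_le (N : ℕ) (V : Set (E d)) (χ : TestFun d) (t s : Distr d) :
    coneNorm N V χ (t - s) ≤ coneNorm N V χ t + coneNorm N V χ s := by
  refine coneNorm_le_iff.2 fun ξ hξ => ?_
  rw [fourierCut_sub_left]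
  refine (mul_le_mul' le_rfl (enorm_sub_le)).trans ?_
  rw [mul_add]
  exact add_le_add (coneNorm_le_iff.1 le_rfl ξ hξ) (coneNorm_le_iff.1 le_rfl ξ hξ)

end Microlocal

/-! ### Construction, uniqueness and wave front set of the product -/

namespace Microlocal

variable {d : ℕ} {Γ₁ Γ₂ : Set (E d × E d)}

/-- All the seminorms `‖·‖_{N,V,χ}` of `D'_Γ` are finite at `t`. -/
def FiniteConeNorms (Γ : Set (E d × E d)) (t : Distr d) : Prop :=
  ∀ (V : Set (E d)) (χ : TestFun d), IsAdmissible Γ V χ → ∀ N, coneNorm N V χ t < ⊤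

theorem DPrime.finiteConeNorms {Γ : Set (E d × E d)} (t : DPrime Γ) :
    FiniteConeNorms Γ t.toDistr := fun _ _ h N => coneNorm_lt_top_of_isAdmissible h t N

/-- Continuity involves products with differences of distributions. Finiteness of the seminorms
passes to differences at once, with no recourse to their wave front sets. -/
theorem FiniteConeNorms.sub {Γ : Set (E d × E d)} {t s : Distr d} (ht : FiniteConeNorms Γ t)
    (hs : FiniteConeNorms Γ s) : FiniteConeNorms Γ (t - s) := fun V χ h N =>
  (coneNorm_sub_le N V χ t s).trans_lt (ENNReal.add_lt_top.2 ⟨ht V χ h N, hs V χ h N⟩)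

theorem LocalCones.polyConv {U V₁ V₂ V : Set (E d)} {ε : ℝ≥0}
    (h : LocalCones Γ₁ Γ₂ U V₁ V₂ V ε) {t₁ t₂ : Distr d} (h₁ : FiniteConeNorms Γ₁ t₁)
    (h₂ : FiniteConeNorms Γ₂ t₂) {χ ψ : TestFun d} (hχ : tsupport χ ⊆ U) (hψ : tsupport ψ ⊆ U) :
    PolyConv t₁ t₂ χ ψ :=
  h.separated.polyConv h.pos (h₁ _ _ (h.isAdmissible₁ hχ)) (h₂ _ _ (h.isAdmissible₂ hψ))

/-- A partition of unity by squares subordinate to open sets with local cones. -/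
structure LocalPartition (Γ₁ Γ₂ : Set (E d × E d)) (φ : ℕ → TestFun d)
    (U V₁ V₂ V : ℕ → Set (E d)) (ε : ℕ → ℝ≥0) : Prop where
  real : ∀ j x, (φ j x).im = 0
  locallyFinite : LocallyFinite fun j => tsupport (φ j)
  sum_sq : ∀ x, ∑ᶠ j, φ j x ^ 2 = 1
  cones : ∀ j, LocalCones Γ₁ Γ₂ (U j) (V₁ j) (V₂ j) (V j) (ε j)
  subset : ∀ j, tsupport (φ j) ⊆ U j

theorem isClosedCone_empty : IsClosedCone (∅ : Set (E d)) :=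
  ⟨fun _ h => h.elim, fun _ h => h.elim, by simp⟩

/-- `W x` is the cone of directions in which the product is to be tested near `x`, and `O x`
localizes the members of the partition further. Taking `W` empty and `O` everything gives a
partition that only serves to define the product. -/
theorem exists_localPartition (hΓ₁ : IsClosedConic Γ₁) (hΓ₂ : IsClosedConic Γ₂)
    (hΓ : Γ₁ ∩ fiberNeg Γ₂ = ∅) (W : E d → Set (E d)) (hW : ∀ x, IsClosedCone (W x))
    (hxW : ∀ x, ∀ v ∈ W x, (x, v) ∉ prodCone Γ₁ Γ₂) (O : E d → Set (E d)) (hO : ∀ x, O x ∈ 𝓝 x) :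
    ∃ (φ : ℕ → TestFun d) (U V₁ V₂ : ℕ → Set (E d)) (ε : ℕ → ℝ≥0) (c : ℕ → E d),
      LocalPartition Γ₁ Γ₂ φ U V₁ V₂ (fun j => W (c j)) ε ∧ ∀ j, tsupport (φ j) ⊆ O (c j) := by
  choose U V₁ V₂ ε hxU hU using fun x => exists_localCones hΓ₁ hΓ₂ hΓ x (hW x) (hxW x)
  obtain ⟨φ, c, hreal, hlf, hsq, hsub⟩ := exists_sq_partition (fun x => U x ∩ O x) fun x =>
    inter_mem ((hU x).isOpen.mem_nhds (hxU x)) (hO x)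
  exact ⟨φ, fun j => U (c j), fun j => V₁ (c j), fun j => V₂ (c j), fun j => ε (c j), c,
    ⟨hreal, hlf, hsq, fun j => hU (c j), fun j => (hsub j).trans inter_subset_left⟩,
    fun j => (hsub j).trans inter_subset_right⟩

section Partition

variable {φ : ℕ → TestFun d} {U V₁ V₂ V : ℕ → Set (E d)} {ε : ℕ → ℝ≥0} {t₁ t₂ : Distr d}

theorem LocalPartition.isConicPartition (h : LocalPartition Γ₁ Γ₂ φ U V₁ V₂ V ε) :
    IsConicPartition Γ₁ Γ₂ φ V₁ V₂ :=
  ⟨h.real, h.locallyFinite, h.sum_sq, fun j => (h.cones j).isAdmissible₁ (h.subset j),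
    fun j => (h.cones j).isAdmissible₂ (h.subset j)⟩

/-- The indices `j` for which `φ j` meets the support of `f`. -/
noncomputable def LocalPartition.index (h : LocalPartition Γ₁ Γ₂ φ U V₁ V₂ V ε) (f : TestFun d) :
    Finset ℕ := (finite_tsupport_inter h.locallyFinite f).toFinset

theorem LocalPartition.mem_index (h : LocalPartition Γ₁ Γ₂ φ U V₁ V₂ V ε) {f : TestFun d} {j : ℕ} :
    j ∈ h.index f ↔ (tsupport (φ j) ∩ tsupport f).Nonempty := Set.Finite.mem_toFinset _

/-- The value of the product distribution, defined through a partition of unity. -/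
noncomputable def prodValue (φ : ℕ → TestFun d) (t₁ t₂ : Distr d) (f : TestFun d) : ℂ :=
  normConst d * ∑ᶠ j, cutConv t₁ t₂ (mulTest f (φ j)) (φ j) 0

theorem prodValue_eq_sum {f : TestFun d} {J : Finset ℕ}
    (hJ : ∀ j, (tsupport (φ j) ∩ tsupport f).Nonempty → j ∈ J) :
    prodValue φ t₁ t₂ f = normConst d * ∑ j ∈ J, cutConv t₁ t₂ (mulTest f (φ j)) (φ j) 0 := by
  unfold prodValue
  rw [finsum_eq_sum_of_support_subset]
  intro j hj
  by_contra hjJ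
  refine hj ?_
  change cutConv t₁ t₂ (mulTest f (φ j)) (φ j) 0 = 0
  rw [mulTest_eq_zero fun h => hjJ (hJ j h), cutConv_zero_left]

theorem LocalPartition.polyConv (h : LocalPartition Γ₁ Γ₂ φ U V₁ V₂ V ε)
    (h₁ : FiniteConeNorms Γ₁ t₁) (h₂ : FiniteConeNorms Γ₂ t₂) (j : ℕ) (f : TestFun d) :
    PolyConv t₁ t₂ (mulTest f (φ j)) (φ j) :=
  (h.cones j).polyConv h₁ h₂ ((tsupport_mulTest_right _ _).trans (h.subset j)) (h.subset j)

theorem LocalPartition.prodValue_add (h : LocalPartition Γ₁ Γ₂ φ U V₁ V₂ V ε)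
    (h₁ : FiniteConeNorms Γ₁ t₁) (h₂ : FiniteConeNorms Γ₂ t₂) (f g : TestFun d) :
    prodValue φ t₁ t₂ (f + g) = prodValue φ t₁ t₂ f + prodValue φ t₁ t₂ g := by
  have hs : tsupport (f + g : TestFun d) ⊆ tsupport f ∪ tsupport g := tsupport_add f g
  rw [prodValue_eq_sum (J := h.index f ∪ h.index g), prodValue_eq_sum (J := h.index f ∪ h.index g),
    prodValue_eq_sum (J := h.index f ∪ h.index g), ← mul_add, ← Finset.sum_add_distrib]
  · refine congrArg _ (Finset.sum_congr rfl fun j _ => ?_)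
    rw [← cutConv_add_left (h.polyConv h₁ h₂ j f) (h.polyConv h₁ h₂ j g)]
    congr 1
    ext x
    exact add_mul _ _ _
  · exact fun j hj => Finset.mem_union_right _ (h.mem_index.2 hj)
  · exact fun j hj => Finset.mem_union_left _ (h.mem_index.2 hj)
  · rintro j ⟨x, hx, hxf⟩
    rcases hs hxf with hxf | hxg
    · exact Finset.mem_union_left _ (h.mem_index.2 ⟨x, hx, hxf⟩)
    · exact Finset.mem_union_right _ (h.mem_index.2 ⟨x, hx, hxg⟩)

theorem prodValue_smul (φ : ℕ → TestFun d) (t₁ t₂ : Distr d) (c : ℂ) (f : TestFun d) :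
    prodValue φ t₁ t₂ (c • f) = c * prodValue φ t₁ t₂ f := by
  unfold prodValue
  rw [mul_left_comm]
  refine congrArg (normConst d * ·) ?_
  rw [mul_finsum]
  refine finsum_congr fun j => ?_
  rw [← cutConv_smul_left]
  congr 1
  ext x
  exact mul_assoc _ _ _

theorem LocalPartition.exists_distr (h : LocalPartition Γ₁ Γ₂ φ U V₁ V₂ V ε)
    (h₁ : FiniteConeNorms Γ₁ t₁) (h₂ : FiniteConeNorms Γ₂ t₂) :
    ∃ P : Distr d, ∀ f, pairing P f = prodValue φ t₁ t₂ f := by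
  let Φ : 𝓓((⊤ : Opens (E d)), ℝ) →ₗ[ℝ] ℂ :=
    { toFun := fun f => prodValue φ t₁ t₂ (ofRealTest f)
      map_add' := fun f g => by
        rw [← h.prodValue_add h₁ h₂]
        congr 1
        ext x
        exact Complex.ofReal_add _ _
      map_smul' := fun c f => by
        rw [RingHom.id_apply, Complex.real_smul, ← prodValue_smul]
        congr 1
        ext x
        exact Complex.ofReal_mul _ _ }
  obtain ⟨P, hP⟩ := exists_distr_of_bound Φ fun K => by
    -- The indices are chosen from `K` alone, so that order and constant are uniform in `f`.
    let J := (h.locallyFinite.finite_nonempty_inter_compact K.isCompact).toFinset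
    choose p C hC hb using fun j => exists_norm_cutConv_mulTest_le
      ((h.cones j).polyConv h₁ h₂ (h.subset j) (h.subset j)) K
    refine ⟨J.sup p, ‖normConst d‖ * ∑ j ∈ J, C j,
      mul_nonneg (norm_nonneg _) (Finset.sum_nonneg fun j _ => hC j), fun f hf A hA => ?_⟩
    have hfK : tsupport (ofRealTest f) ⊆ K :=
      (tsupport_comp_subset (g := ((↑) : ℝ → ℂ)) Complex.ofReal_zero f).trans hf
    change ‖prodValue φ t₁ t₂ (ofRealTest f)‖ ≤ _
    rw [prodValue_eq_sum (J := J) fun j hj => (Set.Finite.mem_toFinset _).2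
      (hj.mono (inter_subset_inter_right _ hfK)), norm_mul, mul_assoc, Finset.sum_mul]
    refine mul_le_mul_of_nonneg_left ((norm_sum_le _ _).trans (Finset.sum_le_sum fun j hj => ?_))
      (norm_nonneg _)
    refine hb j _ hfK A fun k hk x => ?_
    have e : (ofRealTest f : E d → ℂ) = Complex.ofRealLI ∘ f := rfl
    rw [e, Complex.ofRealLI.norm_iteratedFDeriv_comp_left f.contDiff.contDiffAt
      (by exact_mod_cast le_top)]
    exact hA k (hk.trans (Finset.le_sup hj)) x
  refine ⟨P, fun f => ?_⟩
  have hf : f = ofRealTest (TestFunction.postcompCLM Complex.reCLM f) +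
      Complex.I • ofRealTest (TestFunction.postcompCLM Complex.imCLM f) := by
    ext x
    change f x = ((f x).re : ℂ) + Complex.I * ((f x).im : ℂ)
    rw [mul_comm, Complex.re_add_im]
  conv_rhs => rw [hf]
  rw [h.prodValue_add h₁ h₂, prodValue_smul]
  unfold pairing
  rw [hP, hP]
  rfl

/-- `P` is the product of `t₁` and `t₂` over every open set with local cones. -/
def IsLocalProduct (Γ₁ Γ₂ : Set (E d × E d)) (t₁ t₂ P : Distr d) : Prop :=
  ∀ (U V₁ V₂ V : Set (E d)) (ε : ℝ≥0), LocalCones Γ₁ Γ₂ U V₁ V₂ V ε → ∀ χ ψ : TestFun d,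
    tsupport χ ⊆ U → tsupport ψ ⊆ U → ∀ ξ,
      fourierCut P (mulTest χ ψ) ξ = normConst d * cutConv t₁ t₂ χ ψ ξ

theorem LocalPartition.isLocalProduct (h : LocalPartition Γ₁ Γ₂ φ U V₁ V₂ V ε)
    (h₁ : FiniteConeNorms Γ₁ t₁) (h₂ : FiniteConeNorms Γ₂ t₂) {P : Distr d}
    (hP : ∀ f, pairing P f = prodValue φ t₁ t₂ f) : IsLocalProduct Γ₁ Γ₂ t₁ t₂ P := by
  intro U' V₁' V₂' V' ε' hU χ ψ hχ hψ ξ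
  let eχ := mulSmooth (character ξ) (contDiff_character ξ) χ
  have hs : tsupport eχ ⊆ tsupport χ := tsupport_mulSmooth _ _ _
  have e1 : fourierCut P (mulTest χ ψ) ξ = prodValue φ t₁ t₂ (mulTest eχ ψ) := by
    rw [← hP]
    unfold fourierCut
    congr 1
    ext x
    exact (mul_assoc _ _ _).symm
  -- The cutoff `ψ` goes to the second factor and `φ j` comes back to the first. Summing over `j`,
  -- the squares `φ j ^ 2` then add up to one on the first factor.
  have e2 : ∀ j, cutConv t₁ t₂ (mulTest (mulTest eχ ψ) (φ j)) (φ j) 0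
      = cutConv t₁ t₂ (mulTest (mulTest eχ (φ j)) (φ j)) ψ 0 := fun j => by
    have hp1 := h.polyConv h₁ h₂ j eχ
    have hp2 : PolyConv t₁ t₂ (mulTest eχ (φ j)) ψ :=
      hU.polyConv h₁ h₂ ((tsupport_mulTest_left _ _).trans (hs.trans hχ)) hψ
    rw [mulTest_comm eχ ψ, mulTest_assoc, cutConv_mulTest_move hp1, mulTest_comm ψ,
      ← cutConv_mulTest_move hp2, mulTest_comm (φ j)]
  rw [e1, prodValue_eq_sum (J := h.index eχ) fun j hj => h.mem_index.2
    (hj.mono (inter_subset_inter_right _ (tsupport_mulTest_left _ _))), Finset.sum_congr rfl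
    fun j _ => e2 j, ← cutConv_sum_left, sum_mulTest_sq h.sum_sq fun j hj => h.mem_index.2 hj,
    cutConv_mulSmooth_character, zero_add]
  exact fun j _ => hU.polyConv h₁ h₂ ((tsupport_mulTest_left _ _).trans
    ((tsupport_mulTest_left _ _).trans (hs.trans hχ))) hψ

theorem IsLocalProduct.fourierCut_eq_sum {P : Distr d} (hP : IsLocalProduct Γ₁ Γ₂ t₁ t₂ P)
    (h : LocalPartition Γ₁ Γ₂ φ U V₁ V₂ V ε) (f : TestFun d) (ξ : E d) :
    fourierCut P f ξ
      = normConst d * ∑ j ∈ h.index f, cutConv t₁ t₂ (mulTest f (φ j)) (φ j) ξ := by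
  conv_lhs => rw [← sum_mulTest_sq h.sum_sq (f := f) fun j hj => h.mem_index.2 hj]
  rw [fourierCut_sum, Finset.mul_sum]
  exact Finset.sum_congr rfl fun j _ => hP _ _ _ _ _ (h.cones j) _ _
    ((tsupport_mulTest_right _ _).trans (h.subset j)) (h.subset j) ξ

/-- Here `χ²` is split as the sum of `(χφⱼ)²`, so that both factors carry the cutoff `χφⱼ` as in the
bilinear estimates. `fourierCut_eq_sum` serves test functions that need not be squares. -/
theorem IsLocalProduct.fourierCut_sq_eq_sum {P : Distr d} (hP : IsLocalProduct Γ₁ Γ₂ t₁ t₂ P)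
    (h : LocalPartition Γ₁ Γ₂ φ U V₁ V₂ V ε) (χ : TestFun d) (ξ : E d) :
    fourierCut P (mulTest χ χ) ξ = normConst d *
      ∑ j ∈ h.index χ, cutConv t₁ t₂ (mulTest χ (φ j)) (mulTest χ (φ j)) ξ := by
  conv_lhs => rw [← sum_mulTest_sq h.sum_sq (f := mulTest χ χ) (J := h.index χ) fun j hj =>
    h.mem_index.2 (by rwa [tsupport_mulTest_self] at hj)]
  rw [fourierCut_sum, Finset.mul_sum]
  refine Finset.sum_congr rfl fun j _ => ?_
  have hs : tsupport (mulTest χ (φ j)) ⊆ U j := (tsupport_mulTest_right _ _).trans (h.subset j)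
  rw [← hP _ _ _ _ _ (h.cones j) _ _ hs hs]
  congr 1
  ext x
  simp only [mulTest_apply]
  ring

end Partition

theorem IsLocalProduct.isProduct {t₁ t₂ P : Distr d} (hΓ₁ : IsClosedConic Γ₁)
    (hΓ₂ : IsClosedConic Γ₂) (hΓ : Γ₁ ∩ fiberNeg Γ₂ = ∅) (h₁ : FiniteConeNorms Γ₁ t₁)
    (h₂ : FiniteConeNorms Γ₂ t₂) (hP : IsLocalProduct Γ₁ Γ₂ t₁ t₂ P) : IsProduct t₁ t₂ P := by
  intro x
  obtain ⟨U, V₁, V₂, ε, hxU, hU⟩ := exists_localCones hΓ₁ hΓ₂ hΓ x isClosedCone_empty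
    (fun v hv => hv.elim)
  exact ⟨U, hU.isOpen.mem_nhds hxU, fun χ hχ ξ => ⟨(hU.polyConv h₁ h₂ hχ hχ).integrable ξ,
    hP _ _ _ _ _ hU χ χ hχ hχ ξ⟩⟩

/-- Products of distributions are unique. -/
theorem IsProduct.unique {t₁ t₂ s s' : Distr d} (h : IsProduct t₁ t₂ s) (h' : IsProduct t₁ t₂ s') :
    s = s' := by
  choose U hU hs using h
  choose U' hU' hs' using h'
  have h0 : ∀ x (χ : TestFun d), tsupport χ ⊆ U x ∩ U' x →
      pairing (s - s') (mulTest χ χ) = 0 := fun x χ hχ => by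
    rw [← fourierCut_zero_right, fourierCut_sub_left,
      (hs x χ (hχ.trans inter_subset_left) 0).2, (hs' x χ (hχ.trans inter_subset_right) 0).2, sub_self]
  have h1 : ∀ x (χ ψ : TestFun d), tsupport χ ⊆ U x ∩ U' x → tsupport ψ ⊆ U x ∩ U' x →
      pairing (s - s') (mulTest χ ψ) = 0 := fun x χ ψ hχ hψ => by
    -- Polarization: the definition of the product tests only squares, the partition of unity yields
    -- products `(fφⱼ)φⱼ`.
    have e : mulTest (χ + ψ) (χ + ψ)
        = mulTest χ χ + mulTest ψ ψ + (2 : ℂ) • mulTest χ ψ := by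
      ext y
      change (χ y + ψ y) * (χ y + ψ y) = χ y * χ y + ψ y * ψ y + 2 * (χ y * ψ y)
      ring
    have h2 := h0 x (χ + ψ) ((tsupport_add (χ : E d → ℂ) ψ).trans (union_subset hχ hψ))
    rw [e, pairing_add, pairing_add, h0 x χ hχ, h0 x ψ hψ, add_zero, zero_add, pairing_smul] at h2
    simpa using h2
  obtain ⟨φ, c, -, hlf, hsq, hsub⟩ := exists_sq_partition (fun x => U x ∩ U' x)
    fun x => inter_mem (hU x) (hU' x)
  refine distr_ext fun f => sub_eq_zero.1 ?_
  rw [← pairing_sub_left, ← sum_mulTest_sq hsq (f := f)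
    fun j hj => (Set.Finite.mem_toFinset (finite_tsupport_inter hlf f)).2 hj, pairing_sum]
  exact Finset.sum_eq_zero fun j _ => h1 (c j) _ _
    ((tsupport_mulTest_right _ _).trans (hsub j)) (hsub j)

/-- The wave front set of the product. -/
theorem IsLocalProduct.wavefrontSet_subset {t₁ t₂ P : Distr d} (hΓ₁ : IsClosedConic Γ₁)
    (hΓ₂ : IsClosedConic Γ₂) (hΓ : Γ₁ ∩ fiberNeg Γ₂ = ∅) (h₁ : FiniteConeNorms Γ₁ t₁)
    (h₂ : FiniteConeNorms Γ₂ t₂) (hP : IsLocalProduct Γ₁ Γ₂ t₁ t₂ P) :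
    wavefrontSet P ⊆ prodCone Γ₁ Γ₂ := by
  rintro ⟨x, ξ₀⟩ ⟨h0, hwf⟩
  by_contra hx
  have h0 : ξ₀ ≠ 0 := h0
  -- The cone `Γ₁ ∪ Γ₂ ∪ (Γ₁ + Γ₂)` is conic, so the whole ray of `ξ₀` avoids it over `x`.
  have hxr : ∀ v ∈ ray ξ₀, (x, v) ∉ prodCone Γ₁ Γ₂ := by
    rintro _ ⟨c, hc, rfl⟩ hv
    have hc' : 0 < c⁻¹ := inv_pos.2 hc
    refine hx ?_
    rcases hv with (hv | hv) | ⟨a, b, ha, hb, hab⟩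
    · have := hΓ₁.smul_mem _ hv _ hc'
      rw [inv_smul_smul₀ hc.ne'] at this
      exact Or.inl (Or.inl this)
    · have := hΓ₂.smul_mem _ hv _ hc'
      rw [inv_smul_smul₀ hc.ne'] at this
      exact Or.inl (Or.inr this)
    · refine Or.inr ⟨c⁻¹ • a, c⁻¹ • b, hΓ₁.smul_mem _ ha _ hc', hΓ₂.smul_mem _ hb _ hc', ?_⟩
      change c • ξ₀ = a + b at hab
      change ξ₀ = _
      rw [← smul_add, ← hab, inv_smul_smul₀ hc.ne']
  obtain ⟨U, V₁, V₂, ε, hxU, hU⟩ := exists_localCones hΓ₁ hΓ₂ hΓ x (isClosedCone_ray h0) hxr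
  -- The wave front set requires decay in an open cone, so the ray is widened at the cost of a
  -- smaller separation constant.
  obtain ⟨ε', hε', hsep⟩ := hU.separated.exists_coneNhd hU.pos
  obtain ⟨ρ, hρ, hρU, -⟩ := exists_cutoff (isCompact_singleton (x := x)) hU.isOpen
    (singleton_subset_iff.2 hxU)
  refine hwf ⟨mulTest ρ ρ, coneNhd ξ₀ (ε / 2), ?_, isOpen_coneNhd _ _,
    mem_coneNhd_self h0 (half_pos hU.pos), fun ξ hξ c hc => smul_mem_coneNhd hξ hc, fun N => ?_⟩
  · change ρ x * ρ x ≠ 0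
    rw [hρ x rfl, one_mul]
    exact one_ne_zero
  · obtain ⟨m₁, hm₁⟩ := exists_orderNorm_lt_top t₁ ρ
    obtain ⟨m₂, hm₂⟩ := exists_orderNorm_lt_top t₂ ρ
    let M := N + m₁ + m₂ + d + 1
    obtain ⟨C, hC⟩ := hsep.exists_wt_pow_mul_enorm_cutConv_le m₁ m₂ M (by omega) (by omega) hε'
      (fun h => hU.closedCone₁.ne_zero 0 h rfl) (fun h => hU.closedCone₂.ne_zero 0 h rfl)
      (zero_notMem_coneNhd _ _)
    refine (coneNorm_mono (M := M) (by omega) subset_rfl _ _).trans_lt ?_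
    have hf1 := h₁ _ _ (hU.isAdmissible₁ hρU)
    have hf2 := h₂ _ _ (hU.isAdmissible₂ hρU)
    refine (coneNorm_le_iff.2 fun ξ hξ => ?_).trans_lt (b := ‖normConst d‖ₑ *
      (C * (coneNorm (2 * M) V₂ ρ t₂ * orderNorm m₁ ρ t₁ +
          coneNorm (2 * M) V₁ ρ t₁ * orderNorm m₂ ρ t₂ +
          coneNorm (2 * M) V₁ ρ t₁ * coneNorm M V₂ ρ t₂))) ?_
    · rw [hP _ _ _ _ _ hU ρ ρ hρU hρU, enorm_mul, mul_left_comm]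
      exact mul_le_mul' le_rfl ((mul_le_mul' le_rfl (enorm_cutConv_le _ _ _ _ _)).trans
        (hC t₁ t₂ ρ ρ ξ hξ))
    · have a1 := (hf1 (2 * M)).ne
      have a2 := (hf2 (2 * M)).ne
      have a3 := (hf2 M).ne
      have a4 := hm₁.ne
      have a5 := hm₂.ne
      rw [lt_top_iff_ne_top]
      finiteness

end Microlocal

namespace Microlocal

variable {d : ℕ} {Γ₁ Γ₂ : Set (E d × E d)}

/-! ### Bilinear estimates -/

theorem coneNorm_sub_triangle (N : ℕ) (V : Set (E d)) (χ : TestFun d) (t s r : Distr d) :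
    coneNorm N V χ (t - r) ≤ coneNorm N V χ (t - s) + coneNorm N V χ (s - r) := by
  refine coneNorm_le_iff.2 fun ξ hξ => ?_
  rw [fourierCut_sub_left, ← sub_add_sub_cancel _ (fourierCut s χ ξ)]
  refine (mul_le_mul' le_rfl (enorm_add_le _ _)).trans ?_
  rw [mul_add, ← fourierCut_sub_left, ← fourierCut_sub_left]
  exact add_le_add (coneNorm_le_iff.1 le_rfl ξ hξ) (coneNorm_le_iff.1 le_rfl ξ hξ)

theorem coneNorm_sub_comm (N : ℕ) (V : Set (E d)) (χ : TestFun d) (t s : Distr d) :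
    coneNorm N V χ (t - s) = coneNorm N V χ (s - t) := by
  simp only [coneNorm, fourierCut_sub_left, norm_sub_rev]

theorem coneNorm_sub_self (N : ℕ) (V : Set (E d)) (χ : TestFun d) (t : Distr d) :
    coneNorm N V χ (t - t) = 0 := by
  have h : ∀ ξ, fourierCut (t - t) χ ξ = 0 := fun ξ => by rw [fourierCut_sub_left, sub_self]
  simp only [coneNorm, h]
  simp

/-- The pairing is the value of the transform at `0`. Regarded as a cone norm over `{0}`, it is
treated together with the seminorms `‖·‖_{N,V,χ}`. -/
theorem enorm_pairing_le_coneNorm (t : Distr d) (f : TestFun d) :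
    ‖pairing t f‖ₑ ≤ coneNorm 0 {0} f t := by
  have h := coneNorm_le_iff.1 (le_refl (coneNorm 0 {0} f t)) 0 rfl
  rwa [pow_zero, ENNReal.coe_one, one_mul, fourierCut_zero_right] at h

theorem enorm_mul_sum_le {J : Finset ℕ} {a : ℕ → ℂ} {b X : ℕ → ℝ≥0∞} {C : ℕ → ℝ≥0} (c : ℂ)
    (w : ℝ≥0∞) (hab : ∀ j ∈ J, ‖a j‖ₑ ≤ b j) (hb : ∀ j ∈ J, w * b j ≤ C j * X j) :
    w * ‖c * ∑ j ∈ J, a j‖ₑ ≤ ((‖c‖₊ * ∑ j ∈ J, C j : ℝ≥0) : ℝ≥0∞) * ∑ j ∈ J, X j := by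
  rw [enorm_mul, mul_left_comm, ENNReal.coe_mul, mul_assoc]
  refine mul_le_mul' le_rfl ?_
  calc w * ‖∑ j ∈ J, a j‖ₑ ≤ w * ∑ j ∈ J, b j :=
        mul_le_mul' le_rfl ((enorm_sum_le _ _).trans (Finset.sum_le_sum hab))
    _ ≤ ∑ j ∈ J, C j * X j := by rw [Finset.mul_sum]; exact Finset.sum_le_sum hb
    _ ≤ ∑ j ∈ J, ((∑ j ∈ J, C j : ℝ≥0) : ℝ≥0∞) * X j := by
        refine Finset.sum_le_sum fun j hj => mul_le_mul' ?_ le_rfl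
        exact_mod_cast Finset.single_le_sum (f := C) (fun _ _ => zero_le) hj
    _ = _ := by rw [Finset.mul_sum]

theorem isAdmissible_mulTest_self {Γ : Set (E d × E d)} {V : Set (E d)} {χ : TestFun d} :
    IsAdmissible Γ V (mulTest χ χ) ↔ IsAdmissible Γ V χ := by
  rw [IsAdmissible, IsAdmissible, tsupport_mulTest_self]

/-- Partitions of unity adapted to a seminorm of `D'_Γ`, `Γ = Γ₁ ∪ Γ₂ ∪ (Γ₁ + Γ₂)`. -/
theorem exists_localPartition_of_isAdmissible (hΓ₁ : IsClosedConic Γ₁) (hΓ₂ : IsClosedConic Γ₂)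
    (hΓ : Γ₁ ∩ fiberNeg Γ₂ = ∅) {W : Set (E d)} {χ : TestFun d}
    (hW : IsAdmissible (prodCone Γ₁ Γ₂) W χ) :
    ∃ (φ : ℕ → TestFun d) (U V₁ V₂ V : ℕ → Set (E d)) (ε : ℕ → ℝ≥0),
      ∃ h : LocalPartition Γ₁ Γ₂ φ U V₁ V₂ V ε, ∀ j ∈ h.index χ, V j = W := by
  classical
  obtain ⟨φ, U, V₁, V₂, ε, c, h, hc⟩ := exists_localPartition hΓ₁ hΓ₂ hΓ
    -- Over the support of `χ` the test cone is `W`. Elsewhere nothing is tested, and `O x` is the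
    -- complement of the support, so that members of the partition centred there do not meet it.
    (fun x => if x ∈ tsupport χ then W else ∅)
    (fun x => by
      split_ifs
      · exact hW.1
      · exact isClosedCone_empty)
    (fun x v hv hx => by
      split_ifs at hv with hxχ
      · have : (x, v) ∈ (tsupport χ ×ˢ W) ∩ prodCone Γ₁ Γ₂ := ⟨⟨hxχ, hv⟩, hx⟩
        rw [hW.2] at this
        exact this
      · exact hv)
    (fun x => if x ∈ tsupport χ then univ else (tsupport χ)ᶜ)
    (fun x => by
      split_ifs with hxχ
      · exact univ_mem
      · exact (isClosed_tsupport χ).isOpen_compl.mem_nhds hxχ)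
  refine ⟨φ, U, V₁, V₂, _, ε, h, fun j hj => ?_⟩
  obtain ⟨y, hy, hyχ⟩ := h.mem_index.1 hj
  have h1 := hc j hy
  by_cases hx : c j ∈ tsupport χ
  · simp only [hx, if_true]
  · rw [if_neg hx] at h1
    exact absurd hyχ h1

section Partition

variable {φ : ℕ → TestFun d} {U V₁ V₂ V : ℕ → Set (E d)} {ε : ℕ → ℝ≥0}

theorem LocalPartition.exists_orderNorm_le (h : LocalPartition Γ₁ Γ₂ φ U V₁ V₂ V ε)
    (m₁ m₂ N₁ N₂ : ℕ) (χ : TestFun d) (hN₁ : m₂ + d + 1 ≤ N₁) (hN₂ : m₁ + d + 1 ≤ N₂) :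
    ∃ C : ℝ≥0, ∀ t₁ t₂ P : Distr d, IsLocalProduct Γ₁ Γ₂ t₁ t₂ P →
      orderNorm (m₁ + m₂ + d) (mulTest χ χ) P ≤ C * ∑' j,
        (orderNorm m₁ (mulTest χ (φ j)) t₁ + coneNorm N₁ (V₁ j) (mulTest χ (φ j)) t₁) *
        (orderNorm m₂ (mulTest χ (φ j)) t₂ + coneNorm N₂ (V₂ j) (mulTest χ (φ j)) t₂) := by
  choose C hC using fun j =>
    (h.cones j).separated.exists_enorm_cutConv_le m₁ m₂ N₁ N₂ hN₁ hN₂ (h.cones j).pos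
  refine ⟨‖normConst d‖₊ * ∑ j ∈ h.index χ, C j, fun t₁ t₂ P hP => orderNorm_le_iff.2 fun ξ => ?_⟩
  rw [hP.fourierCut_sq_eq_sum h, ← one_mul ‖_‖ₑ, mul_right_comm]
  refine (enorm_mul_sum_le (b := fun j => ∫⁻ η, ‖fourierCut t₁ (mulTest χ (φ j)) (ξ - η)‖ₑ *
    ‖fourierCut t₂ (mulTest χ (φ j)) η‖ₑ) (C := fun j => C j * wt ξ ^ (m₁ + m₂ + d)) (X := fun j =>
      (orderNorm m₁ (mulTest χ (φ j)) t₁ + coneNorm N₁ (V₁ j) (mulTest χ (φ j)) t₁) *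
      (orderNorm m₂ (mulTest χ (φ j)) t₂ + coneNorm N₂ (V₂ j) (mulTest χ (φ j)) t₂)) _ 1
    (fun j _ => enorm_cutConv_le _ _ _ _ _) (fun j _ => ?_)).trans ?_
  · rw [one_mul, ENNReal.coe_mul]
    exact hC j t₁ t₂ _ _ ξ
  · rw [← Finset.sum_mul, ← mul_assoc, ENNReal.coe_mul]
    exact mul_le_mul' le_rfl (ENNReal.sum_le_tsum _)

theorem LocalPartition.exists_coneNorm_le (h : LocalPartition Γ₁ Γ₂ φ U V₁ V₂ V ε)
    {W : Set (E d)} (hW0 : 0 ∉ W) {χ : TestFun d} (hW : ∀ j ∈ h.index χ, V j = W)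
    (m₁ m₂ N : ℕ) (hm₁ : m₁ + d + 1 ≤ N) (hm₂ : m₂ + d + 1 ≤ N) :
    ∃ C : ℝ≥0, ∀ t₁ t₂ P : Distr d, IsLocalProduct Γ₁ Γ₂ t₁ t₂ P →
      coneNorm N W (mulTest χ χ) P ≤ C * ∑' j,
        (coneNorm (2 * N) (V₂ j) (mulTest χ (φ j)) t₂ * orderNorm m₁ (mulTest χ (φ j)) t₁ +
          coneNorm (2 * N) (V₁ j) (mulTest χ (φ j)) t₁ * orderNorm m₂ (mulTest χ (φ j)) t₂ +
          coneNorm (2 * N) (V₁ j) (mulTest χ (φ j)) t₁ *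
            coneNorm N (V₂ j) (mulTest χ (φ j)) t₂) := by
  -- The cone `V j` is known to be `W` only for these indices; the constants are later extended by
  -- `0`.
  choose C hC using fun j : {j // j ∈ h.index χ} =>
    (hW j.1 j.2 ▸ (h.cones j.1).separated).exists_wt_pow_mul_enorm_cutConv_le m₁ m₂ N hm₁ hm₂
      (h.cones j.1).pos (fun h' => (h.cones j.1).closedCone₁.ne_zero 0 h' rfl)
      (fun h' => (h.cones j.1).closedCone₂.ne_zero 0 h' rfl) hW0
  classical
  let C' : ℕ → ℝ≥0 := fun j => if hj : j ∈ h.index χ then C ⟨j, hj⟩ else 0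
  refine ⟨‖normConst d‖₊ * ∑ j ∈ h.index χ, C' j, fun t₁ t₂ P hP =>
    coneNorm_le_iff.2 fun ξ hξ => ?_⟩
  rw [hP.fourierCut_sq_eq_sum h]
  refine (enorm_mul_sum_le (b := fun j => ∫⁻ η, ‖fourierCut t₁ (mulTest χ (φ j)) (ξ - η)‖ₑ *
    ‖fourierCut t₂ (mulTest χ (φ j)) η‖ₑ) (C := C') _ _
    (fun j _ => enorm_cutConv_le _ _ _ _ _) (fun j hj => ?_)).trans
      (mul_le_mul' le_rfl (ENNReal.sum_le_tsum _))
  simp only [C', dif_pos hj]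
  exact hC ⟨j, hj⟩ t₁ t₂ _ _ ξ hξ

/-- The size of a distribution near the support of `g`: its growth and its decay in a cone. -/
noncomputable def size (m M : ℕ) (V : Set (E d)) (g : TestFun d) (t : Distr d) : ℝ≥0∞ :=
  orderNorm m g t + coneNorm M V g t

/-- The convolutions that constitute the Fourier transform of `f t₁ t₂` are controlled on `W` by the
sizes of `t₁` and `t₂`. -/
def LocalPartition.Controls (h : LocalPartition Γ₁ Γ₂ φ U V₁ V₂ V ε) (f : TestFun d) (N : ℕ)
    (W : Set (E d)) : Prop :=
  ∀ m₁ m₂ : ℕ, ∃ (M : ℕ) (C : ℕ → ℝ≥0), ∀ t₁ t₂ : Distr d, ∀ ξ ∈ W, ∀ j ∈ h.index f,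
    ((wt ξ ^ N : ℝ≥0) : ℝ≥0∞) *
        ∫⁻ η, ‖fourierCut t₁ (mulTest f (φ j)) (ξ - η)‖ₑ * ‖fourierCut t₂ (φ j) η‖ₑ ≤
      C j * (size m₁ M (V₁ j) (mulTest f (φ j)) t₁ * size m₂ M (V₂ j) (φ j) t₂)

/-- At `ξ = 0` the weight is one, so the growth estimate already bounds the pairing. -/
theorem LocalPartition.controls_zero (h : LocalPartition Γ₁ Γ₂ φ U V₁ V₂ V ε) (f : TestFun d) :
    h.Controls f 0 {0} := by
  intro m₁ m₂
  choose C hC using fun j => (h.cones j).separated.exists_enorm_cutConv_le m₁ m₂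
    (m₁ + m₂ + d + 1) (m₁ + m₂ + d + 1) (by omega) (by omega) (h.cones j).pos
  refine ⟨m₁ + m₂ + d + 1, C, ?_⟩
  rintro t₁ t₂ ξ rfl j -
  have := hC j t₁ t₂ (mulTest f (φ j)) (φ j) 0
  have hw : wt (0 : E d) = 1 := by simp [wt]
  rw [hw, one_pow, ENNReal.coe_one, mul_one] at this
  rw [pow_zero, ENNReal.coe_one, one_mul]
  exact this

theorem LocalPartition.controls_cone (h : LocalPartition Γ₁ Γ₂ φ U V₁ V₂ V ε)
    {W : Set (E d)} (hW0 : 0 ∉ W) {f : TestFun d} (hW : ∀ j ∈ h.index f, V j = W) (N : ℕ) :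
    h.Controls f N W := by
  intro m₁ m₂
  let M := N + m₁ + m₂ + d + 1
  choose C hC using fun j : {j // j ∈ h.index f} =>
    (hW j.1 j.2 ▸ (h.cones j.1).separated).exists_wt_pow_mul_enorm_cutConv_le m₁ m₂ M
      (by omega) (by omega)
      (h.cones j.1).pos (fun h' => (h.cones j.1).closedCone₁.ne_zero 0 h' rfl)
      (fun h' => (h.cones j.1).closedCone₂.ne_zero 0 h' rfl) hW0
  classical
  refine ⟨2 * M, fun j => if hj : j ∈ h.index f then C ⟨j, hj⟩ else 0, fun t₁ t₂ ξ hξ j hj => ?_⟩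
  simp only [dif_pos hj]
  calc _ ≤ ((wt ξ ^ M : ℝ≥0) : ℝ≥0∞) *
        ∫⁻ η, ‖fourierCut t₁ (mulTest f (φ j)) (ξ - η)‖ₑ * ‖fourierCut t₂ (φ j) η‖ₑ := by
        refine mul_le_mul' ?_ le_rfl
        exact_mod_cast pow_le_pow_right₀ (one_le_wt ξ) (by omega)
    _ ≤ _ := hC ⟨j, hj⟩ t₁ t₂ _ _ ξ hξ
    _ ≤ C ⟨j, hj⟩ * (coneNorm (2 * M) (V₂ j) (φ j) t₂ * orderNorm m₁ (mulTest f (φ j)) t₁ +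
          coneNorm (2 * M) (V₁ j) (mulTest f (φ j)) t₁ * orderNorm m₂ (φ j) t₂ +
          coneNorm (2 * M) (V₁ j) (mulTest f (φ j)) t₁ * coneNorm (2 * M) (V₂ j) (φ j) t₂) := by
        gcongr
        exact coneNorm_mono (by omega) subset_rfl _ _
    _ ≤ _ := by
        refine mul_le_mul' le_rfl ?_
        unfold size
        -- Adding the missing product of the two order norms turns the three-term bound into a
        -- product of sizes.
        calc _ ≤ orderNorm m₁ (mulTest f (φ j)) t₁ * orderNorm m₂ (φ j) t₂ + _ := le_add_self
          _ = _ := by ring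

theorem exists_orderNorm_le_of_bounded {B : Set (Distr d)}
    (hB : ∀ f : TestFun d, ∃ C : ℝ, ∀ t ∈ B, ‖pairing t f‖ ≤ C) (J : Finset ℕ)
    (g : ℕ → TestFun d) :
    ∃ (m : ℕ) (C : ℕ → ℝ≥0), ∀ j ∈ J, ∀ t ∈ B, orderNorm m (g j) t ≤ C j := by
  choose m C hC h using fun j => exists_uniform_norm_fourierCut_le B hB (g j)
  exact ⟨J.sup m, fun j => (C j).toNNReal, fun j hj t ht =>
    (orderNorm_anti (Finset.le_sup (f := m) hj) _ _).trans (orderNorm_le_ofReal (h j t ht))⟩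

/-- Weak boundedness supplies exponents `m₁`, `m₂` valid on all of `B₁`, `B₂`. Only then is the
decay order `M` chosen, and the cone seminorms of that order are bounded by hypothesis. -/
theorem LocalPartition.Controls.exists_coneNorm_le_of_bounded
    {h : LocalPartition Γ₁ Γ₂ φ U V₁ V₂ V ε} {f : TestFun d} {N : ℕ} {W : Set (E d)}
    (hc : h.Controls f N W) {B₁ : Set (DPrime Γ₁)} {B₂ : Set (DPrime Γ₂)}
    (hB₁ : IsBddIn B₁) (hB₂ : IsBddIn B₂) :
    ∃ C : ℝ≥0, ∀ t₁ ∈ B₁, ∀ t₂ ∈ B₂, ∀ P : Distr d,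
      IsLocalProduct Γ₁ Γ₂ t₁.toDistr t₂.toDistr P → coneNorm N W f P ≤ C := by
  obtain ⟨m₁, A₁, hA₁⟩ := exists_orderNorm_le_of_bounded (B := DPrime.toDistr '' B₁)
    (fun g => by simpa using hB₁.1 g) (h.index f) fun j => mulTest f (φ j)
  obtain ⟨m₂, A₂, hA₂⟩ := exists_orderNorm_le_of_bounded (B := DPrime.toDistr '' B₂)
    (fun g => by simpa using hB₂.1 g) (h.index f) φ
  obtain ⟨M, C, hC⟩ := hc m₁ m₂
  choose D₁ hD₁ using fun j => hB₁.2 M (V₁ j) (mulTest f (φ j))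
    ((h.cones j).isAdmissible₁ ((tsupport_mulTest_right _ _).trans (h.subset j)))
  choose D₂ hD₂ using fun j => hB₂.2 M (V₂ j) (φ j) ((h.cones j).isAdmissible₂ (h.subset j))
  refine ⟨(‖normConst d‖₊ * ∑ j ∈ h.index f, C j) *
    ∑ j ∈ h.index f, (A₁ j + D₁ j) * (A₂ j + D₂ j), fun t₁ ht₁ t₂ ht₂ P hP =>
    coneNorm_le_iff.2 fun ξ hξ => ?_⟩
  rw [hP.fourierCut_eq_sum h]
  refine (enorm_mul_sum_le (C := C) _ _ (fun j _ => enorm_cutConv_le _ _ _ _ _) fun j hj =>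
    hC t₁.toDistr t₂.toDistr ξ hξ j hj).trans ?_
  rw [ENNReal.coe_mul (‖normConst d‖₊ * _)]
  refine mul_le_mul' le_rfl ?_
  push_cast
  refine Finset.sum_le_sum fun j hj => ?_
  refine mul_le_mul' (a := size m₁ M (V₁ j) (mulTest f (φ j)) t₁.toDistr) ?_ ?_
  · exact add_le_add (hA₁ j hj _ ⟨t₁, ht₁, rfl⟩) (hD₁ j t₁ ht₁)
  · exact add_le_add (hA₂ j hj _ ⟨t₂, ht₂, rfl⟩) (hD₂ j t₂ ht₂)

theorem exists_tendsto_orderNorm {u : ℕ → Distr d}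
    (hu : ∀ f : TestFun d, Tendsto (fun n => pairing (u n) f) atTop (𝓝 0)) (t : Distr d)
    (J : Finset ℕ) (g : ℕ → TestFun d) :
    ∃ m : ℕ, ∀ j ∈ J, Tendsto (fun n => orderNorm m (g j) (u n)) atTop (𝓝 0) ∧
      orderNorm m (g j) t < ⊤ := by
  choose m c hc h using fun j => exists_tendsto_norm_fourierCut_le u hu (g j)
  choose p hp using fun j => exists_orderNorm_lt_top t (g j)
  refine ⟨J.sup m + J.sup p, fun j hj => ⟨?_, ?_⟩⟩
  · have h0 : Tendsto (fun n => ENNReal.ofReal (c j n)) atTop (𝓝 0) := by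
      simpa using ENNReal.tendsto_ofReal (hc j)
    refine tendsto_of_tendsto_of_tendsto_of_le_of_le tendsto_const_nhds h0 (fun _ => zero_le)
      fun n => ?_
    exact (orderNorm_anti ((Finset.le_sup (f := m) hj).trans (Nat.le_add_right _ _)) _ _).trans
      (orderNorm_le_ofReal (h j n))
  · exact (orderNorm_anti ((Finset.le_sup (f := p) hj).trans (Nat.le_add_left _ _)) _ _).trans_lt
      (hp j)

/-- Convergence to zero in `D'_Γ`. -/
structure TendstoZero (Γ : Set (E d × E d)) (u : ℕ → Distr d) : Prop where
  pairing : ∀ f : TestFun d, Tendsto (fun n => pairing (u n) f) atTop (𝓝 0)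
  coneNorm : ∀ (N : ℕ) (V : Set (E d)) (χ : TestFun d), IsAdmissible Γ V χ →
    Tendsto (fun n => coneNorm N V χ (u n)) atTop (𝓝 0)

theorem LocalPartition.Controls.tendsto_coneNorm
    {h : LocalPartition Γ₁ Γ₂ φ U V₁ V₂ V ε} {f : TestFun d} {N : ℕ} {W : Set (E d)}
    (hc : h.Controls f N W) {s₁ : ℕ → DPrime Γ₁} {s₂ : ℕ → DPrime Γ₂} {t₁ : DPrime Γ₁}
    {t₂ : DPrime Γ₂} (hs₁ : TendstoZero Γ₁ fun n => (s₁ n).toDistr - t₁.toDistr)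
    (hs₂ : TendstoZero Γ₂ fun n => (s₂ n).toDistr - t₂.toDistr) {Q : ℕ → Distr d} {P : Distr d}
    (hQ : ∀ n, IsLocalProduct Γ₁ Γ₂ (s₁ n).toDistr (s₂ n).toDistr (Q n))
    (hP : IsLocalProduct Γ₁ Γ₂ t₁.toDistr t₂.toDistr P) :
    Tendsto (fun n => coneNorm N W f (Q n - P)) atTop (𝓝 0) := by
  set u₁ := fun n => (s₁ n).toDistr - t₁.toDistr
  set u₂ := fun n => (s₂ n).toDistr - t₂.toDistr
  obtain ⟨m₁, hm₁⟩ := exists_tendsto_orderNorm hs₁.pairing t₁.toDistr (h.index f)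
    fun j => mulTest f (φ j)
  obtain ⟨m₂, hm₂⟩ := exists_tendsto_orderNorm hs₂.pairing t₂.toDistr (h.index f) φ
  obtain ⟨M, C, hC⟩ := hc m₁ m₂
  let S₁ : ℕ → Distr d → ℝ≥0∞ := fun j => size m₁ M (V₁ j) (mulTest f (φ j))
  let S₂ : ℕ → Distr d → ℝ≥0∞ := fun j => size m₂ M (V₂ j) (φ j)
  have ha₁ : ∀ j, IsAdmissible Γ₁ (V₁ j) (mulTest f (φ j)) := fun j =>
    (h.cones j).isAdmissible₁ ((tsupport_mulTest_right _ _).trans (h.subset j))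
  have ha₂ : ∀ j, IsAdmissible Γ₂ (V₂ j) (φ j) := fun j => (h.cones j).isAdmissible₂ (h.subset j)
  have hS₁ : ∀ j ∈ h.index f, Tendsto (fun n => S₁ j (u₁ n)) atTop (𝓝 0) := fun j hj => by
    have e := (hm₁ j hj).1.add (hs₁.coneNorm M _ _ (ha₁ j))
    rw [add_zero] at e
    exact e
  have hS₂ : ∀ j ∈ h.index f, Tendsto (fun n => S₂ j (u₂ n)) atTop (𝓝 0) := fun j hj => by
    have e := (hm₂ j hj).1.add (hs₂.coneNorm M _ _ (ha₂ j))
    rw [add_zero] at e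
    exact e
  have hT₁ : ∀ j ∈ h.index f, S₁ j t₁.toDistr ≠ ⊤ := fun j hj =>
    (ENNReal.add_lt_top.2 ⟨(hm₁ j hj).2, t₁.finiteConeNorms _ _ (ha₁ j) M⟩).ne
  have hT₂ : ∀ j ∈ h.index f, S₂ j t₂.toDistr ≠ ⊤ := fun j hj =>
    (ENNReal.add_lt_top.2 ⟨(hm₂ j hj).2, t₂.finiteConeNorms _ _ (ha₂ j) M⟩).ne
  -- Sizes of the three terms of `s₁s₂ - t₁t₂ = u₁u₂ + u₁t₂ + t₁u₂`; each has a factor tending to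
  -- zero, and the sizes of `t₁`, `t₂` are finite.
  let X : ℕ → ℕ → ℝ≥0∞ := fun n j =>
    S₁ j (u₁ n) * S₂ j (u₂ n) + S₁ j (u₁ n) * S₂ j t₂.toDistr + S₁ j t₁.toDistr * S₂ j (u₂ n)
  have hX : Tendsto (fun n => ((‖normConst d‖₊ * ∑ j ∈ h.index f, C j : ℝ≥0) : ℝ≥0∞) *
      ∑ j ∈ h.index f, X n j) atTop (𝓝 0) := by
    have h1 : Tendsto (fun n => ∑ j ∈ h.index f, X n j) atTop (𝓝 0) := by
      rw [← Finset.sum_const_zero (s := h.index f) (M := ℝ≥0∞)]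
      refine tendsto_finsetSum _ fun j hj => ?_
      have e1 := ENNReal.Tendsto.mul (hS₁ j hj) (Or.inr ENNReal.zero_ne_top) (hS₂ j hj)
        (Or.inr ENNReal.zero_ne_top)
      have e2 := ENNReal.Tendsto.mul_const (hS₁ j hj) (Or.inr (hT₂ j hj))
      have e3 := ENNReal.Tendsto.const_mul (hS₂ j hj) (Or.inr (hT₁ j hj))
      simpa using (e1.add e2).add e3
    have e := ENNReal.Tendsto.const_mul h1 (Or.inr (ENNReal.coe_ne_top
      (r := ‖normConst d‖₊ * ∑ j ∈ h.index f, C j)))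
    rw [mul_zero] at e
    exact e
  refine tendsto_of_tendsto_of_tendsto_of_le_of_le tendsto_const_nhds hX (fun _ => zero_le)
    fun n => coneNorm_le_iff.2 fun ξ hξ => ?_
  have hp := fun j => h.polyConv (s₁ n).finiteConeNorms (s₂ n).finiteConeNorms j f
  have hp' := fun j => h.polyConv t₁.finiteConeNorms t₂.finiteConeNorms j f
  have hu₁ := (s₁ n).finiteConeNorms.sub t₁.finiteConeNorms
  have hu₂ := (s₂ n).finiteConeNorms.sub t₂.finiteConeNorms
  have e : ∀ j, cutConv (s₁ n).toDistr (s₂ n).toDistr (mulTest f (φ j)) (φ j) ξ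
      - cutConv t₁.toDistr t₂.toDistr (mulTest f (φ j)) (φ j) ξ
      = cutConv (u₁ n) (u₂ n) (mulTest f (φ j)) (φ j) ξ
        + cutConv (u₁ n) t₂.toDistr (mulTest f (φ j)) (φ j) ξ
        + cutConv t₁.toDistr (u₂ n) (mulTest f (φ j)) (φ j) ξ := fun j => by
    exact cutConv_sub (hp j) (hp' j) (h.polyConv hu₁ hu₂ j f) (h.polyConv hu₁ t₂.finiteConeNorms j f)
      (h.polyConv t₁.finiteConeNorms hu₂ j f) ξ
  rw [fourierCut_sub_left, (hQ n).fourierCut_eq_sum h, hP.fourierCut_eq_sum h, ← mul_sub,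
    ← Finset.sum_sub_distrib]
  refine enorm_mul_sum_le (C := C) (b := fun j =>
    (∫⁻ η, ‖fourierCut (u₁ n) (mulTest f (φ j)) (ξ - η)‖ₑ * ‖fourierCut (u₂ n) (φ j) η‖ₑ) +
    (∫⁻ η, ‖fourierCut (u₁ n) (mulTest f (φ j)) (ξ - η)‖ₑ * ‖fourierCut t₂.toDistr (φ j) η‖ₑ) +
    ∫⁻ η, ‖fourierCut t₁.toDistr (mulTest f (φ j)) (ξ - η)‖ₑ * ‖fourierCut (u₂ n) (φ j) η‖ₑ)
    _ _ (fun j _ => ?_) fun j hj => ?_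
  · rw [e]
    exact (enorm_add_le _ _).trans (add_le_add ((enorm_add_le _ _).trans (add_le_add
      (enorm_cutConv_le _ _ _ _ _) (enorm_cutConv_le _ _ _ _ _))) (enorm_cutConv_le _ _ _ _ _))
  · simp only [X, mul_add]
    exact add_le_add (add_le_add (hC _ _ ξ hξ j hj) (hC _ _ ξ hξ j hj)) (hC _ _ ξ hξ j hj)

end Partition

/-! ### The topology of `D'_Γ` -/

/-- The topology tests the distances to every `s`. The choice `s = t` gives one direction; the
triangle inequality, from both sides, gives the other. -/
theorem DPrime.tendsto_iff {Γ : Set (E d × E d)} {u : ℕ → DPrime Γ} {t : DPrime Γ} :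
    Tendsto u atTop (𝓝 t) ↔ TendstoZero Γ fun n => (u n).toDistr - t.toDistr := by
  have key : Tendsto u atTop (𝓝 t) ↔
      (∀ (N : ℕ) (V : Set (E d)) (χ : TestFun d), IsAdmissible Γ V χ → ∀ s : DPrime Γ,
        Tendsto (fun n => coneNorm N V χ ((u n).toDistr - s.toDistr)) atTop
          (𝓝 (coneNorm N V χ (t.toDistr - s.toDistr)))) ∧
      ∀ f : TestFun d, Tendsto (fun n => pairing (u n).toDistr f) atTop
        (𝓝 (pairing t.toDistr f)) := by
    have e : 𝓝 t = _ := @nhds_inf _ (⨅ (N : ℕ) (V : Set (E d)) (χ : TestFun d)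
      (_ : IsAdmissible Γ V χ) (s : DPrime Γ), induced (fun t : DPrime Γ =>
        coneNorm N V χ (t.toDistr - s.toDistr)) inferInstance)
      (⨅ φ : TestFun d, induced (fun t : DPrime Γ => pairing t.toDistr φ) inferInstance) t
    rw [e]
    simp only [nhds_iInf, nhds_induced, tendsto_inf, tendsto_iInf, tendsto_comap_iff,
      Function.comp_def]
  rw [key]
  constructor
  · rintro ⟨h1, h2⟩
    refine ⟨fun f => ?_, fun N V χ hχ => ?_⟩
    · simpa [pairing_sub_left] using (h2 f).sub_const (pairing t.toDistr f)
    · have := h1 N V χ hχ t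
      rwa [coneNorm_sub_self] at this
  · rintro ⟨h1, h2⟩
    refine ⟨fun N V χ hχ s => ?_, fun f => ?_⟩
    · have h0 := h2 N V χ hχ
      have hl := ENNReal.Tendsto.sub (tendsto_const_nhds (x := coneNorm N V χ
        (t.toDistr - s.toDistr)) (f := atTop)) h0 (Or.inr ENNReal.zero_ne_top)
      have hr := (tendsto_const_nhds (x := coneNorm N V χ
        (t.toDistr - s.toDistr)) (f := atTop)).add h0
      rw [tsub_zero] at hl
      rw [add_zero] at hr
      refine tendsto_of_tendsto_of_tendsto_of_le_of_le hl hr (fun n => ?_) fun n => ?_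
      · rw [tsub_le_iff_left, coneNorm_sub_comm N V χ (u n).toDistr t.toDistr]
        exact coneNorm_sub_triangle _ _ _ _ _ _
      · rw [add_comm]
        exact coneNorm_sub_triangle _ _ _ _ _ _
    · have := (h1 f).add_const (pairing t.toDistr f)
      simpa [pairing_sub_left] using this

end Microlocal

/-! ### The main theorem -/

theorem mainTheorem10 (d : ℕ) (Γ₁ Γ₂ : Set (Microlocal.E d × Microlocal.E d))
    (hΓ₁ : Microlocal.IsClosedConic Γ₁) (hΓ₂ : Microlocal.IsClosedConic Γ₂)
    (hΓ : Γ₁ ∩ Microlocal.fiberNeg Γ₂ = ∅) :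
    ∃ P : Microlocal.DPrime Γ₁ → Microlocal.DPrime Γ₂ →
        Microlocal.DPrime (Microlocal.prodCone Γ₁ Γ₂),
      -- `P t₁ t₂` is the unique product of `t₁` and `t₂`
      (∀ t₁ t₂, Microlocal.IsProduct t₁.toDistr t₂.toDistr (P t₁ t₂).toDistr ∧
        ∀ s : Microlocal.Distr d, Microlocal.IsProduct t₁.toDistr t₂.toDistr s →
          s = (P t₁ t₂).toDistr) ∧
      -- boundedness
      (∀ (B₁ : Set (Microlocal.DPrime Γ₁)) (B₂ : Set (Microlocal.DPrime Γ₂)),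
        Microlocal.IsBddIn B₁ → Microlocal.IsBddIn B₂ →
          Microlocal.IsBddIn (Set.image2 P B₁ B₂)) ∧
      -- first bilinear estimate
      (∃ (φ : ℕ → Microlocal.TestFun d) (V₁ V₂ : ℕ → Set (Microlocal.E d)),
        Microlocal.IsConicPartition Γ₁ Γ₂ φ V₁ V₂ ∧
        ∀ (m₁ m₂ N₁ N₂ : ℕ) (χ : Microlocal.TestFun d),
          m₂ + d + 1 ≤ N₁ → m₁ + d + 1 ≤ N₂ → ∃ C : ℝ≥0,
          ∀ (t₁ : Microlocal.DPrime Γ₁) (t₂ : Microlocal.DPrime Γ₂),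
            (∀ j, Microlocal.orderNorm m₁ (Microlocal.mulTest χ (φ j)) t₁.toDistr < ⊤) →
            (∀ j, Microlocal.orderNorm m₂ (Microlocal.mulTest χ (φ j)) t₂.toDistr < ⊤) →
            Microlocal.orderNorm (m₁ + m₂ + d) (Microlocal.mulTest χ χ) (P t₁ t₂).toDistr ≤
              C * ∑' j,
                (Microlocal.orderNorm m₁ (Microlocal.mulTest χ (φ j)) t₁.toDistr +
                  Microlocal.coneNorm N₁ (V₁ j) (Microlocal.mulTest χ (φ j)) t₁.toDistr) *
                (Microlocal.orderNorm m₂ (Microlocal.mulTest χ (φ j)) t₂.toDistr +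
                  Microlocal.coneNorm N₂ (V₂ j) (Microlocal.mulTest χ (φ j)) t₂.toDistr)) ∧
      -- second bilinear estimate
      (∀ (V : Set (Microlocal.E d)) (χ : Microlocal.TestFun d),
        Microlocal.IsAdmissible (Microlocal.prodCone Γ₁ Γ₂) V (Microlocal.mulTest χ χ) →
        ∃ (φ : ℕ → Microlocal.TestFun d) (V₁ V₂ : ℕ → Set (Microlocal.E d)),
          Microlocal.IsConicPartition Γ₁ Γ₂ φ V₁ V₂ ∧
          ∀ m₁ m₂ N : ℕ, m₁ + d + 1 ≤ N → m₂ + d + 1 ≤ N → ∃ C : ℝ≥0,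
            ∀ (t₁ : Microlocal.DPrime Γ₁) (t₂ : Microlocal.DPrime Γ₂),
              Microlocal.orderNorm m₁ χ t₁.toDistr < ⊤ →
              Microlocal.orderNorm m₂ χ t₂.toDistr < ⊤ →
              Microlocal.coneNorm N V (Microlocal.mulTest χ χ) (P t₁ t₂).toDistr ≤
                C * ∑' j,
                  (Microlocal.coneNorm (2 * N) (V₂ j) (Microlocal.mulTest χ (φ j)) t₂.toDistr *
                      Microlocal.orderNorm m₁ (Microlocal.mulTest χ (φ j)) t₁.toDistr +
                    Microlocal.coneNorm (2 * N) (V₁ j) (Microlocal.mulTest χ (φ j)) t₁.toDistr *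
                      Microlocal.orderNorm m₂ (Microlocal.mulTest χ (φ j)) t₂.toDistr +
                    Microlocal.coneNorm (2 * N) (V₁ j) (Microlocal.mulTest χ (φ j)) t₁.toDistr *
                      Microlocal.coneNorm N (V₂ j) (Microlocal.mulTest χ (φ j)) t₂.toDistr)) ∧
      -- joint and separate sequential continuity
      SeqContinuous (fun t : Microlocal.DPrime Γ₁ × Microlocal.DPrime Γ₂ => P t.1 t.2) ∧
      (∀ t₁, SeqContinuous fun t₂ => P t₁ t₂) ∧
      (∀ t₂, SeqContinuous fun t₁ => P t₁ t₂) := by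
  have hex : ∀ (t₁ : Microlocal.DPrime Γ₁) (t₂ : Microlocal.DPrime Γ₂), ∃ P : Microlocal.DPrime (Microlocal.prodCone Γ₁ Γ₂),
      Microlocal.IsLocalProduct Γ₁ Γ₂ t₁.toDistr t₂.toDistr P.toDistr := fun t₁ t₂ => by
    -- Existence tests no direction, hence empty cones. The resulting `IsLocalProduct` does not
    -- mention the partition, so adapted ones can be used for the estimates.
    obtain ⟨φ, U, V₁, V₂, ε, c, h, -⟩ := Microlocal.exists_localPartition hΓ₁ hΓ₂ hΓ (fun _ => ∅)
      (fun _ => Microlocal.isClosedCone_empty) (fun _ _ hv => hv.elim) (fun _ => univ) fun _ => univ_mem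
    obtain ⟨P, hP⟩ := h.exists_distr t₁.finiteConeNorms t₂.finiteConeNorms
    have hloc := h.isLocalProduct t₁.finiteConeNorms t₂.finiteConeNorms hP
    exact ⟨⟨P, hloc.wavefrontSet_subset hΓ₁ hΓ₂ hΓ t₁.finiteConeNorms t₂.finiteConeNorms⟩, hloc⟩
  choose P hP using hex
  have hcont : SeqContinuous
      (fun t : Microlocal.DPrime Γ₁ × Microlocal.DPrime Γ₂ => P t.1 t.2) := by
    intro s t hs
    have hs₁ := Microlocal.DPrime.tendsto_iff.1 ((continuous_fst.tendsto t).comp hs)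
    have hs₂ := Microlocal.DPrime.tendsto_iff.1 ((continuous_snd.tendsto t).comp hs)
    refine Microlocal.DPrime.tendsto_iff.2 ⟨fun f => ?_, fun N V χ hV => ?_⟩
    · obtain ⟨φ, U, V₁, V₂, ε, c, h, -⟩ := Microlocal.exists_localPartition hΓ₁ hΓ₂ hΓ (fun _ => ∅)
        (fun _ => Microlocal.isClosedCone_empty) (fun _ _ hv => hv.elim) (fun _ => univ)
        fun _ => univ_mem
      have hlim := (h.controls_zero f).tendsto_coneNorm hs₁ hs₂ (fun n => hP _ _) (hP t.1 t.2)
      rw [tendsto_zero_iff_enorm_tendsto_zero]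
      refine tendsto_of_tendsto_of_tendsto_of_le_of_le tendsto_const_nhds hlim (fun _ => zero_le)
        fun n => Microlocal.enorm_pairing_le_coneNorm _ _
    · obtain ⟨φ, U, V₁, V₂, W, ε, h, hW⟩ :=
        Microlocal.exists_localPartition_of_isAdmissible hΓ₁ hΓ₂ hΓ hV
      exact (h.controls_cone (fun h0 => hV.1.ne_zero 0 h0 rfl) hW N).tendsto_coneNorm hs₁ hs₂
        (fun n => hP _ _) (hP t.1 t.2)
  refine ⟨P, fun t₁ t₂ => ?_, fun B₁ B₂ hB₁ hB₂ => ⟨fun f => ?_, fun N V χ hV => ?_⟩, ?_, ?_,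
    hcont, fun t₁ => ?_, fun t₂ => ?_⟩
  · have h := (hP t₁ t₂).isProduct hΓ₁ hΓ₂ hΓ t₁.finiteConeNorms t₂.finiteConeNorms
    exact ⟨h, fun s hs => hs.unique h⟩
  · obtain ⟨φ, U, V₁, V₂, ε, c, h, -⟩ := Microlocal.exists_localPartition hΓ₁ hΓ₂ hΓ (fun _ => ∅)
      (fun _ => Microlocal.isClosedCone_empty) (fun _ _ hv => hv.elim) (fun _ => univ)
      fun _ => univ_mem
    obtain ⟨C, hC⟩ := (h.controls_zero f).exists_coneNorm_le_of_bounded hB₁ hB₂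
    refine ⟨C, ?_⟩
    rintro _ ⟨t₁, h₁, t₂, h₂, rfl⟩
    have := (Microlocal.enorm_pairing_le_coneNorm _ f).trans (hC t₁ h₁ t₂ h₂ _ (hP t₁ t₂))
    rw [enorm_le_coe] at this
    exact_mod_cast this
  · obtain ⟨φ, U, V₁, V₂, W, ε, h, hW⟩ :=
      Microlocal.exists_localPartition_of_isAdmissible hΓ₁ hΓ₂ hΓ hV
    obtain ⟨C, hC⟩ := (h.controls_cone (fun h0 => hV.1.ne_zero 0 h0 rfl) hW
      N).exists_coneNorm_le_of_bounded hB₁ hB₂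
    refine ⟨C, ?_⟩
    rintro _ ⟨t₁, h₁, t₂, h₂, rfl⟩
    exact hC t₁ h₁ t₂ h₂ _ (hP t₁ t₂)
  · obtain ⟨φ, U, V₁, V₂, ε, c, h, -⟩ := Microlocal.exists_localPartition hΓ₁ hΓ₂ hΓ (fun _ => ∅)
      (fun _ => Microlocal.isClosedCone_empty) (fun _ _ hv => hv.elim) (fun _ => univ)
      fun _ => univ_mem
    refine ⟨φ, V₁, V₂, h.isConicPartition, fun m₁ m₂ N₁ N₂ χ hN₁ hN₂ => ?_⟩
    obtain ⟨C, hC⟩ := h.exists_orderNorm_le m₁ m₂ N₁ N₂ χ hN₁ hN₂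
    exact ⟨C, fun t₁ t₂ _ _ => hC _ _ _ (hP t₁ t₂)⟩
  · intro V χ hV
    -- `χ` and `χ²` have the same support, and the partition is adapted to the support of `χ`.
    have hV' := Microlocal.isAdmissible_mulTest_self.1 hV
    obtain ⟨φ, U, V₁, V₂, W, ε, h, hW⟩ :=
      Microlocal.exists_localPartition_of_isAdmissible hΓ₁ hΓ₂ hΓ hV'
    refine ⟨φ, V₁, V₂, h.isConicPartition, fun m₁ m₂ N hm₁ hm₂ => ?_⟩
    obtain ⟨C, hC⟩ := h.exists_coneNorm_le (fun h0 => hV.1.ne_zero 0 h0 rfl) hW m₁ m₂ N hm₁ hm₂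
    exact ⟨C, fun t₁ t₂ _ _ => hC _ _ _ (hP t₁ t₂)⟩
  · intro s t hs
    exact hcont (x := fun n => (t₁, s n)) (p := (t₁, t)) (tendsto_const_nhds.prodMk_nhds hs)
  · intro s t hs
    exact hcont (x := fun n => (s n, t₂)) (p := (t, t₂)) (hs.prodMk_nhds tendsto_const_nhds)
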